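/- Let $g(t)=\frac{(t-1)^2}{2(t+1)}$. Let $P$ be a probability measure on $\mathbb{R}^{d_X}\times\mathbb{R}^{d_Y}\times\mathbb{R}^{d_Z}$, the law of $(X,Y,Z)$, such that the supports of $X$, $Y$ and $Z$ are bounded and $P$ has a Lebesgue density that is Hölder continuous (with some positive exponent) on the support of $P$. Assume that the Radon–Nikodym derivative $\rho=\frac{dP_{XY|Z}}{dP_{X|Z}P_{Y|Z}}$ is positive $P_ZP_{X|Z}P_{Y|Z}$-almost everywhere. Let $\varphi\ge 0$ be a bounded measurable function of $(x,y,z)$, and put $$I_\varphi(X;Y|Z)=\mathbb{E}_{P_ZP_{X|Z}P_{Y|Z}}\big[\varphi(X,Y,Z)\,g(\rho)\big].$$ Let $(X_t,Y_t,Z_t)$, $t\ge 1$, be i.i.d. with law $P$. Fix an integer $c_H\ge 1$ and numbers $\epsilon_N>0$ with $\epsilon_N\to 0$ and $N\epsilon_N^{d_X+d_Y+d_Z}\to\infty$. For each $N\ge 1$ let $b_N$ be a random variable with values in $[0,\epsilon_N]$, let $H_1$ map a vector $x$ to the integer vector with coordinates $\lfloor (x_c+b_N)/\epsilon_N\rfloor$,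 let $H_2$ be a random hash function whose values at distinct integer vectors (of any dimension) are independent and uniform on $\{1,\dots,c_HN\}$, and let $H=H_2\circ H_1$; for each $N$, the samples, $b_N$ and $H_2$ are independent (nothing is assumed about the joint law for different $N$). Let $N_{ijk}$ be the number of $t\le N$ with $H(X_t)=i$, $H(Y_t)=j$, $H(Z_t)=k$, let $N_{ik}$, $N_{jk}$, $N_k$ be the corresponding numbers for $(X,Z)$, $(Y,Z)$ and $Z$, and let $r_{ijk},r_{ik},r_{jk},r_k$ be these numbers divided by $N$. The hash-based estimator is $$\widehat I_\varphi(X;Y|Z)=\sum_{(i,j,k):\,N_{ijk}>0}\varphi(i,j,k)\,\frac{r_{ik}r_{jk}}{r_k}\,g\!\left(\frac{r_{ijk}r_k}{r_{ik}r_{jk}}\right).$$ Then, as $N\to\infty$, $\widehat I_\varphi(X;Y|Z)\to I_\varphi(X;Y|Z)$ almost surely, where $\varphi(i,j,k)$ is the mean of $\varphi$ over the sample points $(X_t,Y_t,Z_t)$, $t\le N$, with labels $(i,j,k)$. If moreover $\varphi$ is continuous at $P$-almost every point, then almost surely the same convergence holds for every choice of the weights $\varphi(i,j,k)$ as a value $\varphi(x,y,z)$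 at a point such that $x$, $y$, $z$ lie in cells of $H_1$ that contain a sample point $X_s$, $Y_t$, $Z_u$ respectively ($s,t,u\le N$) and that $H_2$ sends to $i$, $j$, $k$. -/

import Mathlib

open MeasureTheory ProbabilityTheory Filter Topology
open scoped NNReal ENNReal

noncomputable section

/-- The Euclidean space of dimension `d`. -/
abbrev Euc (d : ℕ) : Type := EuclideanSpace ℝ (Fin d)

/-- The function `g(t) = (t - 1)² / (2 (t + 1))`. -/
def gFun (t : ℝ) : ℝ := (t - 1) ^ 2 / (2 * (t + 1))

section Target

variable {dX dY dZ : ℕ}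

/-- The marginal law of `Z` under the joint law `P` of `(X, Y, Z)`. -/
def lawZ (P : Measure (Euc dX × Euc dY × Euc dZ)) : Measure (Euc dZ) :=
  P.map (fun p => p.2.2)

/-- The conditional law of `(X, Y)` given `Z`. -/
def condXY (P : Measure (Euc dX × Euc dY × Euc dZ)) [IsProbabilityMeasure P] :
    Kernel (Euc dZ) (Euc dX × Euc dY) :=
  condDistrib (fun p : Euc dX × Euc dY × Euc dZ => (p.1, p.2.1)) (fun p => p.2.2) P

/-- The product, for each value of `Z`, of the conditional laws of `X` and of `Y` given `Z`. -/
def condProd (P : Measure (Euc dX × Euc dY × Euc dZ)) [IsProbabilityMeasure P] :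
    Kernel (Euc dZ) (Euc dX × Euc dY) :=
  condDistrib (fun p : Euc dX × Euc dY × Euc dZ => p.1) (fun p => p.2.2) P ×ₖ
    condDistrib (fun p : Euc dX × Euc dY × Euc dZ => p.2.1) (fun p => p.2.2) P

/-- The measure `P_Z P_{X|Z} P_{Y|Z}`, on triples written as `(z, (x, y))`. -/
def refMeasure (P : Measure (Euc dX × Euc dY × Euc dZ)) [IsProbabilityMeasure P] :
    Measure (Euc dZ × (Euc dX × Euc dY)) :=
  lawZ P ⊗ₘ condProd P

/-- The Radon-Nikodym derivative `dP_{XY|Z} / d(P_{X|Z} P_{Y|Z})` at `(z, (x, y))`. -/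
def condRatio (P : Measure (Euc dX × Euc dY × Euc dZ)) [IsProbabilityMeasure P]
    (p : Euc dZ × (Euc dX × Euc dY)) : ℝ≥0∞ :=
  Kernel.rnDeriv (condXY P) (condProd P) p.1 p.2

/-- The adaptive conditional mutual information `I_φ(X;Y|Z)`. -/
def acmi (P : Measure (Euc dX × Euc dY × Euc dZ)) [IsProbabilityMeasure P]
    (φ : Euc dX × Euc dY × Euc dZ → ℝ) : ℝ :=
  ∫ p, φ (p.2.1, p.2.2, p.1) * gFun (condRatio P p).toReal ∂(refMeasure P)

end Target

section Estimator

/-- The quantizer `H₁` with bin width `ε` and shift `b`, on points of any dimension: the output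
is an integer vector, paired with its dimension. -/
def cell (ε b : ℝ) {d : ℕ} (x : Euc d) : Σ d : ℕ, Fin d → ℤ :=
  ⟨d, fun c => ⌊(x c + b) / ε⌋⟩

/-- The labels of the first `N` points `x 0, …, x (N - 1)` under `H = H₂ ∘ H₁`. -/
def label (ε b : ℝ) (h : (Σ d : ℕ, Fin d → ℤ) → ℕ) {d : ℕ} (x : ℕ → Euc d) (t : ℕ) : ℕ :=
  h (cell ε b (x t))

/-- The union of those cells of `H₁` that contain one of `x 0, …, x (N - 1)` and that `H₂` sends
to the label `i`. -/
def bucket (ε b : ℝ) (h : (Σ d : ℕ, Fin d → ℤ) → ℕ) (N : ℕ) {d : ℕ} (x : ℕ → Euc d) (i : ℕ) :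
    Set (Euc d) :=
  {y | (∃ t < N, cell ε b y = cell ε b (x t)) ∧ h (cell ε b y) = i}

variable (N : ℕ) (u v s : ℕ → ℕ)

/-- The samples on the edge `(i, j, k)`: those `t < N` with labels `u t = i`, `v t = j`,
`s t = k`. -/
def edgeSamples (i j k : ℕ) : Finset ℕ :=
  (Finset.range N).filter (fun t => u t = i ∧ v t = j ∧ s t = k)

/-- The ratio `r_{ijk} = N_{ijk} / N`. -/
def ratio3 (i j k : ℕ) : ℝ := ((edgeSamples N u v s i j k).card : ℝ) / N

/-- The ratio of samples with two prescribed labels (`r_{ik}` and `r_{jk}`). -/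
def ratio2 (i k : ℕ) : ℝ :=
  (((Finset.range N).filter (fun t => u t = i ∧ s t = k)).card : ℝ) / N

/-- The ratio `r_k = N_k / N`. -/
def ratio1 (k : ℕ) : ℝ :=
  (((Finset.range N).filter (fun t => s t = k)).card : ℝ) / N

/-- The edges of the dependence graph: the triples `(i, j, k)` with `N_{ijk} > 0`. -/
def edges : Finset (ℕ × ℕ × ℕ) :=
  (Finset.range N).image (fun t => (u t, v t, s t))

/-- The estimator computed from the labels `u`, `v`, `s` of the `X`-, `Y`- and `Z`-samples, where
`w i j k` is the weight `φ(i, j, k)` of an edge. -/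
def hashEstimator (w : ℕ → ℕ → ℕ → ℝ) : ℝ :=
  ∑ e ∈ edges N u v s,
    w e.1 e.2.1 e.2.2 *
      (ratio2 N u s e.1 e.2.2 * ratio2 N v s e.2.1 e.2.2 / ratio1 N s e.2.2) *
      gFun (ratio3 N u v s e.1 e.2.1 e.2.2 * ratio1 N s e.2.2 /
        (ratio2 N u s e.1 e.2.2 * ratio2 N v s e.2.1 e.2.2))

/-- The edge weight given by the mean, over the samples on the edge, of the values `a t` attached
to the samples. -/
def meanWeight (a : ℕ → ℝ) (i j k : ℕ) : ℝ :=
  (∑ t ∈ edgeSamples N u v s i j k, a t) / (edgeSamples N u v s i j k).card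

end Estimator

end

/-! Let G(p, q) = (p - q)² / (2(p + q)) be the perspective of g. It is symmetric, so p g(q/p) = q
g(p/q), it is Lipschitz, and it is at most (p + q)/2. If f is the density of P and Qf = f_XZ f_YZ /
f_Z is its conditionally independent counterpart, then I_φ = ∫ φ G(f, Qf) (`acmi_eq_integral`).
Computed from cells instead of labels, the estimator is ∫ f̂ w g(Qf̂/f̂) for the histogram f̂ with
cubes of side ε_N (`integral_hist_mul_gFun`). What remains is continuity of this functional in L¹,
consistency of f̂ in L¹, and harmlessness of hash collisions.

Continuity (`tendsto_integral_functional`): f ↦ Qf is 3-Lipschitz in L¹, with no lower bound on the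
density. The difficulty is that empty cells are dropped and that the weights are controlled only
against f̂. Positivity of ρ makes Qf vanish a.e. where f does, so G(f, Qf) ≤ K f up to an excess
whose integral tends to 0 as K → ∞.

Consistency (`ae_tendsto_lintegral_hist_sub`): the bias vanishes because averages over small cells
converge in L¹, uniformly over partitions, hence over shifts. The total deviation over cells is a
maximum over 2^(number of cells) sign patterns of centred sums of bounded i.i.d. variables.
Hoeffding's inequality beats the union bound since the number of cells is o(N), and Borel–Cantelli
needs no relation between different N. The shift is frozen by independence.

Collisions: an exponential moment shows that a.s. only o(ε^(-d)) collisions occur among the cells of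
a box (`ae_tendsto_collisions_mul`). The merged cells thus have vanishing volume, hence vanishing
probability by absolute continuity, hence contain a vanishing fraction of the samples
(`tendsto_cnt_merged_div`). The ratios at these samples may be large. But by the symmetry of G the
estimator is a sample mean of weights times g of a ratio (`hashEstimator_eq_sampleEstimator`), g(s)
≤ (1 + s)/2, and ratios summed over a union of label classes do not exceed its size
(`sum_depRatio_le`). So merging costs at most a multiple of the merged fraction
(`abs_sampleEstimator_sub_le`).

Weights: away from merged cells, mean weights are quotients of two consistent histograms. Weights by
values are values of φ in the same cell, close to φ off a set of small probability when φ is a.e.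
continuous. -/

noncomputable section

/-! ### The perspective of g and its Lipschitz bound. -/

/-- The perspective `G(p, q) = (p - q)² / (2 (p + q))` of `gFun`. -/
def gPersp (p q : ℝ) : ℝ := (p - q) ^ 2 / (2 * (p + q))

lemma gPersp_nonneg {p q : ℝ} (hp : 0 ≤ p) (hq : 0 ≤ q) : 0 ≤ gPersp p q := by
  unfold gPersp; positivity

lemma gPersp_le {p q : ℝ} (hp : 0 ≤ p) (hq : 0 ≤ q) : gPersp p q ≤ (p + q) / 2 := by
  unfold gPersp
  rcases eq_or_lt_of_le (add_nonneg hp hq) with h | h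
  · rw [← h]; simp
  · rw [div_le_iff₀ (by positivity)]
    nlinarith [mul_nonneg hp hq]

lemma gPersp_comm (p q : ℝ) : gPersp p q = gPersp q p := by
  unfold gPersp; rw [add_comm p q]; ring

/-- Positivity of p matters: at p = 0 the left side is 0 while G(0, q) = q/2. This gap is the
contribution of the empty cells that the estimator drops. -/
lemma mul_gFun_div {p q : ℝ} (hp : 0 < p) : p * gFun (q / p) = gPersp p q := by
  unfold gFun gPersp
  have h1 : q / p - 1 = (q - p) / p := by field_simp
  have h2 : q / p + 1 = (q + p) / p := by field_simp
  rw [h1, h2]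
  rcases eq_or_ne (q + p) 0 with h | h
  · rw [h, add_comm p q, h]; simp
  · rw [add_comm p q]; field_simp; ring

lemma gFun_nonneg {s : ℝ} (hs : 0 ≤ s) : 0 ≤ gFun s := by
  unfold gFun; positivity

lemma gFun_le {s : ℝ} (hs : 0 ≤ s) : gFun s ≤ (1 + s) / 2 := by
  have := gPersp_le zero_le_one hs
  rwa [← mul_gFun_div one_pos, one_mul, div_one] at this

lemma gPersp_eq {p q : ℝ} :
    gPersp p q = (p + q) / 2 - 2 * (p * (q / (p + q))) := by
  unfold gPersp
  rcases eq_or_ne (p + q) 0 with h | h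
  · rw [h]; simp
  · field_simp; ring

/-- The derivative of p ↦ pq/(p + q) is (q/(p + q))², which lies in [0, 1]; the difference quotient
is the product of two such factors. -/
lemma harmonic_mono {p p' q : ℝ} (hp : 0 ≤ p) (hq : 0 ≤ q) (h : p ≤ p') :
    p * (q / (p + q)) ≤ p' * (q / (p' + q)) ∧
      p' * (q / (p' + q)) ≤ p * (q / (p + q)) + (p' - p) := by
  rcases eq_or_lt_of_le hq with rfl | hq'
  · simp [h]
  · have h1 : 0 < p + q := by positivity
    have h2 : 0 < p' + q := by linarith
    have key : p' * (q / (p' + q)) - p * (q / (p + q)) = (p' - p) * (q / (p' + q) * (q / (p + q))) := by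
      field_simp; ring
    have e1 : q / (p' + q) ≤ 1 := by rw [div_le_one h2]; linarith
    have e2 : q / (p + q) ≤ 1 := by rw [div_le_one h1]; linarith
    have e3 : 0 ≤ q / (p' + q) := by positivity
    have e4 : 0 ≤ q / (p + q) := by positivity
    have e5 := mul_le_one₀ e1 e4 e2
    have e6 := mul_nonneg e3 e4
    constructor <;> nlinarith

/-- The slope of G in p is 1/2 minus twice a number in [0, 1], hence between -3/2 and 1/2. -/
lemma abs_gPersp_sub_left {p p' q : ℝ} (hp : 0 ≤ p) (hp' : 0 ≤ p') (hq : 0 ≤ q) :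
    |gPersp p q - gPersp p' q| ≤ 3 / 2 * |p - p'| := by
  wlog h : p' ≤ p generalizing p p'
  · rw [abs_sub_comm, abs_sub_comm p]; exact this hp' hp (le_of_not_ge h)
  rw [gPersp_eq, gPersp_eq, abs_of_nonneg (sub_nonneg.2 h), abs_le]
  obtain ⟨h1, h2⟩ := harmonic_mono hp' hq h
  constructor <;> linarith

lemma abs_gPersp_sub_le {p p' q q' : ℝ} (hp : 0 ≤ p) (hp' : 0 ≤ p') (hq : 0 ≤ q) (hq' : 0 ≤ q') :
    |gPersp p q - gPersp p' q'| ≤ 3 / 2 * (|p - p'| + |q - q'|) := by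
  have h1 := abs_gPersp_sub_left hp hp' hq
  have h2 := abs_gPersp_sub_left hq hq' hp'
  rw [gPersp_comm q, gPersp_comm q'] at h2
  calc _ ≤ |gPersp p q - gPersp p' q| + |gPersp p' q - gPersp p' q'| := abs_sub_le _ _ _
    _ ≤ _ := by linarith

lemma measurable_gFun : Measurable gFun := by
  unfold gFun; fun_prop

lemma measurable_gPersp : Measurable (fun p : ℝ × ℝ => gPersp p.1 p.2) := by
  unfold gPersp; fun_prop

/-! ### Products of margins as a Lipschitz operation in L¹. -/

section Product

variable {α β γ : Type*} [MeasurableSpace α] [MeasurableSpace β] [MeasurableSpace γ]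

/-- The product of the two marginals of a density on a product space, normalized by the total
mass. -/
def marginProd (μ : Measure α) (ν : Measure β) (a : α × β → ℝ) (p : α × β) : ℝ :=
  (∫ y, a (p.1, y) ∂ν) * (∫ x, a (x, p.2) ∂μ) / ∫ q, a q ∂(μ.prod ν)

/-- Telescoping arranged so that each difference meets only the normalized margins a2/a0 and b1/b0,
which have mass at most one. The hypotheses on zeros make the convention x/0 = 0 compatible with the
identity. -/
lemma marginProd_pointwise {a0 a1 a2 b0 b1 b2 : ℝ} (ha0 : 0 ≤ a0)
    (ha2 : 0 ≤ a2) (hb0 : 0 ≤ b0) (hb1 : 0 ≤ b1)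
    (ha : a0 = 0 → a2 = 0) (hb : b0 = 0 → b1 = 0) :
    |a1 * a2 / a0 - b1 * b2 / b0| ≤
      |a1 - b1| * (a2 / a0) + (b1 / b0) * (|a0 - b0| * (a2 / a0)) + (b1 / b0) * |a2 - b2| := by
  rcases eq_or_ne b0 0 with h0 | h0
  · rw [h0, hb h0]
    simp only [div_zero, sub_zero, zero_mul, add_zero]
    rw [mul_div_assoc, abs_mul, abs_of_nonneg (div_nonneg ha2 ha0)]
  have e : a1 * a2 / a0 - b1 * b2 / b0
      = (a1 - b1) * (a2 / a0) + (b1 / b0) * ((b0 - a0) * (a2 / a0)) + (b1 / b0) * (a2 - b2) := by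
    rcases eq_or_ne a0 0 with h | h
    · rw [h, ha h]; simp; ring
    · field_simp; ring
  rw [e]
  have n1 : 0 ≤ a2 / a0 := div_nonneg ha2 ha0
  have n2 : 0 ≤ b1 / b0 := div_nonneg hb1 hb0
  refine (abs_add_three _ _ _).trans ?_
  rw [abs_mul, abs_mul, abs_mul, abs_mul, abs_of_nonneg n1, abs_of_nonneg n2, abs_sub_comm b0]

variable {μ : Measure α} {ν : Measure β} [SigmaFinite μ] [SigmaFinite ν]

lemma lintegral_margin_sub_le {a b : α × β → ℝ} (ha : Integrable a (μ.prod ν))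
    (hb : Integrable b (μ.prod ν)) :
    ∫⁻ x, ‖∫ y, a (x, y) ∂ν - ∫ y, b (x, y) ∂ν‖ₑ ∂μ ≤ ∫⁻ p, ‖a p - b p‖ₑ ∂(μ.prod ν) := by
  have m : AEMeasurable (fun p => ‖a p - b p‖ₑ) (μ.prod ν) := (ha.sub hb).aestronglyMeasurable.enorm
  rw [lintegral_prod _ m]
  refine lintegral_mono_ae ?_
  filter_upwards [ha.prod_right_ae, hb.prod_right_ae] with x hx hx'
  rw [← integral_sub hx hx']
  exact enorm_integral_le_lintegral_enorm _

lemma lintegral_enorm_margin {a : α × β → ℝ} (ha : Integrable a (μ.prod ν)) (h0 : ∀ p, 0 ≤ a p) :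
    ∫⁻ x, ‖∫ y, a (x, y) ∂ν‖ₑ ∂μ = ‖∫ p, a p ∂(μ.prod ν)‖ₑ := by
  have e : ∀ x, ‖∫ y, a (x, y) ∂ν‖ₑ = ENNReal.ofReal (∫ y, a (x, y) ∂ν) := fun x =>
    Real.enorm_of_nonneg (integral_nonneg fun y => h0 _)
  simp_rw [e]
  rw [← ofReal_integral_eq_lintegral_ofReal ha.integral_prod_left
    (Eventually.of_forall fun x => integral_nonneg fun y => h0 _), integral_prod _ ha,
    Real.enorm_of_nonneg (integral_nonneg fun x => integral_nonneg fun y => h0 _)]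

/-- The normalized product of the marginals depends on the density in a Lipschitz way in `L¹`. -/
lemma lintegral_marginProd_sub_le {a b : α × β → ℝ} (ha : Integrable a (μ.prod ν))
    (hb : Integrable b (μ.prod ν)) (ha0 : ∀ p, 0 ≤ a p) (hb0 : ∀ p, 0 ≤ b p) :
    ∫⁻ p, ‖marginProd μ ν a p - marginProd μ ν b p‖ₑ ∂(μ.prod ν) ≤
      3 * ∫⁻ p, ‖a p - b p‖ₑ ∂(μ.prod ν) := by
  have ha' : Integrable (fun p : β × α => a p.swap) (ν.prod μ) := ha.swap
  have hb' : Integrable (fun p : β × α => b p.swap) (ν.prod μ) := hb.swap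
  set A := ∫ q, a q ∂(μ.prod ν) with hA
  set B := ∫ q, b q ∂(μ.prod ν) with hB
  set a1 : α → ℝ := fun x => ∫ y, a (x, y) ∂ν with ha1
  set b1 : α → ℝ := fun x => ∫ y, b (x, y) ∂ν with hb1
  set a2 : β → ℝ := fun y => ∫ x, a (x, y) ∂μ with ha2
  set b2 : β → ℝ := fun y => ∫ x, b (x, y) ∂μ with hb2
  have ia1 : Integrable a1 μ := ha.integral_prod_left
  have ib1 : Integrable b1 μ := hb.integral_prod_left
  have ia2 : Integrable a2 ν := ha'.integral_prod_left
  have ib2 : Integrable b2 ν := hb'.integral_prod_left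
  have A0 : 0 ≤ A := integral_nonneg ha0
  have B0 : 0 ≤ B := integral_nonneg hb0
  set d := ∫⁻ p, ‖a p - b p‖ₑ ∂(μ.prod ν) with hd
  have d1 : ∫⁻ x, ‖a1 x - b1 x‖ₑ ∂μ ≤ d := lintegral_margin_sub_le ha hb
  have d2 : ∫⁻ y, ‖a2 y - b2 y‖ₑ ∂ν ≤ d := by
    refine (lintegral_margin_sub_le ha' hb').trans (le_of_eq ?_)
    rw [hd, ← lintegral_prod_swap]
    simp only [Prod.swap_swap]
  have d0 : ‖A - B‖ₑ ≤ d := by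
    rw [hA, hB, ← integral_sub ha hb]
    exact enorm_integral_le_lintegral_enorm _
  have m2 : ∫⁻ y, ‖a2 y‖ₑ ∂ν = ‖A‖ₑ := by
    refine (lintegral_enorm_margin ha' fun p => ha0 _).trans ?_
    rw [hA, ← integral_prod_swap]
    simp only [Prod.swap_swap]
  have m1 : ∫⁻ x, ‖b1 x‖ₑ ∂μ = ‖B‖ₑ := lintegral_enorm_margin hb hb0
  -- The mass is 1, or 0 when A = 0; this keeps the Lipschitz constant absolute.
  have r2 : ∫⁻ y, ‖a2 y / A‖ₑ ∂ν ≤ 1 := by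
    simp_rw [div_eq_mul_inv, enorm_mul]
    rw [lintegral_mul_const'' _ ia2.aestronglyMeasurable.enorm, m2, ← enorm_mul, ← div_eq_mul_inv]
    rcases eq_or_ne A 0 with h | h
    · simp [h]
    · simp [div_self h]
  have r1 : ∫⁻ x, ‖b1 x / B‖ₑ ∂μ ≤ 1 := by
    simp_rw [div_eq_mul_inv, enorm_mul]
    rw [lintegral_mul_const'' _ ib1.aestronglyMeasurable.enorm, m1, ← enorm_mul, ← div_eq_mul_inv]
    rcases eq_or_ne B 0 with h | h
    · simp [h]
    · simp [div_self h]
  have z2 : ∀ᵐ p ∂(μ.prod ν), A = 0 → a2 p.2 = 0 := by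
    by_cases h : A = 0
    · have : ∀ᵐ y ∂ν, a2 y = 0 := by
        rw [h, enorm_zero, lintegral_eq_zero_iff' ia2.aestronglyMeasurable.enorm] at m2
        filter_upwards [m2] with y hy using by simpa using hy
      filter_upwards [Measure.quasiMeasurePreserving_snd.ae this] with p hp _ using hp
    · exact Eventually.of_forall fun p hp => absurd hp h
  have z1 : ∀ᵐ p ∂(μ.prod ν), B = 0 → b1 p.1 = 0 := by
    by_cases h : B = 0
    · have : ∀ᵐ y ∂μ, b1 y = 0 := by
        rw [h, enorm_zero, lintegral_eq_zero_iff' ib1.aestronglyMeasurable.enorm] at m1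
        filter_upwards [m1] with y hy using by simpa using hy
      filter_upwards [Measure.quasiMeasurePreserving_fst.ae this] with p hp _ using hp
    · exact Eventually.of_forall fun p hp => absurd hp h
  have e1 := ia1.aestronglyMeasurable.enorm
  have e2 := ia2.aestronglyMeasurable.enorm
  have s1 : AEMeasurable (fun x => ‖a1 x - b1 x‖ₑ) μ := (ia1.sub ib1).aestronglyMeasurable.enorm
  have s2 : AEMeasurable (fun x => ‖a2 x - b2 x‖ₑ) ν := (ia2.sub ib2).aestronglyMeasurable.enorm
  have q2 := (ia2.div_const A).aestronglyMeasurable.enorm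
  have q1 := (ib1.div_const B).aestronglyMeasurable.enorm
  calc ∫⁻ p, ‖marginProd μ ν a p - marginProd μ ν b p‖ₑ ∂(μ.prod ν)
      ≤ ∫⁻ p, (‖a1 p.1 - b1 p.1‖ₑ * ‖a2 p.2 / A‖ₑ
          + ‖b1 p.1 / B‖ₑ * (‖A - B‖ₑ * ‖a2 p.2 / A‖ₑ)
          + ‖b1 p.1 / B‖ₑ * ‖a2 p.2 - b2 p.2‖ₑ) ∂(μ.prod ν) := by
        refine lintegral_mono_ae ?_
        filter_upwards [z1, z2] with p h1 h2
        have n2 : 0 ≤ a2 p.2 := integral_nonneg fun x => ha0 _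
        have n1 : 0 ≤ b1 p.1 := integral_nonneg fun x => hb0 _
        have key := marginProd_pointwise (a1 := a1 p.1) (b2 := b2 p.2) A0 n2 B0 n1 h2 h1
        have := ENNReal.ofReal_le_ofReal key
        rw [← Real.enorm_eq_ofReal_abs] at this
        refine this.trans (le_of_eq ?_)
        have p1 : 0 ≤ a2 p.2 / A := div_nonneg n2 A0
        have p2 : 0 ≤ b1 p.1 / B := div_nonneg n1 B0
        rw [ENNReal.ofReal_add (by positivity) (by positivity),
          ENNReal.ofReal_add (by positivity) (by positivity),
          ENNReal.ofReal_mul (by positivity), ENNReal.ofReal_mul (by positivity),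
          ENNReal.ofReal_mul (by positivity), ENNReal.ofReal_mul (by positivity),
          ← Real.enorm_eq_ofReal_abs, ← Real.enorm_eq_ofReal_abs, ← Real.enorm_eq_ofReal_abs,
          ← Real.enorm_of_nonneg p1, ← Real.enorm_of_nonneg p2]
    _ = (∫⁻ x, ‖a1 x - b1 x‖ₑ ∂μ) * (∫⁻ y, ‖a2 y / A‖ₑ ∂ν)
        + (∫⁻ x, ‖b1 x / B‖ₑ ∂μ) * (‖A - B‖ₑ * ∫⁻ y, ‖a2 y / A‖ₑ ∂ν)
        + (∫⁻ x, ‖b1 x / B‖ₑ ∂μ) * ∫⁻ y, ‖a2 y - b2 y‖ₑ ∂ν := by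
        have t2 : AEMeasurable (fun p : α × β =>
            ‖b1 p.1 / B‖ₑ * (‖A - B‖ₑ * ‖a2 p.2 / A‖ₑ)) (μ.prod ν) :=
          q1.comp_fst.mul (q2.comp_snd.const_mul _)
        have t3 : AEMeasurable (fun p : α × β =>
            ‖b1 p.1 / B‖ₑ * ‖a2 p.2 - b2 p.2‖ₑ) (μ.prod ν) :=
          q1.comp_fst.mul s2.comp_snd
        rw [lintegral_add_right' _ t3, lintegral_add_right' _ t2,
          lintegral_prod_mul s1 q2, lintegral_prod_mul q1 (q2.const_mul _),
          lintegral_const_mul'' _ q2, lintegral_prod_mul q1 s2]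
    -- One d for each margin and one for the normalizing mass.
    _ ≤ d * 1 + 1 * (d * 1) + 1 * d := by gcongr
    _ = 3 * d := by ring

omit [SigmaFinite μ] [SigmaFinite ν] in
lemma marginProd_nonneg {a : α × β → ℝ} (ha : ∀ p, 0 ≤ a p) (p : α × β) :
    0 ≤ marginProd μ ν a p :=
  div_nonneg (mul_nonneg (integral_nonneg fun _ => ha _) (integral_nonneg fun _ => ha _))
    (integral_nonneg fun _ => ha _)

end Product

/-! ### The divergence functional of a density and its continuity in L¹. -/

section Cond

variable {α β γ : Type*} [MeasurableSpace α] [MeasurableSpace β] [MeasurableSpace γ]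

/-- The density of the law under which `X` and `Y` are conditionally independent given `Z`, with
the same laws of `(X, Z)` and `(Y, Z)` as under the density `a`. -/
def condIndepDensity (μ : Measure α) (ν : Measure β) (a : α × β × γ → ℝ) (p : α × β × γ) : ℝ :=
  marginProd μ ν (fun q => a (q.1, q.2, p.2.2)) (p.1, p.2.1)

variable {μ : Measure α} {ν : Measure β} {ξ : Measure γ} [SigmaFinite μ] [SigmaFinite ν]
  [SigmaFinite ξ]

omit [MeasurableSpace γ] [SigmaFinite μ] [SigmaFinite ν] in
lemma condIndepDensity_nonneg {a : α × β × γ → ℝ} (ha : ∀ p, 0 ≤ a p) (p : α × β × γ) :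
    0 ≤ condIndepDensity μ ν a p :=
  marginProd_nonneg (fun _ => ha _) _

lemma measurable_condIndepDensity {a : α × β × γ → ℝ} (ha : Measurable a) :
    Measurable (condIndepDensity μ ν a) := by
  unfold condIndepDensity marginProd
  refine Measurable.div (Measurable.mul ?_ ?_) ?_
  · have : StronglyMeasurable (fun r : (α × β × γ) × β => a (r.1.1, r.2, r.1.2.2)) :=
      Measurable.stronglyMeasurable (by fun_prop)
    exact this.integral_prod_right'.measurable
  · have : StronglyMeasurable (fun r : (α × β × γ) × α => a (r.2, r.1.2.1, r.1.2.2)) :=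
      Measurable.stronglyMeasurable (by fun_prop)
    exact this.integral_prod_right'.measurable
  · have : StronglyMeasurable (fun r : (α × β × γ) × (α × β) => a (r.2.1, r.2.2, r.1.2.2)) :=
      Measurable.stronglyMeasurable (by fun_prop)
    exact this.integral_prod_right'.measurable

lemma lintegral_prod_assoc {F : α × β × γ → ℝ≥0∞} (hF : Measurable F) :
    ∫⁻ p, F p ∂(μ.prod (ν.prod ξ)) = ∫⁻ z, ∫⁻ q : α × β, F (q.1, q.2, z) ∂(μ.prod ν) ∂ξ := by
  rw [← (measurePreserving_prodAssoc μ ν ξ).map_eq,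
    lintegral_map hF MeasurableEquiv.prodAssoc.measurable]
  exact lintegral_prod_symm' _ (hF.comp MeasurableEquiv.prodAssoc.measurable)

lemma Integrable.slice_ae {a : α × β × γ → ℝ} (ha : Integrable a (μ.prod (ν.prod ξ))) :
    ∀ᵐ z ∂ξ, Integrable (fun q : α × β => a (q.1, q.2, z)) (μ.prod ν) := by
  have h := ((measurePreserving_prodAssoc μ ν ξ).integrable_comp_emb
    MeasurableEquiv.prodAssoc.measurableEmbedding).2 ha
  exact h.prod_left_ae

/-- The two-margin bound holds on almost every slice with z fixed; integrate over z. -/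
lemma lintegral_condIndepDensity_sub_le {a b : α × β × γ → ℝ} (ma : Measurable a)
    (mb : Measurable b) (ha : Integrable a (μ.prod (ν.prod ξ)))
    (hb : Integrable b (μ.prod (ν.prod ξ))) (ha0 : ∀ p, 0 ≤ a p) (hb0 : ∀ p, 0 ≤ b p) :
    ∫⁻ p, ‖condIndepDensity μ ν a p - condIndepDensity μ ν b p‖ₑ ∂(μ.prod (ν.prod ξ)) ≤
      3 * ∫⁻ p, ‖a p - b p‖ₑ ∂(μ.prod (ν.prod ξ)) := by
  have m1 : Measurable fun p => ‖condIndepDensity μ ν a p - condIndepDensity μ ν b p‖ₑ :=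
    ((measurable_condIndepDensity ma).sub (measurable_condIndepDensity mb)).enorm
  have m2 : Measurable fun p => ‖a p - b p‖ₑ := (ma.sub mb).enorm
  rw [lintegral_prod_assoc m1, lintegral_prod_assoc m2, ← lintegral_const_mul'' _
      (Measurable.aemeasurable ?_)]
  · refine lintegral_mono_ae ?_
    filter_upwards [Integrable.slice_ae ha, Integrable.slice_ae hb] with z hz hz'
    exact lintegral_marginProd_sub_le hz hz' (fun _ => ha0 _) (fun _ => hb0 _)
  · have : Measurable (fun r : γ × (α × β) => ‖a (r.2.1, r.2.2, r.1) - b (r.2.1, r.2.2, r.1)‖ₑ) :=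
      by fun_prop
    exact this.lintegral_prod_right'

lemma integrable_condIndepDensity {a : α × β × γ → ℝ} (ma : Measurable a)
    (ha : Integrable a (μ.prod (ν.prod ξ))) (ha0 : ∀ p, 0 ≤ a p) :
    Integrable (condIndepDensity μ ν a) (μ.prod (ν.prod ξ)) := by
  refine ⟨(measurable_condIndepDensity ma).aestronglyMeasurable, ?_⟩
  have h := lintegral_condIndepDensity_sub_le ma measurable_zero ha (integrable_zero _ _ _) ha0
    (fun _ => le_rfl)
  have z : condIndepDensity μ ν (0 : α × β × γ → ℝ) = 0 := by
    funext p; simp [condIndepDensity, marginProd]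
  simp only [z, Pi.zero_apply, sub_zero] at h
  exact h.trans_lt (ENNReal.mul_lt_top (by simp) ha.2)

-- Dominated convergence: where f > 0 the excess is zero once K ≥ G/f, and where f = 0 so is G. It
-- allows G to be replaced by a multiple of f, against which weights can be compared.
omit [SigmaFinite μ] in
lemma tendsto_lintegral_excess {f G : α → ℝ} (mf : Measurable f) (mG : Measurable G)
    (hf : ∀ p, 0 ≤ f p) (hG : Integrable G μ) (hac : ∀ᵐ p ∂μ, f p = 0 → G p = 0) :
    Tendsto (fun K : ℕ => ∫⁻ p, ENNReal.ofReal (G p - K * f p) ∂μ) atTop (𝓝 0) := by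
  have h0 : (0 : ℝ≥0∞) = ∫⁻ _, 0 ∂μ := by simp
  rw [h0]
  refine tendsto_lintegral_of_dominated_convergence (fun p => ‖G p‖ₑ) (fun K => by fun_prop)
    (fun K => Eventually.of_forall fun p => ?_) hG.2.ne ?_
  · simp only [Real.enorm_eq_ofReal_abs]
    refine ENNReal.ofReal_le_ofReal ?_
    have := mul_nonneg (Nat.cast_nonneg (α := ℝ) K) (hf p)
    linarith [le_abs_self (G p)]
  · filter_upwards [hac] with p hp
    rcases eq_or_lt_of_le (hf p) with h | h
    · simp [← h, hp h.symm]
    · refine tendsto_const_nhds.congr' ?_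
      obtain ⟨K, hK⟩ := exists_nat_ge (G p / f p)
      filter_upwards [eventually_ge_atTop K] with K' hK'
      symm
      rw [ENNReal.ofReal_eq_zero, sub_nonpos]
      rw [div_le_iff₀ h] at hK
      refine hK.trans ?_
      gcongr

/-- Setting the weight to 0 where fh = 0 makes the left integrand a weight times G(fh, qh), to which
the Lipschitz bound applies. The error of the new weight is controlled only against fh, so G(f, q)
is first bounded by K f plus its excess, and f by fh + |fh - f|. -/
lemma functional_pointwise {w φ M fh f qh q K : ℝ} (hw : 0 ≤ w) (hwM : w ≤ M) (hφ : 0 ≤ φ)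
    (hφM : φ ≤ M) (hfh : 0 ≤ fh) (hf : 0 ≤ f) (hqh : 0 ≤ qh) (hq : 0 ≤ q) (hK : 0 ≤ K) :
    |fh * (w * gFun (qh / fh)) - φ * gPersp f q| ≤
      (3 / 2 * M + K * M) * |fh - f| + 3 / 2 * M * |qh - q| + K * (|w - φ| * fh)
        + M * max (gPersp f q - K * f) 0 := by
  set w' : ℝ := if fh = 0 then 0 else w with hw'
  have w0 : 0 ≤ w' := by rw [hw']; split_ifs <;> linarith
  have wM : w' ≤ M := by rw [hw']; split_ifs <;> linarith
  have e : fh * (w * gFun (qh / fh)) = w' * gPersp fh qh := by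
    rcases eq_or_lt_of_le hfh with h | h
    · simp [hw', ← h]
    · rw [← mul_gFun_div h, hw', if_neg h.ne']; ring
  have e2 : |w' - φ| * fh = |w - φ| * fh := by
    rw [hw']; split_ifs with h
    · simp [h]
    · rfl
  have d : |w' - φ| ≤ M := by rw [abs_le]; constructor <;> linarith
  have hL := abs_gPersp_sub_le hfh hf hqh hq
  have G0 := gPersp_nonneg hf hq
  have hM : 0 ≤ M := hw.trans hwM
  have s1 : |w' * (gPersp fh qh - gPersp f q)| ≤ M * (3 / 2 * (|fh - f| + |qh - q|)) := by
    rw [abs_mul, abs_of_nonneg w0]; gcongr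
  have s2 : |(w' - φ) * gPersp f q| ≤ K * (|w - φ| * fh) + K * M * |fh - f|
      + M * max (gPersp f q - K * f) 0 := by
    rw [abs_mul, abs_of_nonneg G0]
    have hm := le_max_left (gPersp f q - K * f) 0
    have hm0 := le_max_right (gPersp f q - K * f) 0
    have h3 : f ≤ fh + |fh - f| := by linarith [neg_abs_le (fh - f)]
    calc |w' - φ| * gPersp f q ≤ |w' - φ| * (K * f + max (gPersp f q - K * f) 0) := by
          gcongr; linarith
      _ ≤ |w' - φ| * (K * (fh + |fh - f|) + max (gPersp f q - K * f) 0) := by gcongr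
      _ = K * (|w' - φ| * fh) + |w' - φ| * (K * |fh - f| + max (gPersp f q - K * f) 0) := by ring
      _ ≤ K * (|w' - φ| * fh) + M * (K * |fh - f| + max (gPersp f q - K * f) 0) := by gcongr
      _ = _ := by rw [e2]; ring
  have e3 : w' * gPersp fh qh - φ * gPersp f q
      = w' * (gPersp fh qh - gPersp f q) + (w' - φ) * gPersp f q := by ring
  rw [e, e3]
  refine (abs_add_le _ _).trans ?_
  linarith

/-- Continuity in `L¹` of the weighted divergence between a density and its conditionally
independent counterpart. -/
theorem tendsto_integral_functional {f φ : α × β × γ → ℝ} {M : ℝ} (mf : Measurable f)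
    (hf0 : ∀ p, 0 ≤ f p) (hfi : Integrable f (μ.prod (ν.prod ξ)))
    (mφ : Measurable φ) (hφ0 : ∀ p, 0 ≤ φ p) (hφM : ∀ p, φ p ≤ M)
    {fh w : ℕ → α × β × γ → ℝ} (mfh : ∀ n, Measurable (fh n)) (hfh0 : ∀ n p, 0 ≤ fh n p)
    (hfhi : ∀ n, Integrable (fh n) (μ.prod (ν.prod ξ)))
    (mw : ∀ n, Measurable (w n)) (hw0 : ∀ n p, 0 ≤ w n p) (hwM : ∀ n p, w n p ≤ M)
    (hlim : Tendsto (fun n => ∫⁻ p, ‖fh n p - f p‖ₑ ∂(μ.prod (ν.prod ξ))) atTop (𝓝 0))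
    (hwlim : Tendsto (fun n => ∫⁻ p, ‖(w n p - φ p) * fh n p‖ₑ ∂(μ.prod (ν.prod ξ))) atTop (𝓝 0))
    (hac : ∀ᵐ p ∂(μ.prod (ν.prod ξ)), f p = 0 → condIndepDensity μ ν f p = 0) :
    Tendsto (fun n => ∫ p, fh n p * (w n p * gFun (condIndepDensity μ ν (fh n) p / fh n p))
      ∂(μ.prod (ν.prod ξ))) atTop
      (𝓝 (∫ p, φ p * gPersp (f p) (condIndepDensity μ ν f p) ∂(μ.prod (ν.prod ξ)))) := by
  set L := μ.prod (ν.prod ξ) with hL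
  set Q := condIndepDensity μ ν f with hQ
  set Qh := fun n => condIndepDensity μ ν (fh n) with hQh
  have mQ : Measurable Q := measurable_condIndepDensity mf
  have mQh : ∀ n, Measurable (Qh n) := fun n => measurable_condIndepDensity (mfh n)
  have Q0 : ∀ p, 0 ≤ Q p := condIndepDensity_nonneg hf0
  have Qh0 : ∀ n p, 0 ≤ Qh n p := fun n => condIndepDensity_nonneg (hfh0 n)
  have iQ : Integrable Q L := integrable_condIndepDensity mf hfi hf0
  have mG : Measurable (fun p => gPersp (f p) (Q p)) := measurable_gPersp.comp (mf.prodMk mQ)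
  have iG : Integrable (fun p => gPersp (f p) (Q p)) L := by
    refine ((hfi.add iQ).div_const 2).mono' mG.aestronglyMeasurable
      (Eventually.of_forall fun p => ?_)
    rw [Real.norm_of_nonneg (gPersp_nonneg (hf0 p) (Q0 p))]
    exact gPersp_le (hf0 p) (Q0 p)
  have mF : ∀ n, Measurable (fun p => fh n p * (w n p * gFun (Qh n p / fh n p))) := fun n =>
    (mfh n).mul ((mw n).mul (measurable_gFun.comp ((mQh n).div (mfh n))))
  have iI : Integrable (fun p => φ p * gPersp (f p) (Q p)) L := by
    refine iG.bdd_mul mφ.aestronglyMeasurable (c := M) (Eventually.of_forall fun p => ?_)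
    rw [Real.norm_of_nonneg (hφ0 p)]; exact hφM p
  have main : Tendsto (fun n => ∫⁻ p, ‖fh n p * (w n p * gFun (Qh n p / fh n p))
      - φ p * gPersp (f p) (Q p)‖ₑ ∂L) atTop (𝓝 0) := by
    set R := fun K : ℕ => ∫⁻ p, ENNReal.ofReal (gPersp (f p) (Q p) - K * f p) ∂L with hR
    have hRlim : Tendsto R atTop (𝓝 0) := by
      refine tendsto_lintegral_excess mf mG hf0 iG ?_
      filter_upwards [hac] with p hp h0
      rw [h0, hp h0]; simp [gPersp]
    have bound : ∀ K n : ℕ, ∫⁻ p, ‖fh n p * (w n p * gFun (Qh n p / fh n p))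
        - φ p * gPersp (f p) (Q p)‖ₑ ∂L ≤
        ENNReal.ofReal (3 / 2 * M + K * M) * (∫⁻ p, ‖fh n p - f p‖ₑ ∂L)
        + ENNReal.ofReal (3 / 2 * M) * (3 * ∫⁻ p, ‖fh n p - f p‖ₑ ∂L)
        + ENNReal.ofReal K * (∫⁻ p, ‖(w n p - φ p) * fh n p‖ₑ ∂L)
        + ENNReal.ofReal M * R K := by
      intro K n
      have st := lintegral_condIndepDensity_sub_le (mfh n) mf (hfhi n) hfi (hfh0 n) hf0
      calc _ ≤ ∫⁻ p, (ENNReal.ofReal (3 / 2 * M + K * M) * ‖fh n p - f p‖ₑ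
              + ENNReal.ofReal (3 / 2 * M) * ‖Qh n p - Q p‖ₑ
              + ENNReal.ofReal K * ‖(w n p - φ p) * fh n p‖ₑ
              + ENNReal.ofReal M * ENNReal.ofReal (gPersp (f p) (Q p) - K * f p)) ∂L := by
            refine lintegral_mono fun p => ?_
            have hM : 0 ≤ M := (hφ0 p).trans (hφM p)
            have key := functional_pointwise (hw0 n p) (hwM n p) (hφ0 p) (hφM p) (hfh0 n p)
              (hf0 p) (Qh0 n p) (Q0 p) (Nat.cast_nonneg (α := ℝ) K)
            have := ENNReal.ofReal_le_ofReal key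
            rw [← Real.enorm_eq_ofReal_abs] at this
            refine this.trans (le_of_eq ?_)
            rw [ENNReal.ofReal_add (by have := hfh0 n p; positivity) (by positivity),
              ENNReal.ofReal_add (by positivity) (by have := hfh0 n p; positivity),
              ENNReal.ofReal_add (by positivity) (by positivity),
              ENNReal.ofReal_mul (p := 3 / 2 * M + K * M) (by positivity),
              ENNReal.ofReal_mul (p := 3 / 2 * M) (by positivity),
              ENNReal.ofReal_mul (p := K) (by positivity), ENNReal.ofReal_mul (p := M) hM,
              ENNReal.ofReal_max, ENNReal.ofReal_zero, max_eq_left (zero_le),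
              Real.enorm_eq_ofReal_abs, Real.enorm_eq_ofReal_abs, Real.enorm_eq_ofReal_abs,
              abs_mul, abs_of_nonneg (hfh0 n p)]
        _ = ENNReal.ofReal (3 / 2 * M + K * M) * (∫⁻ p, ‖fh n p - f p‖ₑ ∂L)
            + ENNReal.ofReal (3 / 2 * M) * (∫⁻ p, ‖Qh n p - Q p‖ₑ ∂L)
            + ENNReal.ofReal K * (∫⁻ p, ‖(w n p - φ p) * fh n p‖ₑ ∂L)
            + ENNReal.ofReal M * R K := by
            have := mfh n
            have := mw n
            have := mQh n
            rw [lintegral_add_right _ (by fun_prop), lintegral_add_right _ (by fun_prop),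
              lintegral_add_right _ (by fun_prop), lintegral_const_mul _ (by fun_prop),
              lintegral_const_mul _ (by fun_prop), lintegral_const_mul _ (by fun_prop),
              lintegral_const_mul _ (by fun_prop)]
        _ ≤ _ := by gcongr
    rw [ENNReal.tendsto_nhds_zero]
    intro δ hδ
    have hδ2 : 0 < δ / 2 := ENNReal.half_pos hδ.ne'
    have hR' : Tendsto (fun K => ENNReal.ofReal M * R K) atTop (𝓝 0) := by
      simpa using ENNReal.Tendsto.const_mul hRlim (Or.inr (by simp : ENNReal.ofReal M ≠ ⊤))
    -- K is fixed before n: the remaining terms carry factors K but vanish in n.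
    obtain ⟨K, hK⟩ := ((ENNReal.tendsto_nhds_zero.1 hR') (δ / 2) hδ2).exists
    have hn : Tendsto (fun n =>
        ENNReal.ofReal (3 / 2 * M + K * M) * (∫⁻ p, ‖fh n p - f p‖ₑ ∂L)
        + ENNReal.ofReal (3 / 2 * M) * (3 * ∫⁻ p, ‖fh n p - f p‖ₑ ∂L)
        + ENNReal.ofReal K * (∫⁻ p, ‖(w n p - φ p) * fh n p‖ₑ ∂L)) atTop (𝓝 0) := by
      have t3 : Tendsto (fun n => 3 * ∫⁻ p, ‖fh n p - f p‖ₑ ∂L) atTop (𝓝 0) := by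
        simpa using ENNReal.Tendsto.const_mul hlim (Or.inr (by simp : (3 : ℝ≥0∞) ≠ ⊤))
      have c1 := ENNReal.Tendsto.const_mul hlim
        (Or.inr (by simp : ENNReal.ofReal (3 / 2 * M + K * M) ≠ ⊤))
      have c2 := ENNReal.Tendsto.const_mul t3 (Or.inr (by simp : ENNReal.ofReal (3 / 2 * M) ≠ ⊤))
      have c3 := ENNReal.Tendsto.const_mul hwlim (Or.inr (by simp : ENNReal.ofReal (K : ℝ) ≠ ⊤))
      simpa using (c1.add c2).add c3
    filter_upwards [(ENNReal.tendsto_nhds_zero.1 hn) (δ / 2) hδ2] with n h1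
    refine (bound K n).trans ((add_le_add h1 hK).trans (ENNReal.add_halves δ).le)
  refine tendsto_integral_of_L1 _ iI.aestronglyMeasurable (Eventually.of_forall fun n => ?_) main
  have iQn : Integrable (Qh n) L := integrable_condIndepDensity (mfh n) (hfhi n) (hfh0 n)
  refine (((hfhi n).add iQn).const_mul M).mono' (mF n).aestronglyMeasurable
    (Eventually.of_forall fun p => ?_)
  have hM : 0 ≤ M := (hφ0 p).trans (hφM p)
  rcases eq_or_lt_of_le (hfh0 n p) with h | h
  · rw [← h]; simp only [zero_mul, norm_zero, Pi.add_apply]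
    have := Qh0 n p; have := hfh0 n p
    positivity
  · have e : fh n p * (w n p * gFun (Qh n p / fh n p)) = w n p * gPersp (fh n p) (Qh n p) := by
      rw [← mul_gFun_div h]; ring
    have g0 := gPersp_nonneg h.le (Qh0 n p)
    rw [e, Real.norm_of_nonneg (mul_nonneg (hw0 n p) g0), Pi.add_apply]
    have := gPersp_le h.le (Qh0 n p)
    have := Qh0 n p
    have := hwM n p
    gcongr
    linarith

end Cond

/-! ### Radon–Nikodym derivatives and conditional laws from densities. -/

section RnDeriv

variable {α β γ Ω' : Type*} [MeasurableSpace α] [MeasurableSpace β] [MeasurableSpace γ]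
  [MeasurableSpace Ω']

/-- Lebesgue decomposition: the part of the first measure on {B = 0} is singular to the second
measure, and the rest has density A/B with respect to it. -/
lemma rnDeriv_withDensity_withDensity (m : Measure α) [SigmaFinite m] {A B : α → ℝ≥0∞}
    (hA : Measurable A) (hB : Measurable B) (hBi : ∀ᵐ x ∂m, B x ≠ ∞) :
    (m.withDensity A).rnDeriv (m.withDensity B) =ᵐ[m.withDensity B] fun x => A x / B x := by
  have : SigmaFinite (m.withDensity B) := SigmaFinite.withDensity_of_ne_top hBi
  have hs : MeasurableSet {x | B x = 0} := hB (measurableSet_singleton 0)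
  refine (Measure.eq_rnDeriv (s := (m.withDensity A).restrict {x | B x = 0}) (hA.div hB) ?_ ?_).symm
  · refine ⟨{x | B x = 0}ᶜ, hs.compl, ?_, ?_⟩
    · rw [Measure.restrict_apply hs.compl]; simp
    · rw [compl_compl, withDensity_apply _ hs, setLIntegral_congr_fun hs (g := fun _ => 0)
        (fun x hx => hx)]
      simp
  · rw [← withDensity_mul _ hB (hA.div hB), restrict_withDensity hs, ← withDensity_indicator hs,
      ← withDensity_add_left (hA.indicator hs)]
    refine withDensity_congr_ae ?_
    filter_upwards [hBi] with x hx
    by_cases h : B x = 0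
    · simp [h]
    · simp [h, ENNReal.mul_div_cancel h hx]

/-- The kernel with densities `k (z, ·) / ∫ k (z, x') dx'`. -/
def normKernel (μ : Measure α) [SFinite μ] (k : γ × α → ℝ≥0∞) : Kernel γ α :=
  Kernel.withDensity (Kernel.const γ μ) (fun z x => k (z, x) / ∫⁻ x', k (z, x') ∂μ)

variable {μ : Measure α} {ν : Measure β} {ξ : Measure γ} [SigmaFinite μ] [SigmaFinite ν]
  [SigmaFinite ξ]

lemma normKernel_apply {k : γ × α → ℝ≥0∞} (hk : Measurable k) (z : γ) :
    normKernel μ k z = μ.withDensity (fun x => k (z, x) / ∫⁻ x', k (z, x') ∂μ) := by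
  have : Measurable (fun z => ∫⁻ x', k (z, x') ∂μ) := hk.lintegral_prod_right'
  rw [normKernel, Kernel.withDensity_apply _ (by fun_prop), Kernel.const_apply]

lemma isFiniteKernel_normKernel {k : γ × α → ℝ≥0∞} (hk : Measurable k) :
    IsFiniteKernel (normKernel μ k) := by
  refine ⟨1, by simp, fun z => ?_⟩
  rw [normKernel_apply hk, withDensity_apply _ MeasurableSet.univ, Measure.restrict_univ]
  simp_rw [div_eq_mul_inv]
  rw [lintegral_mul_const _ (by fun_prop)]
  exact ENNReal.div_self_le_one

omit [SigmaFinite ξ] in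
lemma map_eq_withDensity_of_prod {P : Measure Ω'} {Z : Ω' → γ} {X : Ω' → α} (hZ : Measurable Z)
    (hX : Measurable X) {k : γ × α → ℝ≥0∞} (hk : Measurable k)
    (h : P.map (fun ω => (Z ω, X ω)) = (ξ.prod μ).withDensity k) :
    P.map Z = ξ.withDensity (fun z => ∫⁻ x, k (z, x) ∂μ) := by
  have e : P.map Z = (P.map (fun ω => (Z ω, X ω))).map Prod.fst := by
    rw [Measure.map_map measurable_fst (hZ.prodMk hX)]; rfl
  rw [e, h]
  ext s hs
  rw [Measure.map_apply measurable_fst hs, withDensity_apply _ (measurable_fst hs),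
    withDensity_apply _ hs, ← lintegral_indicator (measurable_fst hs), ← lintegral_indicator hs,
    lintegral_prod _ ((hk.indicator (measurable_fst hs)).aemeasurable)]
  refine lintegral_congr fun z => ?_
  by_cases hz : z ∈ s <;> simp [hz, Set.indicator]

-- Conditional laws are unique, so it suffices that the kernel reproduces the joint law. On a fibre
-- of mass c this is the identity c (S/c) = S, which needs c finite and, where c = 0, S ≤ c.
omit [SigmaFinite ξ] in
lemma condDistrib_ae_eq_normKernel [StandardBorelSpace α] [Nonempty α] {P : Measure Ω'}
    [IsFiniteMeasure P] {Z : Ω' → γ} {X : Ω' → α}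
    (hZ : Measurable Z) (hX : Measurable X) {k : γ × α → ℝ≥0∞} (hk : Measurable k)
    (h : P.map (fun ω => (Z ω, X ω)) = (ξ.prod μ).withDensity k) :
    condDistrib X Z P =ᵐ[P.map Z] normKernel μ k := by
  have := isFiniteKernel_normKernel (μ := μ) hk
  refine condDistrib_ae_eq_of_measure_eq_compProd Z hX.aemeasurable ?_
  have hm : Measurable (fun z => ∫⁻ x', k (z, x') ∂μ) := hk.lintegral_prod_right'
  have hz := map_eq_withDensity_of_prod hZ hX hk h
  have fin : ∀ᵐ z ∂ξ, ∫⁻ x', k (z, x') ∂μ < ∞ := by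
    refine ae_lt_top hm ?_
    have : (P.map Z) Set.univ < ∞ := measure_lt_top _ _
    rw [hz, withDensity_apply _ MeasurableSet.univ, Measure.restrict_univ] at this
    exact this.ne
  ext s hs
  rw [Measure.compProd_apply hs, hz, h, withDensity_apply _ hs, ← lintegral_indicator hs,
    lintegral_prod _ ((hk.indicator hs).aemeasurable),
    lintegral_withDensity_eq_lintegral_mul _ hm (Kernel.measurable_kernel_prodMk_left hs)]
  refine lintegral_congr_ae ?_
  filter_upwards [fin] with z hz
  have hsz : MeasurableSet (Prod.mk z ⁻¹' s) := measurable_prodMk_left hs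
  have e : ∀ x, s.indicator k (z, x) = (Prod.mk z ⁻¹' s).indicator (fun x => k (z, x)) x :=
    fun x => rfl
  simp_rw [Pi.mul_apply, normKernel_apply hk, withDensity_apply _ hsz, e]
  rw [lintegral_indicator hsz]
  simp_rw [div_eq_mul_inv]
  rw [lintegral_mul_const _ (by fun_prop)]
  rcases eq_or_ne (∫⁻ x', k (z, x') ∂μ) 0 with h0 | h0
  · rw [h0, zero_mul]
    exact le_antisymm ((setLIntegral_le_lintegral _ _).trans h0.le) zero_le
  · rw [mul_comm, mul_assoc, ENNReal.inv_mul_cancel h0 hz.ne, mul_one]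

end RnDeriv

/-! ### Reordering coordinates and margins of a density on triples. -/

section Densities

variable {α β γ : Type*} [MeasurableSpace α] [MeasurableSpace β] [MeasurableSpace γ]

lemma map_withDensity_of_measurePreserving {m : Measure α} {m' : Measure β} (e : α ≃ᵐ β)
    (he : MeasurePreserving e m m') {f : α → ℝ≥0∞} {k : β → ℝ≥0∞}
    (h : ∀ x, k (e x) = f x) : (m.withDensity f).map e = m'.withDensity k := by
  ext s hs
  rw [Measure.map_apply e.measurable hs, withDensity_apply _ (e.measurable hs),
    withDensity_apply _ hs, ← he.setLIntegral_comp_preimage_emb e.measurableEmbedding]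
  simp_rw [h]

/-- The coordinates of a triple in the order `(z, (x, y))`. -/
def zxyEquiv : α × β × γ ≃ᵐ γ × (α × β) := MeasurableEquiv.prodAssoc.symm.trans .prodComm

variable {μ : Measure α} {ν : Measure β} {ξ : Measure γ} [SigmaFinite μ] [SigmaFinite ν]
  [SigmaFinite ξ]

lemma measurePreserving_zxyEquiv :
    MeasurePreserving (zxyEquiv : α × β × γ ≃ᵐ γ × (α × β)) (μ.prod (ν.prod ξ))
      (ξ.prod (μ.prod ν)) :=
  ((measurePreserving_prodAssoc μ ν ξ).symm).trans Measure.measurePreserving_swap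

/-- The coordinates of a triple in the order `((z, x), y)`. -/
def zxEquiv : α × β × γ ≃ᵐ (γ × α) × β := zxyEquiv.trans MeasurableEquiv.prodAssoc.symm

lemma measurePreserving_zxEquiv :
    MeasurePreserving (zxEquiv : α × β × γ ≃ᵐ (γ × α) × β) (μ.prod (ν.prod ξ))
      ((ξ.prod μ).prod ν) :=
  measurePreserving_zxyEquiv.trans (measurePreserving_prodAssoc ξ μ ν).symm

/-- The coordinates of a triple in the order `((z, y), x)`. -/
def zyEquiv : α × β × γ ≃ᵐ (γ × β) × α :=
  (zxyEquiv.trans ((MeasurableEquiv.refl γ).prodCongr .prodComm)).trans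
    MeasurableEquiv.prodAssoc.symm

lemma measurePreserving_zyEquiv :
    MeasurePreserving (zyEquiv : α × β × γ ≃ᵐ (γ × β) × α) (μ.prod (ν.prod ξ))
      ((ξ.prod ν).prod μ) :=
  (measurePreserving_zxyEquiv.trans
    (e' := ((MeasurableEquiv.refl γ).prodCongr MeasurableEquiv.prodComm))
    ((MeasurePreserving.id ξ).prod (Measure.measurePreserving_swap (μ := μ) (ν := ν)))).trans
    (measurePreserving_prodAssoc ξ ν μ).symm

omit [SigmaFinite ξ] in
lemma ae_eq_zero_of_lintegral_eq_zero {k : γ × α → ℝ≥0∞} (hk : Measurable k) :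
    ∀ᵐ p ∂(ξ.prod μ), ∫⁻ x, k (p.1, x) ∂μ = 0 → k p = 0 := by
  have hm : Measurable (fun z => ∫⁻ x', k (z, x') ∂μ) := hk.lintegral_prod_right'
  have hs : MeasurableSet {p : γ × α | ¬ (∫⁻ x, k (p.1, x) ∂μ = 0 → k p = 0)} := by
    have h1 : MeasurableSet {p : γ × α | ∫⁻ x, k (p.1, x) ∂μ = 0} :=
      (hm.comp measurable_fst) (measurableSet_singleton 0)
    have h2 : MeasurableSet {p : γ × α | k p = 0} := hk (measurableSet_singleton 0)
    exact (h1.imp h2).compl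
  rw [ae_iff, Measure.measure_prod_null hs]
  refine Eventually.of_forall fun z => ?_
  by_cases h : ∫⁻ x, k (z, x) ∂μ = 0
  · have := (lintegral_eq_zero_iff (hk.comp measurable_prodMk_left)).1 h
    have h2 : ∀ᵐ x ∂μ, ¬ x ∈ (Prod.mk z ⁻¹'
        {p : γ × α | ¬ (∫⁻ x, k (p.1, x) ∂μ = 0 → k p = 0)}) := by
      filter_upwards [this] with x hx
      simp only [Set.mem_preimage, Set.mem_ofPred_eq, not_not]
      exact fun _ => hx
    simpa [ae_iff] using h2
  · have : (Prod.mk z ⁻¹' {p : γ × α | ¬ (∫⁻ x, k (p.1, x) ∂μ = 0 → k p = 0)}) = ∅ := by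
      ext x; simp [h]
    simp only [this, measure_empty, Pi.zero_apply]

omit [SigmaFinite ξ] in
lemma ae_lintegral_lt_top {k : γ × α → ℝ≥0∞} (hk : Measurable k)
    (h : ∫⁻ p, k p ∂(ξ.prod μ) ≠ ∞) : ∀ᵐ z ∂ξ, ∫⁻ x, k (z, x) ∂μ < ∞ := by
  refine ae_lt_top hk.lintegral_prod_right' ?_
  rwa [← lintegral_prod _ hk.aemeasurable]

lemma integral_coe_nnreal {δ : Type*} [MeasurableSpace δ] (m : Measure δ) {g : δ → ℝ≥0}
    (hg : Measurable g) : ∫ x, (g x : ℝ) ∂m = (∫⁻ x, g x ∂m).toReal := by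
  have : ∫ x, ((g x : ℝ≥0∞)).toReal ∂m = (∫⁻ x, g x ∂m).toReal :=
    integral_toReal (by fun_prop) (by simp)
  simpa only [ENNReal.coe_toReal] using this

lemma lintegral_eq_zero_of_integral_coe {δ : Type*} [MeasurableSpace δ] (m : Measure δ)
    {g : δ → ℝ≥0} (hg : Measurable g) (h : ∫⁻ x, g x ∂m < ∞) (h0 : ∫ x, (g x : ℝ) ∂m = 0) :
    ∫⁻ x, g x ∂m = 0 := by
  rw [integral_coe_nnreal m hg, ENNReal.toReal_eq_zero_iff] at h0
  exact h0.resolve_right h.ne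

/-- Where the normalized product of the marginals vanishes, so does the density. -/
lemma ae_eq_zero_of_condIndepDensity_eq_zero {f : α × β × γ → ℝ≥0} (hf : Measurable f)
    (hfi : ∫⁻ p, f p ∂(μ.prod (ν.prod ξ)) ≠ ∞) :
    ∀ᵐ p ∂(μ.prod (ν.prod ξ)),
      condIndepDensity μ ν (fun p => (f p : ℝ)) p = 0 → f p = 0 := by
  have m1 : Measurable (fun q : (γ × α) × β => (f (q.1.2, q.2, q.1.1) : ℝ≥0∞)) := by fun_prop
  have m2 : Measurable (fun q : (γ × β) × α => (f (q.2, q.1.2, q.1.1) : ℝ≥0∞)) := by fun_prop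
  have m3 : Measurable (fun q : γ × (α × β) => (f (q.2.1, q.2.2, q.1) : ℝ≥0∞)) := by fun_prop
  have i1 := hfi
  have i2 := hfi
  have i3 := hfi
  rw [← (measurePreserving_zxEquiv (μ := μ) (ν := ν) (ξ := ξ)).symm.lintegral_comp_emb
    (MeasurableEquiv.measurableEmbedding _)] at i1
  rw [← (measurePreserving_zyEquiv (μ := μ) (ν := ν) (ξ := ξ)).symm.lintegral_comp_emb
    (MeasurableEquiv.measurableEmbedding _)] at i2
  rw [← (measurePreserving_zxyEquiv (μ := μ) (ν := ν) (ξ := ξ)).symm.lintegral_comp_emb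
    (MeasurableEquiv.measurableEmbedding _)] at i3
  have z1 := (measurePreserving_zxEquiv (μ := μ) (ν := ν) (ξ := ξ)).quasiMeasurePreserving.ae
    (ae_eq_zero_of_lintegral_eq_zero (ξ := ξ.prod μ) (μ := ν) m1)
  have z2 := (measurePreserving_zyEquiv (μ := μ) (ν := ν) (ξ := ξ)).quasiMeasurePreserving.ae
    (ae_eq_zero_of_lintegral_eq_zero (ξ := ξ.prod ν) (μ := μ) m2)
  have z3 := (measurePreserving_zxyEquiv (μ := μ) (ν := ν) (ξ := ξ)).quasiMeasurePreserving.ae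
    (ae_eq_zero_of_lintegral_eq_zero (ξ := ξ) (μ := μ.prod ν) m3)
  -- Finiteness is needed because a real integral also vanishes by convention when the fibre
  -- integral is infinite.
  have f1 := (measurePreserving_zxEquiv (μ := μ) (ν := ν) (ξ := ξ)).quasiMeasurePreserving.ae
    (Measure.quasiMeasurePreserving_fst.ae (ae_lintegral_lt_top (ξ := ξ.prod μ) (μ := ν) m1 i1))
  have f2 := (measurePreserving_zyEquiv (μ := μ) (ν := ν) (ξ := ξ)).quasiMeasurePreserving.ae
    (Measure.quasiMeasurePreserving_fst.ae (ae_lintegral_lt_top (ξ := ξ.prod ν) (μ := μ) m2 i2))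
  have f3 := (measurePreserving_zxyEquiv (μ := μ) (ν := ν) (ξ := ξ)).quasiMeasurePreserving.ae
    (Measure.quasiMeasurePreserving_fst.ae
      (ae_lintegral_lt_top (ξ := ξ) (μ := μ.prod ν) m3 i3))
  filter_upwards [z1, z2, z3, f1, f2, f3] with p z1 z2 z3 f1 f2 f3 h
  rw [condIndepDensity, marginProd, div_eq_zero_iff, mul_eq_zero] at h
  rcases h with (h | h) | h
  · exact ENNReal.coe_eq_zero.1 (z1 (lintegral_eq_zero_of_integral_coe ν (g := fun y => f (p.1, y, p.2.2))
      (by fun_prop) f1 h))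
  · exact ENNReal.coe_eq_zero.1 (z2 (lintegral_eq_zero_of_integral_coe μ
      (g := fun x => f (x, p.2.1, p.2.2)) (by fun_prop) f2 h))
  · exact ENNReal.coe_eq_zero.1
      (z3 (lintegral_eq_zero_of_integral_coe (μ.prod ν)
        (g := fun q => f (q.1, q.2, p.2.2)) (by fun_prop) f3 h))

lemma map_zxy_withDensity {f : α × β × γ → ℝ≥0∞} :
    ((μ.prod (ν.prod ξ)).withDensity f).map (fun p => (p.2.2, (p.1, p.2.1))) =
      (ξ.prod (μ.prod ν)).withDensity (fun q => f (q.2.1, q.2.2, q.1)) :=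
  map_withDensity_of_measurePreserving zxyEquiv measurePreserving_zxyEquiv fun _ => rfl

lemma map_zx_withDensity {f : α × β × γ → ℝ≥0} (hf : Measurable f) :
    ((μ.prod (ν.prod ξ)).withDensity (fun p => (f p : ℝ≥0∞))).map (fun p => (p.2.2, p.1)) =
      (ξ.prod μ).withDensity (fun q => ∫⁻ y, f (q.2, y, q.1) ∂ν) :=
  map_eq_withDensity_of_prod (Z := fun p : α × β × γ => (p.2.2, p.1))
    (X := fun p : α × β × γ => p.2.1) (μ := ν) (ξ := ξ.prod μ)
    (k := fun q : (γ × α) × β => (f (q.1.2, q.2, q.1.1) : ℝ≥0∞)) (by fun_prop) (by fun_prop)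
    (by fun_prop)
    (map_withDensity_of_measurePreserving zxEquiv measurePreserving_zxEquiv fun _ => rfl)

lemma map_zy_withDensity {f : α × β × γ → ℝ≥0} (hf : Measurable f) :
    ((μ.prod (ν.prod ξ)).withDensity (fun p => (f p : ℝ≥0∞))).map (fun p => (p.2.2, p.2.1)) =
      (ξ.prod ν).withDensity (fun q => ∫⁻ x, f (x, q.2, q.1) ∂μ) :=
  map_eq_withDensity_of_prod (Z := fun p : α × β × γ => (p.2.2, p.2.1))
    (X := fun p : α × β × γ => p.1) (μ := μ) (ξ := ξ.prod ν)
    (k := fun q : (γ × β) × α => (f (q.2, q.1.2, q.1.1) : ℝ≥0∞)) (by fun_prop) (by fun_prop)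
    (by fun_prop)
    (map_withDensity_of_measurePreserving zyEquiv measurePreserving_zyEquiv fun _ => rfl)

end Densities

/-! ### The target as an integral against Lebesgue measure. -/

section Acmi

variable {dX dY dZ : ℕ}

/-- Here c, a, b stand for the densities of Z, (X, Z), (Y, Z), and the left side is the reference
density times g of the ratio of conditional densities. Where ab/c = 0 the left side is 0 but G(F, 0)
= F/2, so F must vanish there. -/
lemma acmi_algebra (F a b c : ℝ) (h : a * b / c = 0 → F = 0) :
    c * (a / c * (b / c)) * gFun ((F / c) / (a / c * (b / c))) = gPersp F (a * b / c) := by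
  rcases eq_or_ne (a * b / c) 0 with h0 | h0
  · rw [h h0, h0]
    rcases eq_or_ne c 0 with hc | hc
    · simp [hc, gPersp]
    · have : a * b = 0 := by
        rw [div_eq_zero_iff] at h0; exact h0.resolve_right hc
      have e : c * (a / c * (b / c)) = 0 := by
        rw [show c * (a / c * (b / c)) = c * (a * b / (c * c)) by ring, this]; simp
      rw [e]; simp [gPersp]
  · have hc : c ≠ 0 := by rintro rfl; simp at h0
    have hab : a * b ≠ 0 := by intro h'; simp [h'] at h0
    have ha : a ≠ 0 := left_ne_zero_of_mul hab
    have hb : b ≠ 0 := right_ne_zero_of_mul hab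
    have e1 : c * (a / c * (b / c)) = a * b / c := by field_simp
    have e2 : (F / c) / (a / c * (b / c)) = F / (a * b / c) := by field_simp
    rw [e1, e2, gPersp_comm]
    unfold gFun gPersp
    set q := a * b / c
    have h1 : F / q - 1 = (F - q) / q := by field_simp
    have h2 : F / q + 1 = (q + F) / q := by field_simp; ring
    rw [h1, h2]
    rcases eq_or_ne (q + F) 0 with h | h
    · rw [h]; simp
    · field_simp; ring

/-- The adaptive conditional mutual information in terms of the density, together with the
consequence of the positivity of the conditional density ratio. -/
theorem acmi_eq_integral (P : Measure (Euc dX × Euc dY × Euc dZ)) [IsProbabilityMeasure P]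
    (f : Euc dX × Euc dY × Euc dZ → ℝ≥0) (hf : Measurable f)
    (hP : P = volume.withDensity (fun p => (f p : ℝ≥0∞))) :
    (∀ φ : Euc dX × Euc dY × Euc dZ → ℝ, acmi P φ =
      ∫ p, φ p * gPersp (f p) (condIndepDensity volume volume (fun p => (f p : ℝ)) p)) ∧
    ((∀ᵐ p ∂(refMeasure P), 0 < condRatio P p) →
      ∀ᵐ p, f p = 0 → condIndepDensity volume volume (fun p => (f p : ℝ)) p = 0) := by
  have hfi : ∫⁻ p, f p ≠ ∞ := by
    have : P Set.univ < ∞ := measure_lt_top _ _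
    rw [hP, withDensity_apply _ MeasurableSet.univ, Measure.restrict_univ] at this
    exact this.ne
  set kX : Euc dZ × Euc dX → ℝ≥0∞ := fun q => ∫⁻ y, f (q.2, y, q.1) with hkX
  set kY : Euc dZ × Euc dY → ℝ≥0∞ := fun q => ∫⁻ x, f (x, q.2, q.1) with hkY
  set kXY : Euc dZ × (Euc dX × Euc dY) → ℝ≥0∞ := fun q => f (q.2.1, q.2.2, q.1) with hkXY
  set kZ : Euc dZ → ℝ≥0∞ := fun z => ∫⁻ q : Euc dX × Euc dY, f (q.1, q.2, z) with hkZ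
  have m1 : Measurable (fun q : (Euc dZ × Euc dX) × Euc dY => (f (q.1.2, q.2, q.1.1) : ℝ≥0∞)) := by
    fun_prop
  have m2 : Measurable (fun q : (Euc dZ × Euc dY) × Euc dX => (f (q.2, q.1.2, q.1.1) : ℝ≥0∞)) := by
    fun_prop
  have mkXY : Measurable kXY := by fun_prop
  have mkX : Measurable kX := m1.lintegral_prod_right'
  have mkY : Measurable kY := m2.lintegral_prod_right'
  have mkZ : Measurable kZ := mkXY.lintegral_prod_right'
  have sX : ∀ z, ∫⁻ x, kX (z, x) = kZ z := fun z => by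
    have : Measurable (fun q : Euc dX × Euc dY => (f (q.1, q.2, z) : ℝ≥0∞)) := by fun_prop
    rw [hkZ, Measure.volume_eq_prod]
    exact (lintegral_prod _ this.aemeasurable).symm
  have sY : ∀ z, ∫⁻ y, kY (z, y) = kZ z := fun z => by
    have : Measurable (fun q : Euc dX × Euc dY => (f (q.1, q.2, z) : ℝ≥0∞)) := by fun_prop
    rw [hkZ, Measure.volume_eq_prod]
    exact (lintegral_prod_symm _ this.aemeasurable).symm
  have lawZXY : P.map (fun p => (p.2.2, (p.1, p.2.1))) =
      ((volume : Measure (Euc dZ)).prod volume).withDensity kXY := by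
    rw [hP]; exact map_zxy_withDensity
  have lawZX : P.map (fun p => (p.2.2, p.1)) =
      ((volume : Measure (Euc dZ)).prod volume).withDensity kX := by
    rw [hP]; exact map_zx_withDensity hf
  have lawZY : P.map (fun p => (p.2.2, p.2.1)) =
      ((volume : Measure (Euc dZ)).prod volume).withDensity kY := by
    rw [hP]; exact map_zy_withDensity hf
  have hlawZ : lawZ P = volume.withDensity kZ :=
    map_eq_withDensity_of_prod (μ := volume) (Z := fun p : Euc dX × Euc dY × Euc dZ => p.2.2)
      (X := fun p : Euc dX × Euc dY × Euc dZ => (p.1, p.2.1)) (k := kXY) (by fun_prop)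
      (by fun_prop) mkXY lawZXY
  have cXY : condXY P =ᵐ[lawZ P] normKernel volume kXY :=
    condDistrib_ae_eq_normKernel (ξ := volume) (by fun_prop) (by fun_prop) mkXY lawZXY
  have cX := condDistrib_ae_eq_normKernel (ξ := volume) (P := P) (Z := fun p => p.2.2)
    (X := fun p => p.1) (by fun_prop) (by fun_prop) mkX lawZX
  have cY := condDistrib_ae_eq_normKernel (ξ := volume) (P := P) (Z := fun p => p.2.2)
    (X := fun p => p.2.1) (by fun_prop) (by fun_prop) mkY lawZY
  have finZ : ∀ᵐ z, kZ z < ∞ := by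
    refine ae_lt_top mkZ ?_
    have : (lawZ P) Set.univ < ∞ := by
      have : IsProbabilityMeasure (lawZ P) := Measure.isProbabilityMeasure_map (by fun_prop)
      exact measure_lt_top _ _
    rw [hlawZ, withDensity_apply _ MeasurableSet.univ, Measure.restrict_univ] at this
    exact this.ne
  -- The Lebesgue density of the product of the two conditional laws at z; multiplied by the density
  -- of Z it becomes the density of the reference measure.
  set B : Euc dZ × (Euc dX × Euc dY) → ℝ≥0∞ :=
    fun q => kX (q.1, q.2.1) / kZ q.1 * (kY (q.1, q.2.2) / kZ q.1) with hB
  have mB : Measurable B := by fun_prop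
  have cP : ∀ᵐ z ∂(lawZ P), condProd P z = volume.withDensity (fun q => B (z, q)) := by
    filter_upwards [cX, cY] with z h1 h2
    rw [condProd, Kernel.prod_apply, h1, h2, normKernel_apply mkX, normKernel_apply mkY,
      prod_withDensity (by fun_prop) (by fun_prop), Measure.volume_eq_prod]
    simp_rw [sX, sY]
    rfl
  set q : Euc dZ × (Euc dX × Euc dY) → ℝ≥0∞ := fun r => kZ r.1 * B r with hq
  have mq : Measurable q := by fun_prop
  have href : refMeasure P = (volume : Measure (Euc dZ × (Euc dX × Euc dY))).withDensity q := by
    have : IsMarkovKernel (condProd P) := by unfold condProd; infer_instance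
    have : IsProbabilityMeasure (lawZ P) := Measure.isProbabilityMeasure_map (by fun_prop)
    ext s hs
    have e1 : ∀ᵐ z ∂(volume.withDensity kZ), condProd P z (Prod.mk z ⁻¹' s)
        = ∫⁻ r in Prod.mk z ⁻¹' s, B (z, r) := by
      rw [← hlawZ]
      filter_upwards [cP] with z hz
      rw [hz, withDensity_apply _ (measurable_prodMk_left hs)]
    have mB2 : Measurable (s.indicator B) := mB.indicator hs
    have e2 : ∀ z, ∫⁻ r in Prod.mk z ⁻¹' s, B (z, r) = ∫⁻ r, s.indicator B (z, r) := fun z => by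
      rw [← lintegral_indicator (measurable_prodMk_left hs)]; rfl
    simp_rw [e2] at e1
    rw [refMeasure, Measure.compProd_apply hs, withDensity_apply _ hs, hlawZ, lintegral_congr_ae e1,
      lintegral_withDensity_eq_lintegral_mul _ mkZ mB2.lintegral_prod_right',
      ← lintegral_indicator hs, Measure.volume_eq_prod (Euc dZ),
      lintegral_prod _ ((mq.indicator hs).aemeasurable)]
    refine lintegral_congr fun z => ?_
    rw [Pi.mul_apply, ← lintegral_const_mul _ (by fun_prop)]
    refine lintegral_congr fun r => ?_
    by_cases h : (z, r) ∈ s <;> simp [h, hq]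
  have hratio : ∀ᵐ p ∂(refMeasure P), condRatio P p = (kXY p / kZ p.1) / B p := by
    have : IsMarkovKernel (condProd P) := by unfold condProd; infer_instance
    have : IsMarkovKernel (condXY P) := by unfold condXY; infer_instance
    refine Measure.ae_compProd_of_ae_ae ?_ ?_
    · exact measurableSet_eq_fun (Kernel.measurable_rnDeriv _ _) (by fun_prop)
    · filter_upwards [cP, cXY] with z h1 h2
      have h3 := Kernel.rnDeriv_eq_rnDeriv_measure (κ := condXY P) (η := condProd P) (a := z)
      have h4 : ((volume : Measure (Euc dX × Euc dY)).withDensity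
          (fun r => kXY (z, r) / kZ z)).rnDeriv (volume.withDensity (fun r => B (z, r)))
          =ᵐ[volume.withDensity (fun r => B (z, r))] fun r => (kXY (z, r) / kZ z) / B (z, r) := by
        refine rnDeriv_withDensity_withDensity _ (by fun_prop) (by fun_prop) ?_
        have : IsFiniteMeasure (volume.withDensity (fun r => B (z, r))) := by
          rw [← h1]; infer_instance
        -- The fibre is a probability measure, so its density is a.e. finite, as the quotient
        -- formula requires.
        have h5 : ∫⁻ r, B (z, r) ≠ ∞ := by
          have : (volume.withDensity (fun r => B (z, r))) Set.univ < ∞ := measure_lt_top _ _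
          rw [withDensity_apply _ MeasurableSet.univ, Measure.restrict_univ] at this
          exact this.ne
        filter_upwards [ae_lt_top (by fun_prop) h5] with r hr using hr.ne
      rw [h1, h2, normKernel_apply mkXY] at h3
      rw [h1]
      filter_upwards [h3, h4] with r h3 h4
      rw [condRatio, h3]
      exact h4
  -- real-valued forms
  have tr : ∀ p : Euc dX × Euc dY × Euc dZ,
      condIndepDensity volume volume (fun p => (f p : ℝ)) p =
      (kX (p.2.2, p.1)).toReal * (kY (p.2.2, p.2.1)).toReal / (kZ p.2.2).toReal := by
    intro p
    rw [condIndepDensity, marginProd, 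
      integral_coe_nnreal _ (g := fun y => f (p.1, y, p.2.2)) (by fun_prop),
      integral_coe_nnreal _ (g := fun x => f (x, p.2.1, p.2.2)) (by fun_prop),
      integral_coe_nnreal _ (g := fun q : Euc dX × Euc dY => f (q.1, q.2, p.2.2)) (by fun_prop)]
    rfl
  have hz := ae_eq_zero_of_condIndepDensity_eq_zero (μ := volume) (ν := volume) (ξ := volume)
    hf hfi
  have mpe := measurePreserving_zxyEquiv (μ := (volume : Measure (Euc dX)))
    (ν := (volume : Measure (Euc dY))) (ξ := (volume : Measure (Euc dZ)))
  have qfin : ∀ᵐ r : Euc dZ × (Euc dX × Euc dY), q r < ∞ := by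
    refine ae_lt_top mq ?_
    have : (refMeasure P) Set.univ < ∞ := by
      have : IsProbabilityMeasure (lawZ P) := Measure.isProbabilityMeasure_map (by fun_prop)
      have : IsMarkovKernel (condProd P) := by unfold condProd; infer_instance
      unfold refMeasure
      exact measure_lt_top _ _
    rw [href, withDensity_apply _ MeasurableSet.univ, Measure.restrict_univ] at this
    exact this.ne
  constructor
  · intro φ
    rw [acmi]
    have e1 : ∫ p, φ (p.2.1, p.2.2, p.1) * gFun (condRatio P p).toReal ∂(refMeasure P) =
        ∫ p, φ (p.2.1, p.2.2, p.1) * gFun ((kXY p / kZ p.1) / B p).toReal ∂(refMeasure P) := by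
      refine integral_congr_ae ?_
      filter_upwards [hratio] with p hp
      rw [hp]
    rw [e1, href, integral_withDensity_eq_integral_toReal_smul mq qfin, Measure.volume_eq_prod,
      Measure.volume_eq_prod (Euc dX), ← mpe.integral_comp (MeasurableEquiv.measurableEmbedding _)]
    refine integral_congr_ae ?_
    filter_upwards [hz] with p hp
    have := acmi_algebra (f p) (kX (p.2.2, p.1)).toReal (kY (p.2.2, p.2.1)).toReal
      (kZ p.2.2).toReal (by rw [← tr p]; intro h; exact_mod_cast hp h)
    rw [tr p, ← this]
    change (q (p.2.2, (p.1, p.2.1))).toReal • (φ p * gFun ((kXY (p.2.2, (p.1, p.2.1)) / kZ p.2.2) /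
      B (p.2.2, (p.1, p.2.1))).toReal) = _
    simp only [hq, hB, hkXY, ENNReal.toReal_mul, ENNReal.toReal_div, smul_eq_mul,
      ENNReal.coe_toReal]
    ring
  · intro hpos
    -- A positive ratio has a nonzero numerator. Read through the density of the reference measure,
    -- this says that f is nonzero a.e. where its conditionally independent counterpart is.
    have h1 : ∀ᵐ p ∂(refMeasure P), kXY p ≠ 0 := by
      filter_upwards [hpos, hratio] with p h1 h2 h3
      rw [h2, h3] at h1
      simp at h1
    rw [href, ae_withDensity_iff mq] at h1
    filter_upwards [mpe.quasiMeasurePreserving.ae h1] with p hp h0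
    by_contra h
    refine hp (fun h' => h ?_) ?_
    · have : (q (p.2.2, (p.1, p.2.1))).toReal = 0 := by
        have : q (p.2.2, (p.1, p.2.1)) = 0 := h'
        rw [this]; simp
      simp only [hq, hB, ENNReal.toReal_mul, ENNReal.toReal_div] at this
      rw [tr p]
      simp only [mul_eq_zero, div_eq_zero_iff] at this ⊢
      tauto
    · change (f p : ℝ≥0∞) = 0
      simp [h0]

end Acmi

/-! ### Geometry of the cubic cells. -/

section Cells

variable {d : ℕ}

/-- The integer vector of the cell of `x`. -/
def cellv (ε b : ℝ) (x : Euc d) : Fin d → ℤ := fun c => ⌊(x c + b) / ε⌋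

lemma cell_eq_cell_iff {ε b : ℝ} {x y : Euc d} :
    cell ε b x = cell ε b y ↔ cellv ε b x = cellv ε b y := by
  unfold cell cellv
  constructor
  · intro h
    exact eq_of_heq (Sigma.mk.inj h).2
  · intro h
    rw [h]

lemma measurable_cellv_prod (ε : ℝ) : Measurable (fun q : ℝ × Euc d => cellv ε q.1 q.2) := by
  refine measurable_pi_lambda _ fun c => ?_
  have : Measurable (fun q : ℝ × Euc d => (q.2 c + q.1) / ε) := by fun_prop
  exact Int.measurable_floor.comp this

lemma measurable_cellv (ε b : ℝ) : Measurable (cellv ε b : Euc d → Fin d → ℤ) :=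
  (measurable_cellv_prod ε).comp measurable_prodMk_left

/-- A cell is a half-open cube of side ε, whatever the shift: the floor condition reads c_i ε - b ≤
x_i < c_i ε - b + ε. -/
lemma volume_cellv {ε : ℝ} (hε : 0 < ε) (b : ℝ) (c : Fin d → ℤ) :
    volume {x : Euc d | cellv ε b x = c} = ENNReal.ofReal (ε ^ d) := by
  have h : {x : Euc d | cellv ε b x = c} = (WithLp.ofLp (p := 2)) ⁻¹'
      (Set.univ.pi fun i => Set.Ico (c i * ε - b) (c i * ε - b + ε)) := by
    ext x
    simp only [Set.mem_ofPred_eq, Set.mem_preimage, Set.mem_univ_pi, Set.mem_Ico, cellv, funext_iff,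
      Int.floor_eq_iff, le_div_iff₀ hε, div_lt_iff₀ hε]
    refine forall_congr' fun i => ?_
    constructor <;> rintro ⟨h1, h2⟩ <;> constructor <;> linarith
  rw [h, (PiLp.volume_preserving_ofLp (Fin d)).measure_preimage
    (MeasurableSet.univ_pi fun i => measurableSet_Ico).nullMeasurableSet, Real.volume_pi_Ico]
  simp [ENNReal.ofReal_pow hε.le]

lemma dist_le_of_cellv_eq {ε b : ℝ} (hε : 0 < ε) {x y : Euc d} (h : cellv ε b x = cellv ε b y) :
    dist x y ≤ √d * ε := by
  rw [EuclideanSpace.dist_eq]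
  refine Real.sqrt_le_iff.2 ⟨by positivity, ?_⟩
  rw [mul_pow, Real.sq_sqrt (Nat.cast_nonneg d)]
  calc ∑ i, dist (x i) (y i) ^ 2 ≤ ∑ _i : Fin d, ε ^ 2 := by
        refine Finset.sum_le_sum fun i _ => ?_
        have hi : ⌊(x i + b) / ε⌋ = ⌊(y i + b) / ε⌋ := congrFun h i
        have := Int.abs_sub_lt_one_of_floor_eq_floor hi
        rw [← sub_div, abs_div, abs_of_pos hε, div_lt_one hε] at this
        have e : x i + b - (y i + b) = x i - y i := by ring
        rw [e] at this
        rw [Real.dist_eq]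
        exact pow_le_pow_left₀ (abs_nonneg _) this.le 2
    _ = d * ε ^ 2 := by simp

/-- A finite set of integer vectors that contains the cells of all points of the ball of radius
`R` around the origin, for all shifts in `[0, ε]`. -/
def cellBox (d : ℕ) (R ε : ℝ) : Finset (Fin d → ℤ) :=
  -- The extra unit absorbs the shift, which moves an index by at most one.
  Fintype.piFinset fun _ => Finset.Icc (-(⌈R / ε⌉₊ + 1 : ℤ)) (⌈R / ε⌉₊ + 1)

lemma cellv_mem_cellBox {R ε b : ℝ} (hε : 0 < ε) (hb : b ∈ Set.Icc 0 ε) {x : Euc d}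
    (hx : ‖x‖ ≤ R) : cellv ε b x ∈ cellBox d R ε := by
  rw [cellBox, Fintype.mem_piFinset]
  intro i
  have h1 : |x i| ≤ R := (PiLp.norm_apply_le x i).trans hx
  rw [abs_le] at h1
  have h2 : R / ε ≤ ⌈R / ε⌉₊ := Nat.le_ceil _
  have h3 : R ≤ ⌈R / ε⌉₊ * ε := by rwa [div_le_iff₀ hε] at h2
  rw [Finset.mem_Icc]
  constructor
  · rw [cellv, Int.le_floor, le_div_iff₀ hε]
    push_cast
    nlinarith [hb.1, hb.2]
  · have : ⌊(x i + b) / ε⌋ < ⌈R / ε⌉₊ + 2 := by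
      rw [Int.floor_lt, div_lt_iff₀ hε]
      push_cast
      nlinarith [hb.1, hb.2]
    rw [cellv]
    linarith

/-- Each side has 2⌈R/ε⌉ + 3 indices, of total length at most 2R + 5ε. Hence the number of cells is
at most a constant over the cell volume. -/
lemma card_cellBox_mul_le {R ε : ℝ} (hR : 0 ≤ R) (hε : 0 < ε) (hε1 : ε ≤ 1) :
    ((cellBox d R ε).card : ℝ) * ε ^ d ≤ (2 * R + 5) ^ d := by
  have e : (cellBox d R ε).card = (2 * ⌈R / ε⌉₊ + 3) ^ d := by
    rw [cellBox, Fintype.card_piFinset, Finset.prod_const, Int.card_Icc, Finset.card_univ,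
      Fintype.card_fin]
    congr 1
    omega
  rw [e]
  push_cast
  rw [← mul_pow]
  have h := Nat.ceil_lt_add_one (div_nonneg hR hε.le)
  have h2 : (⌈R / ε⌉₊ : ℝ) * ε ≤ R + ε := by
    calc (⌈R / ε⌉₊ : ℝ) * ε ≤ (R / ε + 1) * ε := by gcongr
      _ = R + ε := by field_simp
  exact pow_le_pow_left₀ (by positivity) (by nlinarith) d

end Cells

/-! ### Weighted histograms. -/

section Hist

variable {E C : Type*} [MeasurableSpace E] [MeasurableSpace C] [Countable C]
  [MeasurableSingletonClass C]

/-- The weighted histogram of the points `s t`, `t < N`, with weights `a t`, where `κ` maps a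
point to its cell and `v` is the measure of a cell. -/
def hist (κ : E → C) (v : ℝ) (N : ℕ) (s : ℕ → E) (a : ℕ → ℝ) (p : E) : ℝ :=
  (N * v)⁻¹ * ∑ t ∈ Finset.range N, {q | κ q = κ (s t)}.indicator (fun _ => a t) p

variable {κ : E → C} {v : ℝ} {N : ℕ} {s : ℕ → E} {a : ℕ → ℝ}

omit [Countable C] in
lemma measurableSet_cell (hκ : Measurable κ) (c : C) : MeasurableSet {q | κ q = c} :=
  hκ (measurableSet_singleton c)

omit [Countable C] in
lemma measurable_hist (hκ : Measurable κ) : Measurable (hist κ v N s a) :=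
  (Finset.measurable_sum _ fun _ _ =>
    measurable_const.indicator (measurableSet_cell hκ _)).const_mul _

omit [MeasurableSpace E] [MeasurableSpace C] [Countable C] [MeasurableSingletonClass C] in
lemma hist_nonneg (hv : 0 ≤ v) (ha : ∀ t, 0 ≤ a t) (p : E) : 0 ≤ hist κ v N s a p :=
  mul_nonneg (by positivity) (Finset.sum_nonneg fun t _ => Set.indicator_nonneg (fun _ _ => ha t) _)

omit [MeasurableSpace E] [MeasurableSpace C] [Countable C] [MeasurableSingletonClass C] in
/-- Multiplying a histogram by a function that is constant on cells. -/
lemma hist_mul {R : E → ℝ} (hR : ∀ p q, κ p = κ q → R p = R q) (p : E) :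
    hist κ v N s a p * R p = hist κ v N s (fun t => a t * R (s t)) p := by
  rw [hist, hist, mul_assoc, Finset.sum_mul]
  congr 1
  refine Finset.sum_congr rfl fun t _ => ?_
  by_cases h : κ p = κ (s t)
  · simp [h, hR _ _ h]
  · simp [h]

variable {m : Measure E}

omit [Countable C] in
lemma integrable_hist_term (hκ : Measurable κ) (hm : ∀ c, m {p | κ p = c} = ENNReal.ofReal v)
    (c : C) (x : ℝ) : Integrable ({q | κ q = c}.indicator (fun _ => x)) m := by
  rw [integrable_indicator_iff (measurableSet_cell hκ c)]
  refine integrableOn_const ?_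
  rw [hm]; simp

omit [Countable C] in
lemma integrable_hist (hκ : Measurable κ) (hm : ∀ c, m {p | κ p = c} = ENNReal.ofReal v) :
    Integrable (hist κ v N s a) m :=
  (integrable_finsetSum _ fun _ _ => integrable_hist_term hκ hm _ _).const_mul _

omit [Countable C] in
lemma integral_hist (hκ : Measurable κ) (hv : 0 < v)
    (hm : ∀ c, m {p | κ p = c} = ENNReal.ofReal v) :
    ∫ p, hist κ v N s a p ∂m = (∑ t ∈ Finset.range N, a t) / N := by
  unfold hist
  rw [integral_const_mul, integral_finsetSum _ fun _ _ => integrable_hist_term hκ hm _ _]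
  have : ∀ t, ∫ p, {q | κ q = κ (s t)}.indicator (fun _ => a t) p ∂m = v * a t := by
    intro t
    rw [integral_indicator (measurableSet_cell hκ _), setIntegral_const, Measure.real, hm,
      ENNReal.toReal_ofReal hv.le, smul_eq_mul]
  simp_rw [this]
  rw [← Finset.mul_sum, mul_inv, mul_assoc, ← mul_assoc v⁻¹, inv_mul_cancel₀ hv.ne', one_mul]
  ring

end Hist

/-! ### Margins of a histogram on product cells are sample counts. -/

section HistProd

variable {α β γ A B D : Type*} [MeasurableSpace α] [MeasurableSpace β] [MeasurableSpace γ]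
  [MeasurableSpace A] [Countable A] [MeasurableSingletonClass A]
  [MeasurableSpace B] [Countable B] [MeasurableSingletonClass B]
  {κ₁ : α → A} {κ₂ : β → B} {κ₃ : γ → D} {v₁ v₂ v₃ : ℝ}
  {N : ℕ} {s : ℕ → α × β × γ}

/-- The cell map of a product. -/
def prodCell (κ₁ : α → A) (κ₂ : β → B) (κ₃ : γ → D) (p : α × β × γ) : A × B × D :=
  (κ₁ p.1, κ₂ p.2.1, κ₃ p.2.2)

open Classical in
/-- The number of `t < N` such that `q t` holds. -/
def cnt (N : ℕ) (q : ℕ → Prop) : ℕ := ((Finset.range N).filter q).card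

open Classical in
lemma cnt_cast (N : ℕ) (q : ℕ → Prop) :
    (cnt N q : ℝ) = ∑ t ∈ Finset.range N, if q t then (1 : ℝ) else 0 := by
  rw [cnt, Finset.card_filter]; push_cast; rfl

open Classical in
lemma indicator_cell_one {E C : Type*} (κ : E → C) (c : C) (p : E) :
    {q | κ q = c}.indicator (fun _ => (1 : ℝ)) p = if c = κ p then 1 else 0 := by
  by_cases h : κ p = c
  · simp [h]
  · simp [h, Ne.symm h]

lemma hist_one_apply {E C : Type*} (κ : E → C) (v : ℝ) (s : ℕ → E) (p : E) :
    hist κ v N s 1 p = (N * v)⁻¹ * cnt N (fun t => κ (s t) = κ p) := by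
  classical
  rw [hist, cnt_cast]
  congr 1
  refine Finset.sum_congr rfl fun t _ => ?_
  exact indicator_cell_one κ (κ (s t)) p

omit [Countable A] in
lemma integral_indicator_cell {μ : Measure α} (hκ : Measurable κ₁) (hv : 0 < v₁)
    (hm : ∀ c, μ {x | κ₁ x = c} = ENNReal.ofReal v₁) (c : A) (y : ℝ) :
    ∫ x, {x | κ₁ x = c}.indicator (fun _ => y) x ∂μ = v₁ * y := by
  rw [integral_indicator (measurableSet_cell hκ _), setIntegral_const, Measure.real, hm,
      ENNReal.toReal_ofReal hv.le, smul_eq_mul]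

variable {μ : Measure α} {ν : Measure β} [SigmaFinite μ] [SigmaFinite ν]

omit [MeasurableSpace γ] [Countable A] [Countable B] in
/-- The conditionally independent counterpart of a histogram, relative to the histogram, at a
sample point. -/
lemma condIndepDensity_hist_div (h1 : Measurable κ₁) (h2 : Measurable κ₂)
    (hv1 : 0 < v₁) (hv2 : 0 < v₂) (hv3 : 0 < v₃)
    (hm1 : ∀ c, μ {x | κ₁ x = c} = ENNReal.ofReal v₁)
    (hm2 : ∀ c, ν {x | κ₂ x = c} = ENNReal.ofReal v₂) (hN : 0 < N) (p : α × β × γ) :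
    condIndepDensity μ ν (hist (prodCell κ₁ κ₂ κ₃) (v₁ * (v₂ * v₃)) N s 1) p /
      hist (prodCell κ₁ κ₂ κ₃) (v₁ * (v₂ * v₃)) N s 1 p =
    (cnt N (fun t => κ₁ (s t).1 = κ₁ p.1 ∧ κ₃ (s t).2.2 = κ₃ p.2.2) : ℝ) *
      cnt N (fun t => κ₂ (s t).2.1 = κ₂ p.2.1 ∧ κ₃ (s t).2.2 = κ₃ p.2.2) /
      (cnt N (fun t => κ₃ (s t).2.2 = κ₃ p.2.2) *
        cnt N (fun t => κ₁ (s t).1 = κ₁ p.1 ∧ κ₂ (s t).2.1 = κ₂ p.2.1 ∧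
          κ₃ (s t).2.2 = κ₃ p.2.2)) := by
  classical
  set V := v₁ * (v₂ * v₃) with hV
  -- The indicator of a product cell factors, so integrating out a coordinate drops its constraint
  -- and contributes its cell measure.
  have e : ∀ q : α × β × γ, hist (prodCell κ₁ κ₂ κ₃) V N s 1 q = (N * V)⁻¹ *
      ∑ t ∈ Finset.range N, {x | κ₁ x = κ₁ (s t).1}.indicator (fun _ => 1) q.1 *
        ({y | κ₂ y = κ₂ (s t).2.1}.indicator (fun _ => 1) q.2.1 *
          {z | κ₃ z = κ₃ (s t).2.2}.indicator (fun _ => 1) q.2.2) := by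
    intro q
    rw [hist]
    congr 1
    refine Finset.sum_congr rfl fun t _ => ?_
    rw [indicator_cell_one, indicator_cell_one, indicator_cell_one, Pi.one_apply,
      indicator_cell_one]
    by_cases c1 : κ₁ (s t).1 = κ₁ q.1 <;> by_cases c2 : κ₂ (s t).2.1 = κ₂ q.2.1 <;>
      simp [c1, c2, prodCell]
  have e' : ∀ q : α × β × γ, hist (prodCell κ₁ κ₂ κ₃) V N s 1 q = (N * V)⁻¹ *
      ∑ t ∈ Finset.range N, {x | κ₁ x = κ₁ (s t).1}.indicator (fun _ => 1) q.1 *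
        {y | κ₂ y = κ₂ (s t).2.1}.indicator (fun _ => 1) q.2.1 *
          {z | κ₃ z = κ₃ (s t).2.2}.indicator (fun _ => 1) q.2.2 := by
    intro q; rw [e q]; simp only [mul_assoc]
  have I1 : ∀ c y, Integrable ({x | κ₁ x = c}.indicator (fun _ => y)) μ :=
    integrable_hist_term h1 hm1
  have I2 : ∀ c y, Integrable ({x | κ₂ x = c}.indicator (fun _ => y)) ν :=
    integrable_hist_term h2 hm2
  have mXZ : ∫ y, hist (prodCell κ₁ κ₂ κ₃) V N s 1 (p.1, y, p.2.2) ∂ν = (N * V)⁻¹ * (v₂ *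
      cnt N (fun t => κ₁ (s t).1 = κ₁ p.1 ∧ κ₃ (s t).2.2 = κ₃ p.2.2)) := by
    simp_rw [e]
    rw [integral_const_mul, integral_finsetSum]
    swap
    · intro t _
      refine Integrable.const_mul ?_ _
      refine Integrable.mul_const ?_ _
      exact I2 _ 1
    rw [cnt_cast]
    congr 1
    rw [Finset.mul_sum]
    refine Finset.sum_congr rfl fun t _ => ?_
    rw [integral_const_mul, integral_mul_const, integral_indicator_cell h2 hv2 hm2]
    rw [indicator_cell_one, indicator_cell_one]
    by_cases c1 : κ₁ (s t).1 = κ₁ p.1 <;> simp [c1]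
  have mYZ : ∫ x, hist (prodCell κ₁ κ₂ κ₃) V N s 1 (x, p.2.1, p.2.2) ∂μ = (N * V)⁻¹ * (v₁ *
      cnt N (fun t => κ₂ (s t).2.1 = κ₂ p.2.1 ∧ κ₃ (s t).2.2 = κ₃ p.2.2)) := by
    simp_rw [e]
    rw [integral_const_mul, integral_finsetSum]
    swap
    · intro t _
      refine Integrable.mul_const ?_ _
      exact I1 _ 1
    rw [cnt_cast]
    congr 1
    rw [Finset.mul_sum]
    refine Finset.sum_congr rfl fun t _ => ?_
    rw [integral_mul_const, integral_indicator_cell h1 hv1 hm1]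
    rw [indicator_cell_one, indicator_cell_one]
    by_cases c1 : κ₂ (s t).2.1 = κ₂ p.2.1 <;> simp [c1]
  have mZ : ∫ q : α × β, hist (prodCell κ₁ κ₂ κ₃) V N s 1 (q.1, q.2, p.2.2) ∂(μ.prod ν) =
      (N * V)⁻¹ * (v₁ * v₂ * cnt N (fun t => κ₃ (s t).2.2 = κ₃ p.2.2)) := by
    simp_rw [e']
    rw [integral_const_mul, integral_finsetSum]
    swap
    · intro t _
      refine Integrable.mul_const ?_ _
      exact (I1 _ 1).mul_prod (I2 _ 1)
    rw [cnt_cast]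
    congr 1
    rw [Finset.mul_sum]
    refine Finset.sum_congr rfl fun t _ => ?_
    rw [integral_mul_const, integral_prod_mul (f := {x | κ₁ x = κ₁ (s t).1}.indicator fun _ => 1)
      (g := {y | κ₂ y = κ₂ (s t).2.1}.indicator fun _ => 1), integral_indicator_cell h1 hv1 hm1,
      integral_indicator_cell h2 hv2 hm2]
    rw [indicator_cell_one]
    ring
  rw [condIndepDensity, marginProd, mXZ, mYZ, mZ, hist_one_apply]
  have hc : (fun t => prodCell κ₁ κ₂ κ₃ (s t) = prodCell κ₁ κ₂ κ₃ p) =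
      fun t => κ₁ (s t).1 = κ₁ p.1 ∧ κ₂ (s t).2.1 = κ₂ p.2.1 ∧ κ₃ (s t).2.2 = κ₃ p.2.2 := by
    funext t; simp [prodCell]
  rw [hc]
  -- The factors v₁ v₂ of the two margins cancel against those of the Z-margin, and N V cancels
  -- against the histogram, leaving counts only.
  have hN' : (N : ℝ) ≠ 0 := by exact_mod_cast hN.ne'
  have hV' : V ≠ 0 := by positivity
  field_simp

end HistProd

/-! ### The bias: averages over small cells. -/

section CellMean

variable {E C : Type*} [MeasurableSpace E] [MeasurableSpace C] [Countable C]
  [MeasurableSingletonClass C] {κ : E → C} {m : Measure E} [SigmaFinite m]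

/-- Tonelli: q is in the cell of p exactly when p is in the cell of q, so each q is counted with the
measure V of its cell. Averaging over cells therefore preserves integrals. -/
lemma lintegral_setLIntegral_cell (hκ : Measurable κ) {V : ℝ≥0∞}
    (hm : ∀ c, m {q | κ q = c} = V) {h : E → ℝ≥0∞} (hh : Measurable h) :
    ∫⁻ p, ∫⁻ q in {q | κ q = κ p}, h q ∂m ∂m = V * ∫⁻ q, h q ∂m := by
  have hs : MeasurableSet {r : E × E | κ r.2 = κ r.1} := by
    have : Measurable (fun r : E × E => (κ r.2, κ r.1)) := by fun_prop
    exact this (Set.to_countable {c : C × C | c.1 = c.2}).measurableSet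
  have e : ∀ p, ∫⁻ q in {q | κ q = κ p}, h q ∂m =
      ∫⁻ q, {r : E × E | κ r.2 = κ r.1}.indicator (fun r => h r.2) (p, q) ∂m := by
    intro p
    rw [← lintegral_indicator (measurableSet_cell hκ _)]
    rfl
  have mi : Measurable ({r : E × E | κ r.2 = κ r.1}.indicator (fun r => h r.2)) :=
    (hh.comp measurable_snd).indicator hs
  simp_rw [e]
  rw [lintegral_lintegral_swap (f := fun p q => {r : E × E | κ r.2 = κ r.1}.indicator
    (fun r => h r.2) (p, q)) mi.aemeasurable, ← lintegral_const_mul _ hh]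
  refine lintegral_congr fun q => ?_
  have e2 : ∀ p, {r : E × E | κ r.2 = κ r.1}.indicator (fun r => h r.2) (p, q) =
      {p | κ p = κ q}.indicator (fun _ => h q) p := by
    intro p
    by_cases hpq : κ p = κ q
    · simp [hpq]
    · simp [hpq, Ne.symm hpq]
  simp_rw [e2]
  rw [lintegral_indicator (measurableSet_cell hκ _), setLIntegral_const, hm, mul_comm]

end CellMean

section Bias

variable {E : Type*} [MetricSpace E] [MeasurableSpace E] [BorelSpace E] [LocallyCompactSpace E]
  {m : Measure E} [SigmaFinite m] [m.Regular]
  {C : Type*} [MeasurableSpace C] [Countable C] [MeasurableSingletonClass C]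

/-- The averages of an integrable function over cells of equal measure and small diameter are
close to the function in `L¹`, uniformly in the partition. -/
theorem exists_cellAverage_sub_le {F : E → ℝ} (mF : Measurable F) (hF : Integrable F m)
    {η : ℝ≥0∞} (hη : η ≠ 0) :
    ∃ δ > 0, ∀ (κ : E → C) (v : ℝ), Measurable κ → 0 < v →
      (∀ c, m {q | κ q = c} = ENNReal.ofReal v) → (∀ p q, κ p = κ q → dist p q ≤ δ) →
      ∫⁻ p, ‖v⁻¹ * ∫ q in {q | κ q = κ p}, F q ∂m - F p‖ₑ ∂m ≤ η := by
  wlog hηt : η ≠ ∞ generalizing η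
  · obtain ⟨δ, hδ, h⟩ := this (η := 1) one_ne_zero ENNReal.one_ne_top
    refine ⟨δ, hδ, fun κ v h1 h2 h3 h4 => ?_⟩
    rw [not_ne_iff.1 hηt]
    exact le_top
  have hη4 : η / 4 ≠ 0 := by simp [hη]
  obtain ⟨g, gs, hg, gc, gi⟩ := hF.exists_hasCompactSupport_lintegral_sub_le hη4
  set K := tsupport g with hK
  have mK : m K < ∞ := IsCompact.measure_lt_top gs
  have msK : MeasurableSet K := (isClosed_tsupport g).measurableSet
  -- The modulus η' is tuned to the measure of the support of g; the added 1 avoids division by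
  -- zero.
  obtain ⟨η', hη'0, hη'⟩ : ∃ η' : ℝ, 0 < η' ∧ ENNReal.ofReal η' * m K ≤ η / 4 := by
    refine ⟨(η / 4 / (m K + 1)).toReal, ?_, ?_⟩
    · refine ENNReal.toReal_pos ?_ ?_
      · exact (ENNReal.div_pos hη4 (by simp [mK.ne])).ne'
      · refine ENNReal.div_ne_top (ENNReal.div_ne_top hηt (by simp)) (by simp)
    · rw [ENNReal.ofReal_toReal (ENNReal.div_ne_top (ENNReal.div_ne_top hηt (by simp)) (by simp))]
      refine (mul_le_mul_right (le_self_add : m K ≤ m K + 1) _).trans ?_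
      exact (ENNReal.div_mul_cancel (by simp) (by simp [mK.ne])).le
  have huc : UniformContinuous g := gs.uniformContinuous_of_continuous gc
  obtain ⟨δ, hδ, hgδ⟩ := Metric.uniformContinuous_iff.1 huc η' hη'0
  refine ⟨δ / 2, half_pos hδ, fun κ v hκ hv hm hd => ?_⟩
  -- h dominates the oscillation of F in a cell, |F q - F p| ≤ h q + h p. Since g vanishes off K,
  -- the modulus is charged only to points of K, which keeps h integrable.
  set h : E → ℝ≥0∞ := fun p => ‖F p - g p‖ₑ + K.indicator (fun _ => ENNReal.ofReal η') p with hh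
  have mh : Measurable h :=
    (mF.sub gc.measurable).enorm.add (measurable_const.indicator msK)
  have hFh : ∀ p q, κ q = κ p → ‖F q - F p‖ₑ ≤ h q + h p := by
    intro p q hpq
    have d1 : dist (g q) (g p) < η' := hgδ ((hd q p hpq).trans_lt (half_lt_self hδ))
    have d2 : ‖g q - g p‖ₑ ≤ K.indicator (fun _ => ENNReal.ofReal η') q
        + K.indicator (fun _ => ENNReal.ofReal η') p := by
      by_cases hq : q ∈ K
      · rw [Set.indicator_of_mem hq]
        refine le_trans ?_ le_self_add
        rw [← ofReal_norm, ← dist_eq_norm]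
        exact ENNReal.ofReal_le_ofReal d1.le
      by_cases hp : p ∈ K
      · rw [Set.indicator_of_mem hp]
        refine le_trans ?_ le_add_self
        rw [← ofReal_norm, ← dist_eq_norm]
        exact ENNReal.ofReal_le_ofReal d1.le
      · rw [image_eq_zero_of_notMem_tsupport hq, image_eq_zero_of_notMem_tsupport hp]
        simp
    have e : F q - F p = (F q - g q) + (g q - g p) - (F p - g p) := by ring
    rw [e]
    refine (enorm_sub_le).trans ?_
    refine (add_le_add_left (enorm_add_le _ _) _).trans ?_
    refine (add_le_add_left (add_le_add_right d2 _) _).trans (le_of_eq ?_)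
    simp only [hh]
    ring
  have hV0 : ENNReal.ofReal v ≠ 0 := by simpa using hv
  have pt : ∀ p, ‖v⁻¹ * ∫ q in {q | κ q = κ p}, F q ∂m - F p‖ₑ ≤
      (ENNReal.ofReal v)⁻¹ * (∫⁻ q in {q | κ q = κ p}, h q ∂m) + h p := by
    intro p
    have e : v⁻¹ * ∫ q in {q | κ q = κ p}, F q ∂m - F p =
        v⁻¹ * ∫ q in {q | κ q = κ p}, (F q - F p) ∂m := by
      rw [integral_sub hF.integrableOn (integrableOn_const (by rw [hm]; simp)), setIntegral_const,
        Measure.real, hm, ENNReal.toReal_ofReal hv.le, mul_sub, smul_eq_mul, ← mul_assoc,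
        inv_mul_cancel₀ hv.ne', one_mul]
    rw [e, enorm_mul, Real.enorm_of_nonneg (inv_nonneg.2 hv.le), ENNReal.ofReal_inv_of_pos hv]
    calc _ ≤ (ENNReal.ofReal v)⁻¹ * ∫⁻ q in {q | κ q = κ p}, (h q + h p) ∂m := by
          gcongr
          refine (enorm_integral_le_lintegral_enorm _).trans ?_
          exact setLIntegral_mono (mh.add_const _) fun q hq => hFh p q hq
      _ = _ := by
          rw [lintegral_add_left mh, setLIntegral_const, hm, mul_add, mul_comm (h p), ← mul_assoc,
            ENNReal.inv_mul_cancel hV0 (by simp), one_mul]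
  have ih : ∫⁻ p, h p ∂m ≤ η / 4 + η / 4 := by
    simp only [hh]
    have m1 : Measurable fun p => ‖F p - g p‖ₑ := (mF.sub gc.measurable).enorm
    rw [lintegral_add_left m1, lintegral_indicator msK,
      setLIntegral_const]
    exact add_le_add hg hη'
  calc ∫⁻ p, ‖v⁻¹ * ∫ q in {q | κ q = κ p}, F q ∂m - F p‖ₑ ∂m
      ≤ ∫⁻ p, ((ENNReal.ofReal v)⁻¹ * (∫⁻ q in {q | κ q = κ p}, h q ∂m) + h p) ∂m :=
        lintegral_mono pt
    _ = (ENNReal.ofReal v)⁻¹ * (∫⁻ p, ∫⁻ q in {q | κ q = κ p}, h q ∂m ∂m) + ∫⁻ p, h p ∂m := by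
        rw [lintegral_add_right _ mh, lintegral_const_mul' _ _ (by simp [hv])]
    _ = ∫⁻ p, h p ∂m + ∫⁻ p, h p ∂m := by
        rw [lintegral_setLIntegral_cell hκ hm mh, ← mul_assoc,
          ENNReal.inv_mul_cancel hV0 (by simp), one_mul]
    -- The averaged h and h itself have the same integral, at most η/4 for approximation and η/4 for
    -- the modulus.
    _ ≤ (η / 4 + η / 4) + (η / 4 + η / 4) := add_le_add ih ih
    _ = η := by
        have : η / 4 + η / 4 = η / 2 := by
          rw [← ENNReal.add_div, ← two_mul, show (4 : ℝ≥0∞) = 2 * 2 by norm_num,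
            ENNReal.mul_div_mul_left _ _ (by simp) (by simp)]
        rw [this, ENNReal.add_halves]

end Bias

/-! ### Splitting the histogram error into deviation and bias. -/

section Deviation

variable {E C : Type*} [MeasurableSpace E] [MeasurableSpace C] [Countable C]
  [MeasurableSingletonClass C] {κ : E → C} {m P : Measure E}

/-- The deviation of the empirical mean over a cell from its expectation. -/
def cellDev (P : Measure E) (φ : E → ℝ) (κ : E → C) (N : ℕ) (s : ℕ → E) (c : C) : ℝ :=
  (∑ t ∈ Finset.range N, {q | κ q = c}.indicator φ (s t)) / N - ∫ q in {q | κ q = c}, φ q ∂P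

/-- The distance of a weighted histogram from the weighted density is controlled by the deviations
on the cells of a finite set that carries the law, and by the bias. -/
lemma lintegral_hist_sub_le [SigmaFinite m] (hκ : Measurable κ) {v : ℝ} (hv : 0 < v)
    (hm : ∀ c, m {q | κ q = c} = ENNReal.ofReal v) {f : E → ℝ≥0} (hf : Measurable f)
    (hP : P = m.withDensity (fun p => (f p : ℝ≥0∞))) {φ : E → ℝ}
    {N : ℕ} {s : ℕ → E} {S : Finset C} (hs : ∀ t < N, κ (s t) ∈ S) (hS : P {q | κ q ∉ S} = 0) :
    ∫⁻ p, ‖hist κ v N s (fun t => φ (s t)) p - φ p * f p‖ₑ ∂m ≤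
      ENNReal.ofReal (∑ c ∈ S, |cellDev P φ κ N s c|) +
      ∫⁻ p, ‖v⁻¹ * ∫ q in {q | κ q = κ p}, φ q * f q ∂m - φ p * f p‖ₑ ∂m := by
  have hint : ∀ c, ∫ q in {q | κ q = c}, φ q ∂P = ∫ q in {q | κ q = c}, φ q * f q ∂m := by
    intro c
    rw [hP, restrict_withDensity (measurableSet_cell hκ c),
      integral_withDensity_eq_integral_toReal_smul (by fun_prop) (by simp)]
    refine integral_congr_ae (Eventually.of_forall fun q => ?_)
    simp [mul_comm]
  -- Against the cell average of φ f, the histogram errs by the deviation of the cell divided by v;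
  -- integration over the cell cancels v.
  have hh : ∀ p, hist κ v N s (fun t => φ (s t)) p - v⁻¹ * ∫ q in {q | κ q = κ p}, φ q * f q ∂m =
      v⁻¹ * cellDev P φ κ N s (κ p) := by
    intro p
    rw [hist, cellDev, hint]
    have : ∀ t, {q | κ q = κ (s t)}.indicator (fun _ => φ (s t)) p =
        {q | κ q = κ p}.indicator φ (s t) := by
      intro t
      by_cases hpq : κ p = κ (s t)
      · simp [hpq]
      · simp [hpq, Ne.symm hpq]
    simp_rw [this]
    rw [mul_inv]
    ring
  have hdev : ∀ c, c ∉ S → cellDev P φ κ N s c = 0 := by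
    intro c hc
    have z1 : ∑ t ∈ Finset.range N, {q | κ q = c}.indicator φ (s t) = 0 := by
      refine Finset.sum_eq_zero fun t ht => ?_
      refine Set.indicator_of_notMem (fun h => hc ?_) _
      rw [← show κ (s t) = c from h]
      exact hs t (Finset.mem_range.1 ht)
    have z2 : P {q | κ q = c} = 0 :=
      measure_mono_null (fun q hq => by rw [Set.mem_ofPred_eq] at hq ⊢; rwa [hq]) hS
    rw [cellDev, z1, Measure.restrict_eq_zero.2 z2]
    simp
  have e1 : ∫⁻ p, ‖v⁻¹ * cellDev P φ κ N s (κ p)‖ₑ ∂m =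
      ENNReal.ofReal (∑ c ∈ S, |cellDev P φ κ N s c|) := by
    have e2 : ∀ p, ‖v⁻¹ * cellDev P φ κ N s (κ p)‖ₑ =
        ∑ c ∈ S, {q | κ q = c}.indicator (fun _ => ‖v⁻¹ * cellDev P φ κ N s c‖ₑ) p := by
      intro p
      by_cases hp : κ p ∈ S
      · rw [Finset.sum_eq_single_of_mem _ hp]
        · simp
        · intro c _ hc
          simp [hc.symm]
      · rw [hdev _ hp, Finset.sum_eq_zero]
        · simp
        · intro c hc
          refine Set.indicator_of_notMem (fun h => hp ?_) _
          rw [show κ p = c from h]; exact hc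
    simp_rw [e2]
    rw [lintegral_finsetSum _ fun c _ => measurable_const.indicator (measurableSet_cell hκ c),
      ENNReal.ofReal_sum_of_nonneg fun _ _ => abs_nonneg _]
    refine Finset.sum_congr rfl fun c _ => ?_
    rw [lintegral_indicator (measurableSet_cell hκ c), setLIntegral_const, hm, enorm_mul,
      Real.enorm_of_nonneg (inv_nonneg.2 hv.le), ENNReal.ofReal_inv_of_pos hv,
      mul_comm, ← mul_assoc, ENNReal.mul_inv_cancel (by simpa using hv) (by simp), one_mul,
      Real.enorm_eq_ofReal_abs]
  rw [← e1, ← lintegral_add_left]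
  · refine lintegral_mono fun p => ?_
    rw [← hh p]
    have e3 : hist κ v N s (fun t => φ (s t)) p - φ p * f p =
        (hist κ v N s (fun t => φ (s t)) p - v⁻¹ * ∫ q in {q | κ q = κ p}, φ q * f q ∂m) +
        (v⁻¹ * ∫ q in {q | κ q = κ p}, φ q * f q ∂m - φ p * f p) := by ring
    rw [e3]
    exact enorm_add_le _ _
  · exact ((Measurable.of_discrete (f := fun c => ‖v⁻¹ * cellDev P φ κ N s c‖ₑ)).comp hκ)

end Deviation

/-! ### Borel–Cantelli tools and an independent random parameter. -/

section BorelCantelli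

variable {Ω : Type*} [MeasurableSpace Ω] {μ : Measure Ω}

/-- The first Borel–Cantelli lemma after an index shift, since the bound holds only eventually; no
independence between indices enters. -/
lemma ae_eventually_notMem_of_summable {A : ℕ → Set Ω} {u : ℕ → ℝ} (hu : Summable u)
    (hu0 : ∀ n, 0 ≤ u n) (h : ∀ᶠ n in atTop, μ (A n) ≤ ENNReal.ofReal (u n)) :
    ∀ᵐ ω ∂μ, ∀ᶠ n in atTop, ω ∉ A n := by
  obtain ⟨n0, hn0⟩ := eventually_atTop.1 h
  have hs : ∑' n, μ (A (n + n0)) ≠ ∞ := by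
    refine ne_top_of_le_ne_top ?_ (ENNReal.tsum_le_tsum fun n => hn0 (n + n0) (by omega))
    rw [← ENNReal.ofReal_tsum_of_nonneg (fun n => hu0 _) ((summable_nat_add_iff n0).2 hu)]
    exact ENNReal.ofReal_ne_top
  filter_upwards [ae_eventually_notMem hs] with ω hω
  obtain ⟨k, hk⟩ := eventually_atTop.1 hω
  refine eventually_atTop.2 ⟨k + n0, fun n hn => ?_⟩
  have := hk (n - n0) (by omega)
  rwa [Nat.sub_add_cancel (by omega)] at this

lemma ae_tendsto_zero_of_forall_eventually_lt {D : ℕ → Ω → ℝ} (hD : ∀ n ω, 0 ≤ D n ω)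
    (h : ∀ δ > 0, ∀ᵐ ω ∂μ, ∀ᶠ n in atTop, D n ω < δ) :
    ∀ᵐ ω ∂μ, Tendsto (fun n => D n ω) atTop (𝓝 0) := by
  have h' : ∀ᵐ ω ∂μ, ∀ k : ℕ, ∀ᶠ n in atTop, D n ω < 1 / (k + 1 : ℝ) :=
    ae_all_iff.2 fun k => h _ Nat.one_div_pos_of_nat
  filter_upwards [h'] with ω hω
  rw [Metric.tendsto_atTop']
  intro δ hδ
  obtain ⟨k, hk⟩ := exists_nat_one_div_lt hδ
  obtain ⟨n0, hn0⟩ := eventually_atTop.1 (hω k)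
  refine ⟨n0, fun n hn => ?_⟩
  rw [Real.dist_eq, sub_zero, abs_of_nonneg (hD n ω)]
  exact (hn0 n hn.le).trans hk

/-- If every section of an event in an independent second variable has measure at most `r`, so
has the event. -/
lemma IndepFun.measure_le_of_forall_section {𝓤 𝓥 : Type*} [MeasurableSpace 𝓤] [MeasurableSpace 𝓥]
    [IsProbabilityMeasure μ] {U : Ω → 𝓤} {V : Ω → 𝓥} (h : IndepFun U V μ) (hU : AEMeasurable U μ)
    (hV : AEMeasurable V μ) {A : Set (𝓤 × 𝓥)} (hA : MeasurableSet A) {r : ℝ≥0∞}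
    (hr : ∀ v, μ {ω | (U ω, v) ∈ A} ≤ r) : μ {ω | (U ω, V ω) ∈ A} ≤ r := by
  have h1 := (indepFun_iff_map_prod_eq_prod_map_map hU hV).1 h
  have : IsProbabilityMeasure (μ.map U) := Measure.isProbabilityMeasure_map hU
  have : IsProbabilityMeasure (μ.map V) := Measure.isProbabilityMeasure_map hV
  have e : μ {ω | (U ω, V ω) ∈ A} = μ.map (fun ω => (U ω, V ω)) A := by
    rw [Measure.map_apply_of_aemeasurable (hU.prodMk hV) hA]; rfl
  rw [e, h1, Measure.prod_apply_symm hA]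
  calc ∫⁻ v, μ.map U ((fun u => (u, v)) ⁻¹' A) ∂(μ.map V) ≤ ∫⁻ _, r ∂(μ.map V) := by
        refine lintegral_mono fun v => ?_
        rw [Measure.map_apply_of_aemeasurable hU (measurable_prodMk_right hA)]
        exact hr v
    _ = r := by simp

end BorelCantelli

/-! ### Exponential concentration of the total deviation over cells. -/

section Concentration

variable {Ω E C : Type*} [MeasurableSpace Ω] [MeasurableSpace E] [MeasurableSpace C]
  [MeasurableSingletonClass C] {μ : Measure Ω} [IsProbabilityMeasure μ]
  {P : Measure E} [IsProbabilityMeasure P] {φ : E → ℝ} {M : ℝ}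

/-- A bounded function multiplied by a sign that depends on the cell, on the cells of `S`. -/
def signedSum (φ : E → ℝ) (κ : E → C) (S : Finset C) (σ : C → ℝ) (p : E) : ℝ :=
  ∑ c ∈ S, σ c * {q | κ q = c}.indicator φ p

-- Cells are disjoint, so at most one term is nonzero; the bound does not grow with S.
omit [MeasurableSpace E] [MeasurableSpace C] [MeasurableSingletonClass C] in
lemma abs_signedSum_le (hM : 0 ≤ M) (hφM : ∀ p, |φ p| ≤ M) (κ : E → C) (S : Finset C) {σ : C → ℝ}
    (hσ : ∀ c, |σ c| ≤ 1) (p : E) : |signedSum φ κ S σ p| ≤ M := by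
  unfold signedSum
  by_cases hp : κ p ∈ S
  · rw [Finset.sum_eq_single_of_mem _ hp]
    · rw [Set.indicator_of_mem (by rfl), abs_mul]
      calc |σ (κ p)| * |φ p| ≤ 1 * M := by gcongr; exacts [hσ _, hφM _]
        _ = M := one_mul M
    · intro c _ hc
      simp [hc.symm]
  · rw [Finset.sum_eq_zero]
    · simpa using hM
    · intro c hc
      rw [Set.indicator_of_notMem, mul_zero]
      rintro rfl
      exact hp hc

lemma measurable_signedSum (hφ : Measurable φ) {κ : E → C} (hκ : Measurable κ) (S : Finset C)
    (σ : C → ℝ) : Measurable (signedSum φ κ S σ) :=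
  Finset.measurable_sum _ fun _ _ => (hφ.indicator (measurableSet_cell hκ _)).const_mul _

/-- For fixed signs the signed total deviation is linear in the empirical measure, so it is a
centred sum of bounded variables, one per sample. -/
lemma sum_sign_cellDev (hφ : Measurable φ) (hφM : ∀ p, |φ p| ≤ M) {κ : E → C} (hκ : Measurable κ)
    (S : Finset C) (σ : C → ℝ) {N : ℕ} (hN : 0 < N) (s : ℕ → E) :
    N * ∑ c ∈ S, σ c * cellDev P φ κ N s c =
      ∑ t ∈ Finset.range N, (signedSum φ κ S σ (s t) - ∫ p, signedSum φ κ S σ p ∂P) := by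
  have hi : Integrable φ P := Integrable.of_bound hφ.aestronglyMeasurable M
    (Eventually.of_forall fun p => by simpa using hφM p)
  have e1 : ∫ p, signedSum φ κ S σ p ∂P = ∑ c ∈ S, σ c * ∫ q in {q | κ q = c}, φ q ∂P := by
    unfold signedSum
    rw [integral_finsetSum _ fun c _ =>
      (hi.indicator (measurableSet_cell hκ c)).const_mul (σ c)]
    refine Finset.sum_congr rfl fun c _ => ?_
    rw [integral_const_mul, integral_indicator (measurableSet_cell hκ c)]
  have hN' : (N : ℝ) ≠ 0 := by exact_mod_cast hN.ne'
  rw [Finset.sum_sub_distrib, Finset.sum_const, Finset.card_range, nsmul_eq_mul, e1]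
  unfold signedSum cellDev
  rw [Finset.sum_comm, Finset.mul_sum, Finset.mul_sum, ← Finset.sum_sub_distrib]
  refine Finset.sum_congr rfl fun c _ => ?_
  rw [← Finset.mul_sum]
  field_simp

/-- Exponential bound for the total deviation of the empirical means over the cells of `S`. -/
theorem measureReal_sum_abs_cellDev_ge_le {s : ℕ → Ω → E} (hlaw : ∀ t, HasLaw (s t) P μ)
    (hind : iIndepFun s μ) (hφ : Measurable φ) (hM : 0 ≤ M) (hφM : ∀ p, |φ p| ≤ M) {κ : E → C}
    (hκ : Measurable κ) (S : Finset C) {N : ℕ} (hN : 0 < N) {δ : ℝ} (hδ : 0 ≤ δ) :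
    μ.real {ω | δ ≤ ∑ c ∈ S, |cellDev P φ κ N (fun t => s t ω) c|} ≤
      2 ^ S.card * Real.exp (-(N * δ ^ 2 / (2 * M ^ 2))) := by
  classical
  -- A sum of absolute values is attained at one of 2^|S| sign patterns, indexed by the set of cells
  -- with sign +1; this gives the union bound.
  set σ : Finset C → C → ℝ := fun T c => if c ∈ T then 1 else -1 with hσ
  set A : Finset C → Set Ω := fun T => {ω | N * δ ≤ ∑ t ∈ Finset.range N,
    (signedSum φ κ S (σ T) (s t ω) - ∫ p, signedSum φ κ S (σ T) p ∂P)} with hA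
  have hsub : {ω | δ ≤ ∑ c ∈ S, |cellDev P φ κ N (fun t => s t ω) c|} ⊆
      ⋃ T ∈ S.powerset, A T := by
    intro ω hω
    simp only [Set.mem_iUnion]
    refine ⟨S.filter fun c => 0 ≤ cellDev P φ κ N (fun t => s t ω) c,
      Finset.mem_powerset.2 (Finset.filter_subset _ _), ?_⟩
    simp only [hA, Set.mem_ofPred_eq] at hω ⊢
    rw [← sum_sign_cellDev hφ hφM hκ S _ hN (fun t => s t ω)]
    refine mul_le_mul_of_nonneg_left (hω.trans (le_of_eq ?_)) (Nat.cast_nonneg N)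
    refine Finset.sum_congr rfl fun c hc => ?_
    simp only [hσ, Finset.mem_filter, hc, true_and]
    split_ifs with h
    · rw [abs_of_nonneg h, one_mul]
    · rw [abs_of_neg (not_le.1 h)]; ring
  have hbound : ∀ T, μ.real (A T) ≤ Real.exp (-(N * δ ^ 2 / (2 * M ^ 2))) := by
    intro T
    have hσ1 : ∀ c, |σ T c| ≤ 1 := by
      intro c; simp only [hσ]; split_ifs <;> simp
    have mS := measurable_signedSum hφ hκ S (σ T)
    have hsg : ∀ t < N, HasSubgaussianMGF
        (fun ω => signedSum φ κ S (σ T) (s t ω) - ∫ p, signedSum φ κ S (σ T) p ∂P)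
        ((‖M - (-M)‖₊ / 2) ^ 2) μ := by
      intro t _
      have e : ∫ p, signedSum φ κ S (σ T) p ∂P = ∫ ω, signedSum φ κ S (σ T) (s t ω) ∂μ := by
        rw [← (hlaw t).map_eq, integral_map (hlaw t).aemeasurable mS.aestronglyMeasurable]
      rw [e]
      refine hasSubgaussianMGF_of_mem_Icc (mS.comp_aemeasurable (hlaw t).aemeasurable)
        (Eventually.of_forall fun ω => ?_)
      exact abs_le.1 (abs_signedSum_le hM hφM κ S hσ1 _)
    have hindT : iIndepFun (fun t ω => signedSum φ κ S (σ T) (s t ω) -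
        ∫ p, signedSum φ κ S (σ T) p ∂P) μ :=
      hind.comp (fun _ p => signedSum φ κ S (σ T) p - ∫ p, signedSum φ κ S (σ T) p ∂P)
        (fun _ => mS.sub_const _)
    refine (HasSubgaussianMGF.measure_sum_range_ge_le_of_iIndepFun hindT hsg
      (by positivity : 0 ≤ N * δ)).trans (le_of_eq ?_)
    congr 1
    -- Hoeffding's lemma on [-M, M]: the half-width M gives variance proxy M².
    have e2 : ((((‖M - (-M)‖₊ / 2) ^ 2 : ℝ≥0)) : ℝ) = M ^ 2 := by
      push_cast
      rw [Real.norm_eq_abs, sub_neg_eq_add, ← two_mul, abs_of_nonneg (by positivity)]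
      ring
    rw [e2]
    have hN' : (N : ℝ) ≠ 0 := by exact_mod_cast hN.ne'
    rcases eq_or_ne M 0 with h | h
    · simp [h]
    · field_simp
  calc _ ≤ μ.real (⋃ T ∈ S.powerset, A T) := measureReal_mono hsub (measure_ne_top _ _)
    _ ≤ ∑ T ∈ S.powerset, μ.real (A T) := measureReal_biUnion_finset_le _ _
    _ ≤ ∑ _T ∈ S.powerset, Real.exp (-(N * δ ^ 2 / (2 * M ^ 2))) :=
        Finset.sum_le_sum fun T _ => hbound T
    _ = _ := by rw [Finset.sum_const, Finset.card_powerset, nsmul_eq_mul]; push_cast; rfl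

/-- Joint measurability in samples and parameter is what lets Fubini freeze the random shift. -/
lemma measurable_sum_abs_cellDev {B : Type*} [MeasurableSpace B] (hφ : Measurable φ)
    {κ : B → E → C} (hκ : Measurable (Function.uncurry κ)) (S : Finset C) (N : ℕ) :
    Measurable (fun r : (ℕ → E) × B => ∑ c ∈ S, |cellDev P φ (κ r.2) N r.1 c|) := by
  refine Finset.measurable_sum _ fun c _ => Measurable.abs ?_
  unfold cellDev
  refine Measurable.sub ?_ ?_
  · refine Measurable.div_const (Finset.measurable_sum _ fun t _ => ?_) _
    have e : (fun r : (ℕ → E) × B => {q | κ r.2 q = c}.indicator φ (r.1 t)) =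
        {r : (ℕ → E) × B | κ r.2 (r.1 t) = c}.indicator (fun r => φ (r.1 t)) := by
      funext r; simp [Set.indicator]
    rw [e]
    have m1 : Measurable (fun r : (ℕ → E) × B => r.1 t) :=
      (measurable_pi_apply t).comp measurable_fst
    have m2 : Measurable (fun r : (ℕ → E) × B => κ r.2 (r.1 t)) :=
      hκ.comp (measurable_snd.prodMk m1)
    exact (hφ.comp m1).indicator (measurableSet_cell m2 c)
  · have e : (fun r : (ℕ → E) × B => ∫ q in {q | κ r.2 q = c}, φ q ∂P) = fun r =>
        ∫ q, {x : ((ℕ → E) × B) × E | κ x.1.2 x.2 = c}.indicator (fun x => φ x.2) (r, q) ∂P := by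
      funext r
      have : Measurable (κ r.2) := hκ.comp measurable_prodMk_left
      rw [← integral_indicator (measurableSet_cell this c)]
      rfl
    rw [e]
    have m2 : Measurable (fun x : ((ℕ → E) × B) × E => κ x.1.2 x.2) :=
      hκ.comp ((measurable_snd.comp measurable_fst).prodMk measurable_snd)
    have m3 : Measurable ({x : ((ℕ → E) × B) × E | κ x.1.2 x.2 = c}.indicator
        (fun x => φ x.2)) := (hφ.comp measurable_snd).indicator (measurableSet_cell m2 c)
    exact (m3.stronglyMeasurable.integral_prod_right' (ν := P)).measurable

/-- The total deviation over the cells tends to zero almost surely when the number of cells is of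
smaller order than the sample size, also for partitions with an independent random parameter. -/
theorem ae_tendsto_sum_abs_cellDev {B : Type*} [MeasurableSpace B] {s : ℕ → Ω → E}
    (hlaw : ∀ t, HasLaw (s t) P μ) (hind : iIndepFun s μ) (hφ : Measurable φ)
    (hφM : ∀ p, |φ p| ≤ M) {β : ℕ → Ω → B} (hβ : ∀ N, AEMeasurable (β N) μ)
    (hβind : ∀ N, 1 ≤ N → IndepFun (fun ω t => s t ω) (β N) μ)
    {κ : ℕ → B → E → C} (hκ : ∀ N, Measurable (Function.uncurry (κ N))) {S : ℕ → Finset C}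
    (hS : Tendsto (fun N => ((S N).card : ℝ) / N) atTop (𝓝 0)) :
    ∀ᵐ ω ∂μ, Tendsto (fun N => ∑ c ∈ S N, |cellDev P φ (κ N (β N ω)) N (fun t => s t ω) c|)
      atTop (𝓝 0) := by
  refine ae_tendsto_zero_of_forall_eventually_lt
    (fun n ω => Finset.sum_nonneg fun _ _ => abs_nonneg _) fun δ hδ => ?_
  set M' := max M 1 with hM'
  have hM'0 : 0 < M' := lt_max_of_lt_right one_pos
  -- r is half of Hoeffding's rate δ²/(2M'²): the other half pays for the union bound, since
  -- eventually |S N| < rN and 2 ≤ e.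
  set r := δ ^ 2 / (4 * M' ^ 2) with hr
  have hr0 : 0 < r := by positivity
  have hsum : Summable (fun N : ℕ => Real.exp (-r * N)) := by
    have : ∀ N : ℕ, Real.exp (-r * N) = Real.exp (-r) ^ N := fun N => by
      rw [← Real.exp_nat_mul]; ring_nf
    simp_rw [this]
    exact summable_geometric_of_lt_one (Real.exp_pos _).le (by rw [Real.exp_lt_one_iff]; linarith)
  have key : ∀ᶠ N in atTop, μ {ω | δ ≤ ∑ c ∈ S N, |cellDev P φ (κ N (β N ω)) N
      (fun t => s t ω) c|} ≤ ENNReal.ofReal (Real.exp (-r * N)) := by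
    filter_upwards [eventually_ge_atTop 1, (tendsto_order.1 hS).2 r hr0] with N hN hSN
    have hNpos : (0 : ℝ) < N := by exact_mod_cast hN
    have hms := measurable_sum_abs_cellDev (P := P) hφ (hκ N) (S N) N
    -- For each frozen parameter the partition is deterministic, and the tail bound does not depend
    -- on the parameter.
    refine IndepFun.measure_le_of_forall_section (hβind N hN)
      (aemeasurable_pi_lambda _ fun t => (hlaw t).aemeasurable) (hβ N)
      (A := {x | δ ≤ ∑ c ∈ S N, |cellDev P φ (κ N x.2) N x.1 c|})
      (measurableSet_le measurable_const hms) fun b => ?_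
    have h1 := measureReal_sum_abs_cellDev_ge_le hlaw hind hφ hM'0.le
      (fun p => (hφM p).trans (le_max_left M 1))
      (κ := κ N b) ((hκ N).comp measurable_prodMk_left) (S N) hN hδ.le
    have h2 : (2 : ℝ) ^ (S N).card * Real.exp (-(N * δ ^ 2 / (2 * M' ^ 2))) ≤
        Real.exp (-r * N) := by
      have h3 : (2 : ℝ) ^ (S N).card ≤ Real.exp ((S N).card) := by
        rw [← Real.exp_one_pow]
        exact pow_le_pow_left₀ (by norm_num) (by linarith [Real.add_one_le_exp (1 : ℝ)]) _
      refine (mul_le_mul_of_nonneg_right h3 (Real.exp_pos _).le).trans ?_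
      rw [← Real.exp_add]
      refine Real.exp_le_exp.2 ?_
      have h4 : ((S N).card : ℝ) < r * N := by rwa [div_lt_iff₀ hNpos] at hSN
      have h5 : N * δ ^ 2 / (2 * M' ^ 2) = 2 * (r * N) := by rw [hr]; field_simp; ring
      rw [h5]
      linarith
    rw [← ofReal_measureReal]
    exact ENNReal.ofReal_le_ofReal (h1.trans h2)
  filter_upwards [ae_eventually_notMem_of_summable hsum (fun _ => (Real.exp_pos _).le) key]
    with ω hω
  filter_upwards [hω] with N hN
  simpa using hN

end Concentration

/-! ### Collisions of the random hash function. -/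

section Collisions

variable {Ω C : Type*} [MeasurableSpace Ω] {μ : Measure Ω}

/-- The number of elements of `S` that are lost under the map `g`. -/
def collisions (S : Finset C) (g : C → ℕ) : ℕ := S.card - (S.image g).card

lemma measure_hash_mem_le {L : ℕ} {V : Ω → ℕ}
    (hV : HasLaw V (uniformOn (Set.Icc 1 L)) μ) (A : Finset ℕ) :
    μ.map V (A : Set ℕ) ≤ (A.card : ℝ≥0∞) / L := by
  rw [hV.map_eq]
  have e : (Set.Icc 1 L) = ((Finset.Icc 1 L : Finset ℕ) : Set ℕ) := by simp
  have hc : Measure.count (Set.Icc 1 L) = (L : ℝ≥0∞) := by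
    rw [e, Measure.count_apply_finset]; simp
  rw [uniformOn, cond_apply measurableSet_Icc, hc, ENNReal.div_eq_inv_mul]
  gcongr
  calc Measure.count (Set.Icc 1 L ∩ (A : Set ℕ)) ≤ Measure.count (A : Set ℕ) :=
        measure_mono Set.inter_subset_right
    _ = A.card := Measure.count_apply_finset A

lemma collisions_insert [DecidableEq C] {S : Finset C} {c : C} (hc : c ∉ S) (g : C → ℕ) :
    collisions (insert c S) g = collisions S g + if g c ∈ S.image g then 1 else 0 := by
  have h := Finset.card_image_le (s := S) (f := g)
  unfold collisions
  rw [Finset.card_insert_of_notMem hc, Finset.image_insert]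
  split_ifs with h1
  · rw [Finset.insert_eq_of_mem h1]; omega
  · rw [Finset.card_insert_of_notMem h1]; omega

lemma aemeasurable_collisions {h : C → Ω → ℕ} (hm : ∀ c, AEMeasurable (h c) μ) (S : Finset C) :
    AEMeasurable (fun ω => collisions S (fun c => h c ω)) μ := by
  classical
  have e : (fun ω => collisions S (fun c => h c ω)) =
      (fun u : S → ℕ => S.card - (Finset.univ.image u).card) ∘ fun ω (i : S) => h i ω := by
    funext ω
    simp only [collisions, Function.comp]
    congr 2
    ext x; simp
  rw [e]
  exact (Measurable.of_discrete).comp_aemeasurable (aemeasurable_pi_lambda _ fun i => hm i)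

/-- An exponential moment of the number of collisions of a random hash function. -/
theorem lintegral_pow_collisions_le [IsProbabilityMeasure μ] {h : C → Ω → ℕ} {L : ℕ}
    (hlaw : ∀ c, HasLaw (h c) (uniformOn (Set.Icc 1 L)) μ) (hind : iIndepFun h μ) (t : ℝ≥0∞)
    (F : ℕ) (S : Finset C) (hS : S.card ≤ F) :
    ∫⁻ ω, (1 + t) ^ collisions S (fun c => h c ω) ∂μ ≤ (1 + t * (F / L)) ^ S.card := by
  classical
  induction S using Finset.induction_on with
  | empty => simp [collisions]
  | insert c S hc ih =>
    have hSF : S.card ≤ F := (Finset.card_le_card (Finset.subset_insert c S)).trans hS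
    have hm : ∀ c, AEMeasurable (h c) μ := fun c => (hlaw c).aemeasurable
    set U : Ω → (S → ℕ) := fun ω i => h i ω with hU
    have hUm : AEMeasurable U μ := aemeasurable_pi_lambda _ fun i => hm i
    -- The hash of the new cell is independent of the earlier ones and hits one of at most F used
    -- values with probability at most F/L, so the moment gains a factor 1 + tF/L.
    have hUV : IndepFun U (h c) μ := by
      have := hind.indepFun_finset₀ S {c} (Finset.disjoint_singleton_right.2 hc) hm
      exact this.comp (φ := id) (ψ := fun u : (({c} : Finset C) → ℕ) => u ⟨c, by simp⟩)
        measurable_id (measurable_pi_apply _)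
    have hmap := (indepFun_iff_map_prod_eq_prod_map_map hUm (hm c)).1 hUV
    have : IsProbabilityMeasure (μ.map U) := Measure.isProbabilityMeasure_map hUm
    have : IsProbabilityMeasure (μ.map (h c)) := Measure.isProbabilityMeasure_map (hm c)
    set I : (S → ℕ) → Finset ℕ := fun u => Finset.univ.image u with hI
    set Φ : (S → ℕ) → ℝ≥0∞ := fun u => (1 + t) ^ (S.card - (I u).card) with hΦ
    have himg : ∀ ω, S.image (fun c => h c ω) = I (U ω) := by
      intro ω; ext x; simp [hI, hU]
    have hΦU : ∀ ω, Φ (U ω) = (1 + t) ^ collisions S (fun c => h c ω) := by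
      intro ω; rw [hΦ, collisions, himg]
    set Ψ : (S → ℕ) × ℕ → ℝ≥0∞ :=
      fun q => Φ q.1 * (1 + t * (I q.1 : Set ℕ).indicator 1 q.2) with hΨ
    have hΨm : Measurable Ψ := Measurable.of_discrete
    have e : ∀ ω, (1 + t) ^ collisions (insert c S) (fun c => h c ω) = Ψ (U ω, h c ω) := by
      intro ω
      rw [collisions_insert hc, hΨ]
      simp only
      rw [hΦU, pow_add, himg]
      by_cases hx : h c ω ∈ I (U ω)
      · simp [hx]
      · simp [hx]
    simp_rw [e]
    rw [← lintegral_map' (f := Ψ) (g := fun ω => (U ω, h c ω)) hΨm.aemeasurable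
      (hUm.prodMk (hm c)), hmap, lintegral_prod _ hΨm.aemeasurable, Finset.card_insert_of_notMem hc,
      pow_succ]
    calc ∫⁻ u, ∫⁻ v, Ψ (u, v) ∂(μ.map (h c)) ∂(μ.map U)
        ≤ ∫⁻ u, Φ u * (1 + t * (F / L)) ∂(μ.map U) := by
          refine lintegral_mono fun u => ?_
          simp only [hΨ]
          rw [lintegral_const_mul _ Measurable.of_discrete]
          gcongr
          rw [lintegral_add_left measurable_const, lintegral_const_mul _ Measurable.of_discrete,
            lintegral_indicator_one (by measurability)]
          simp only [lintegral_const, measure_univ, mul_one]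
          gcongr
          refine (measure_hash_mem_le (hlaw c) (I u)).trans ?_
          gcongr
          calc (I u).card ≤ (Finset.univ : Finset S).card := Finset.card_image_le
            _ ≤ F := by simpa using hSF
      _ = (∫⁻ ω, (1 + t) ^ collisions S (fun c => h c ω) ∂μ) * (1 + t * (F / L)) := by
          rw [lintegral_mul_const _ Measurable.of_discrete,
            lintegral_map' (f := Φ) Measurable.of_discrete.aemeasurable hUm]
          simp_rw [hΦU]
      _ ≤ _ := by gcongr; exact ih hSF

/-- Markov's inequality for the exponential moment with t = L/F: the moment is at most 2^F, and (1 +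
t)^k ≥ (L/F)^k. -/
theorem measure_le_collisions_le [IsProbabilityMeasure μ] {h : C → Ω → ℕ} {L : ℕ} (hL : 0 < L)
    (hlaw : ∀ c, HasLaw (h c) (uniformOn (Set.Icc 1 L)) μ) (hind : iIndepFun h μ)
    (S : Finset C) {F : ℕ} (hF : 0 < F) (hS : S.card ≤ F) (k : ℕ) :
    μ {ω | k ≤ collisions S (fun c => h c ω)} ≤ ENNReal.ofReal (2 ^ F * (F / L) ^ k) := by
  have hL' : (0:ℝ) < L := by exact_mod_cast hL
  have hF' : (0:ℝ) < F := by exact_mod_cast hF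
  set t : ℝ≥0∞ := L / F with ht
  have ht0 : t ≠ 0 := by
    rw [ht]; exact (ENNReal.div_pos (by exact_mod_cast hL.ne') (by simp)).ne'
  have htt : t ≠ ∞ := ENNReal.div_ne_top (by simp) (by exact_mod_cast hF.ne')
  have h1 := lintegral_pow_collisions_le hlaw hind t F S hS
  have h2 : t * (F / L) = 1 := by
    have : ((F : ℝ≥0∞) / L) = t⁻¹ := by rw [ht, ENNReal.inv_div (by simp) (by simp [hF.ne'])]
    rw [this, ENNReal.mul_inv_cancel ht0 htt]
  have h3 : ∫⁻ ω, (1 + t) ^ collisions S (fun c => h c ω) ∂μ ≤ 2 ^ F := by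
    refine h1.trans ?_
    rw [h2, one_add_one_eq_two]
    exact pow_le_pow_right₀ (by norm_num) hS
  have h4 : t ^ k * μ {ω | k ≤ collisions S (fun c => h c ω)} ≤ 2 ^ F := by
    refine le_trans ?_ h3
    calc t ^ k * μ {ω | k ≤ collisions S (fun c => h c ω)}
        ≤ t ^ k * μ {ω | t ^ k ≤ (1 + t) ^ collisions S (fun c => h c ω)} := by
          gcongr with ω
          intro hω
          calc t ^ k ≤ (1 + t) ^ k := by gcongr; exact le_add_self
            _ ≤ _ := pow_le_pow_right₀ le_self_add hω
      _ ≤ _ := mul_meas_ge_le_lintegral₀ ((aemeasurable_collisions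
          (fun c => (hlaw c).aemeasurable) S).const_pow _) _
  have h5 : μ {ω | k ≤ collisions S (fun c => h c ω)} ≤ 2 ^ F / t ^ k := by
    rw [ENNReal.le_div_iff_mul_le (Or.inl (pow_ne_zero _ ht0)) (Or.inl (ENNReal.pow_ne_top htt)),
      mul_comm]
    exact h4
  refine h5.trans (le_of_eq ?_)
  rw [ENNReal.ofReal_mul (by positivity), ENNReal.ofReal_pow (by positivity),
    ENNReal.ofReal_pow (by positivity), ENNReal.ofReal_div_of_pos hL', ENNReal.ofReal_natCast,
    ENNReal.ofReal_natCast, ENNReal.div_eq_inv_mul, mul_comm, ENNReal.inv_pow, ht,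
    ENNReal.inv_div (by simp) (by simp [hF.ne'])]
  simp

/-- A summable tail bound in two regimes. If (Bk)² ≤ N, four factors Bk/N ≤ N^(-1/2) suffice;
otherwise the geometric decay 2^(-j) is at most k^(-4), which is of order N^(-2). -/
lemma two_pow_mul_pow_le {B k N : ℝ} {j : ℕ} (hk : (j : ℝ) = k) (hB : 1 ≤ B) (hj : 4 ≤ j)
    (hN : 0 < N) (hkN : B * k / N ≤ 1 / 2) (hk4 : k ^ 4 * (1 / 2) ^ j ≤ 1) :
    (B * k / N) ^ j ≤ B ^ 4 / N ^ 2 := by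
  have hk0 : 0 < k := by rw [← hk]; exact_mod_cast (by omega : 0 < j)
  have hx : 0 ≤ B * k / N := by positivity
  rcases le_total ((B * k) ^ 2) N with h | h
  · calc (B * k / N) ^ j ≤ (B * k / N) ^ 4 := pow_le_pow_of_le_one hx (by linarith) hj
      _ = ((B * k) ^ 2) ^ 2 / N ^ 4 := by rw [div_pow]; ring
      _ ≤ N ^ 2 / N ^ 4 := by gcongr
      _ = 1 / N ^ 2 := by field_simp
      _ ≤ B ^ 4 / N ^ 2 := by gcongr; exact one_le_pow₀ hB
  · calc (B * k / N) ^ j ≤ (1 / 2) ^ j := by gcongr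
      _ ≤ 1 / k ^ 4 := by rw [le_div_iff₀ (by positivity), mul_comm]; exact hk4
      _ = B ^ 4 / ((B * k) ^ 2) ^ 2 := by field_simp
      _ ≤ B ^ 4 / N ^ 2 := by gcongr

/-- If the number of points is at most of order `1 / w N` and the number of values of the hash
functions is at least `N`, where `N * w N → ∞`, then almost surely the number of collisions is
`o(1 / w N)`. -/
theorem ae_tendsto_collisions_mul [IsProbabilityMeasure μ] {h : ℕ → C → Ω → ℕ} {L : ℕ → ℕ}
    (hL : ∀ N, N ≤ L N) (hlaw : ∀ N, 1 ≤ N → ∀ c, HasLaw (h N c) (uniformOn (Set.Icc 1 (L N))) μ)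
    (hind : ∀ N, 1 ≤ N → iIndepFun (h N) μ) {S : ℕ → Finset C} {w : ℕ → ℝ} (hw : ∀ N, 0 < w N)
    (hw0 : Tendsto w atTop (𝓝 0)) {A : ℝ} (hA : ∀ᶠ N in atTop, (S N).card * w N ≤ A)
    (hNw : Tendsto (fun N : ℕ => N * w N) atTop atTop) :
    ∀ᵐ ω ∂μ, Tendsto (fun N => collisions (S N) (fun c => h N c ω) * w N) atTop (𝓝 0) := by
  refine ae_tendsto_zero_of_forall_eventually_lt
    (fun N ω => mul_nonneg (Nat.cast_nonneg _) (hw N).le) fun δ hδ => ?_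
  -- The threshold k is about δ/w. At most A/w ≤ qk cells are hashed, so the tail bound with F = qk
  -- is 2^(qk) (qk/L)^k = (Bk/L)^k, with Bk/N → 0 since N w → ∞.
  set k : ℕ → ℕ := fun N => ⌈δ / w N⌉₊ with hk
  set q : ℕ := ⌈A / δ⌉₊ + 1 with hq
  set B : ℝ := 2 ^ q * q with hB
  have hq1 : (1:ℝ) ≤ q := by rw [hq]; push_cast; linarith [Nat.cast_nonneg (α := ℝ) ⌈A / δ⌉₊]
  have hB1 : 1 ≤ B := by
    rw [hB]
    calc (1:ℝ) = 1 * 1 := by ring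
      _ ≤ 2 ^ q * q := mul_le_mul (one_le_pow₀ (by norm_num)) hq1 zero_le_one (by positivity)
  have hdw : Tendsto (fun N => δ / w N) atTop atTop := by
    have : Tendsto w atTop (𝓝[>] 0) :=
      tendsto_nhdsWithin_iff.2 ⟨hw0, Eventually.of_forall hw⟩
    simp_rw [div_eq_mul_inv]
    exact (tendsto_inv_nhdsGT_zero.comp this).const_mul_atTop hδ
  have hkt : Tendsto k atTop atTop := (tendsto_nat_ceil_atTop).comp hdw
  have hkN : Tendsto (fun N : ℕ => B * k N / N) atTop (𝓝 0) := by
    have h1 : Tendsto (fun N : ℕ => B * (δ * ((N:ℝ) * w N)⁻¹ + (N:ℝ)⁻¹)) atTop (𝓝 0) := by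
      have := (((tendsto_inv_atTop_zero.comp hNw).const_mul δ).add
        (tendsto_inv_atTop_zero.comp (tendsto_natCast_atTop_atTop (R := ℝ)))).const_mul B
      simpa using this
    refine squeeze_zero (fun N => by positivity) (fun N => ?_) h1
    have := (Nat.ceil_lt_add_one (div_nonneg hδ.le (hw N).le)).le
    calc B * k N / N ≤ B * (δ / w N + 1) / N := by gcongr
      _ = _ := by rw [mul_inv]; ring
  have hk4 : Tendsto (fun N => (k N : ℝ) ^ 4 * (1 / 2) ^ k N) atTop (𝓝 0) :=
    (tendsto_pow_const_mul_const_pow_of_abs_lt_one 4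
      (by rw [abs_of_pos] <;> norm_num : |(1 / 2 : ℝ)| < 1)).comp hkt
  have hsum : Summable fun N : ℕ => B ^ 4 / (N : ℝ) ^ 2 := by
    have := (Real.summable_one_div_nat_pow.2 (one_lt_two)).mul_left (B ^ 4)
    simpa [div_eq_mul_inv] using this
  have key := ae_eventually_notMem_of_summable (μ := μ)
    (A := fun N => {ω | k N ≤ collisions (S N) (fun c => h N c ω)}) hsum
    (fun N => by positivity) ?_
  · filter_upwards [key] with ω hω
    filter_upwards [hω] with N hN
    simp only [not_le] at hN
    have := Nat.lt_ceil.1 hN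
    rwa [lt_div_iff₀ (hw N)] at this
  · filter_upwards [hA, hkN.eventually_le_const (by norm_num : (0:ℝ) < 1 / 2),
      hk4.eventually_le_const one_pos, hkt.eventually_ge_atTop 4, eventually_ge_atTop 1]
      with N h1 h2 h3 h4 h5
    have hN0 : (0:ℝ) < N := by exact_mod_cast h5
    have hcard : (S N).card ≤ q * k N := by
      have : ((S N).card : ℝ) ≤ q * k N := by
        calc ((S N).card : ℝ) ≤ A / w N := by rwa [le_div_iff₀ (hw N)]
          _ = A / δ * (δ / w N) := by field_simp
          _ ≤ q * k N := by
            refine mul_le_mul ?_ (Nat.le_ceil _) (div_nonneg hδ.le (hw N).le) (by positivity)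
            rw [hq]; push_cast
            exact (Nat.le_ceil _).trans (by linarith)
      exact_mod_cast this
    refine (measure_le_collisions_le (h5.trans (hL N)) (hlaw N h5) (hind N h5) (S N)
      (F := q * k N) (Nat.mul_pos (by omega) (by omega)) hcard (k N)).trans
      (ENNReal.ofReal_le_ofReal ?_)
    refine le_trans ?_ (two_pow_mul_pow_le rfl hB1 h4 hN0 h2 h3)
    rw [pow_mul, ← mul_pow]
    have hNL : (N:ℝ) ≤ L N := by exact_mod_cast hL N
    refine pow_le_pow_left₀ (by positivity) ?_ _
    push_cast
    calc (2:ℝ) ^ q * (q * k N / L N) ≤ 2 ^ q * (q * k N / N) := by gcongr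
      _ = B * k N / N := by rw [hB]; ring

-- A hash fibre of size n ≥ 2 contains n colliding cells and loses n - 1, and n ≤ 2(n - 1); a fibre
-- of size 1 contributes nothing.
open Classical in
lemma card_filter_collide_le (S : Finset C) (g : C → ℕ) :
    {c ∈ S | ∃ c' ∈ S, c' ≠ c ∧ g c' = g c}.card ≤ 2 * collisions S g := by
  have h1 : S.card = ∑ i ∈ S.image g, {c ∈ S | g c = i}.card :=
    Finset.card_eq_sum_card_image g S
  have h2 : {c ∈ S | ∃ c' ∈ S, c' ≠ c ∧ g c' = g c}.card =
      ∑ i ∈ S.image g, {c ∈ {c ∈ S | ∃ c' ∈ S, c' ≠ c ∧ g c' = g c} | g c = i}.card :=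
    Finset.card_eq_sum_card_fiberwise fun c hc =>
      Finset.mem_image_of_mem g (Finset.mem_filter.1 hc).1
  have h3 : (S.image g).card = ∑ _i ∈ S.image g, 1 := by simp
  have h4 : ∀ i ∈ S.image g, {c ∈ {c ∈ S | ∃ c' ∈ S, c' ≠ c ∧ g c' = g c} | g c = i}.card + 2 ≤
      2 * {c ∈ S | g c = i}.card := by
    intro i hi
    obtain ⟨c, hc, hci⟩ := Finset.mem_image.1 hi
    have hT : c ∈ {c ∈ S | g c = i} := Finset.mem_filter.2 ⟨hc, hci⟩
    have hle : {c ∈ {c ∈ S | ∃ c' ∈ S, c' ≠ c ∧ g c' = g c} | g c = i}.card ≤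
        {c ∈ S | g c = i}.card :=
      Finset.card_le_card (Finset.filter_subset_filter _ (Finset.filter_subset _ _))
    rcases (Finset.card_pos.2 ⟨c, hT⟩ : 0 < _).nat_succ_le.eq_or_lt with h | h
    · have he : {c ∈ {c ∈ S | ∃ c' ∈ S, c' ≠ c ∧ g c' = g c} | g c = i} = ∅ := by
        rw [Finset.eq_empty_iff_forall_notMem]
        intro x hx
        simp only [Finset.mem_filter] at hx
        obtain ⟨⟨hxS, c', hc', hne, hgc⟩, hxi⟩ := hx
        exact hne (Finset.card_le_one.1 h.symm.le c' (Finset.mem_filter.2 ⟨hc', hgc.trans hxi⟩) x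
          (Finset.mem_filter.2 ⟨hxS, hxi⟩))
      rw [he, Finset.card_empty]; omega
    · omega
  have h5 := Finset.sum_le_sum h4
  rw [Finset.sum_add_distrib, ← h2, ← Finset.mul_sum, ← h1, Finset.sum_const, smul_eq_mul] at h5
  unfold collisions
  omega

end Collisions

/-! ### The estimator as a sample mean, and its stability under merging. -/

section SampleEstimator

variable {A B D : Type*}

/-- The number of samples with the labels `i` and `k`, `j` and `k`, divided by the numbers for `k`
and for `i`, `j` and `k`, where `i`, `j`, `k` are the labels of the `t`-th sample. -/
def depRatio (N : ℕ) (u : ℕ → A) (v : ℕ → B) (s : ℕ → D) (t : ℕ) : ℝ :=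
  (cnt N (fun r => u r = u t ∧ s r = s t) : ℝ) * cnt N (fun r => v r = v t ∧ s r = s t) /
    (cnt N (fun r => s r = s t) * cnt N (fun r => u r = u t ∧ v r = v t ∧ s r = s t))

/-- The estimator as a mean over the samples. -/
def sampleEstimator (N : ℕ) (u : ℕ → A) (v : ℕ → B) (s : ℕ → D) (a : ℕ → ℝ) : ℝ :=
  (∑ t ∈ Finset.range N, a t * gFun (depRatio N u v s t)) / N

lemma depRatio_nonneg (N : ℕ) (u : ℕ → A) (v : ℕ → B) (s : ℕ → D) (t : ℕ) :
    0 ≤ depRatio N u v s t := by unfold depRatio; positivity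

lemma cnt_pos {N : ℕ} {q : ℕ → Prop} {t : ℕ} (ht : t < N) (hq : q t) : 0 < cnt N q := by
  classical
  exact Finset.card_pos.2 ⟨t, Finset.mem_filter.2 ⟨Finset.mem_range.2 ht, hq⟩⟩

lemma cnt_congr {N : ℕ} {q q' : ℕ → Prop} (h : ∀ t < N, q t ↔ q' t) : cnt N q = cnt N q' := by
  classical
  unfold cnt
  congr 1
  exact Finset.filter_congr fun t ht => h t (Finset.mem_range.1 ht)

lemma cnt_mono {N : ℕ} {q q' : ℕ → Prop} (h : ∀ t < N, q t → q' t) : cnt N q ≤ cnt N q' := by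
  classical
  refine Finset.card_le_card fun t ht => ?_
  rw [Finset.mem_filter, Finset.mem_range] at ht ⊢
  exact ⟨ht.1, h t ht.1 ht.2⟩

lemma cnt_eq_card_filter {N : ℕ} {q : ℕ → Prop} [DecidablePred q] :
    cnt N q = ((Finset.range N).filter q).card := by
  unfold cnt; congr!

lemma cnt_or_le (N : ℕ) (q q' : ℕ → Prop) :
    cnt N (fun t => q t ∨ q' t) ≤ cnt N q + cnt N q' := by
  classical
  rw [cnt_eq_card_filter, cnt_eq_card_filter, cnt_eq_card_filter, Finset.filter_or]
  exact Finset.card_union_le _ _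

/-- With p = r_ijk and q = r_ik r_jk / r_k, symmetry of the perspective turns q g(p/q) into p
g(q/p). The factor p = N_ijk/N then spreads an edge over its samples. -/
theorem hashEstimator_eq_sampleEstimator (N : ℕ) (u v s : ℕ → ℕ) (w : ℕ → ℕ → ℕ → ℝ) :
    hashEstimator N u v s w = sampleEstimator N u v s (fun t => w (u t) (v t) (s t)) := by
  classical
  rcases Nat.eq_zero_or_pos N with rfl | hN
  · simp [hashEstimator, sampleEstimator, edges]
  have hN' : (0:ℝ) < N := by exact_mod_cast hN
  have key : ∀ e ∈ edges N u v s, w e.1 e.2.1 e.2.2 *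
      (ratio2 N u s e.1 e.2.2 * ratio2 N v s e.2.1 e.2.2 / ratio1 N s e.2.2) *
      gFun (ratio3 N u v s e.1 e.2.1 e.2.2 * ratio1 N s e.2.2 /
        (ratio2 N u s e.1 e.2.2 * ratio2 N v s e.2.1 e.2.2)) =
      ({t ∈ Finset.range N | (u t, v t, s t) = e}.card : ℝ) * (w e.1 e.2.1 e.2.2 *
      gFun ((cnt N (fun r => u r = e.1 ∧ s r = e.2.2) : ℝ) *
        cnt N (fun r => v r = e.2.1 ∧ s r = e.2.2) /
      (cnt N (fun r => s r = e.2.2) *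
        cnt N (fun r => u r = e.1 ∧ v r = e.2.1 ∧ s r = e.2.2)))) / N := by
    intro e he
    obtain ⟨t, ht, rfl⟩ := Finset.mem_image.1 he
    have htN := Finset.mem_range.1 ht
    have e3 : ({r ∈ Finset.range N | (u r, v r, s r) = (u t, v t, s t)}.card) =
        cnt N (fun r => u r = u t ∧ v r = v t ∧ s r = s t) := by
      unfold cnt; congr 1; ext r; simp
    rw [e3]
    have h3 : (0:ℝ) < cnt N (fun r => u r = u t ∧ v r = v t ∧ s r = s t) := by
      exact Nat.cast_pos.2 (cnt_pos htN ⟨rfl, rfl, rfl⟩)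
    have hu : (0:ℝ) < cnt N (fun r => u r = u t ∧ s r = s t) := by
      exact Nat.cast_pos.2 (cnt_pos htN ⟨rfl, rfl⟩)
    have hv : (0:ℝ) < cnt N (fun r => v r = v t ∧ s r = s t) := by
      exact Nat.cast_pos.2 (cnt_pos htN ⟨rfl, rfl⟩)
    have hs : (0:ℝ) < cnt N (fun r => s r = s t) := 
      Nat.cast_pos.2 (cnt_pos htN rfl)
    have r3 : ratio3 N u v s (u t) (v t) (s t) =
      cnt N (fun r => u r = u t ∧ v r = v t ∧ s r = s t) / N := by
      unfold ratio3 edgeSamples cnt; congr!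
    have ru : ratio2 N u s (u t) (s t) = cnt N (fun r => u r = u t ∧ s r = s t) / N := by
      unfold ratio2 cnt; congr!
    have rv : ratio2 N v s (v t) (s t) = cnt N (fun r => v r = v t ∧ s r = s t) / N := by
      unfold ratio2 cnt; congr!
    have rs : ratio1 N s (s t) = cnt N (fun r => s r = s t) / N := by
      unfold ratio1 cnt; congr!
    simp only
    rw [r3, ru, rv, rs]
    generalize (cnt N (fun r => u r = u t ∧ v r = v t ∧ s r = s t) : ℝ) = n3 at *
    generalize (cnt N (fun r => u r = u t ∧ s r = s t) : ℝ) = nu at *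
    generalize (cnt N (fun r => v r = v t ∧ s r = s t) : ℝ) = nv at *
    generalize (cnt N (fun r => s r = s t) : ℝ) = ns at *
    have hp : 0 < n3 / N := by positivity
    have hq : 0 < nu * nv / ns / N := by positivity
    have g1 := mul_gFun_div (q := nu * nv / ns / N) hp
    have g2 := mul_gFun_div (q := n3 / N) hq
    have a1 : nu * nv / ns / N / (n3 / N) = nu * nv / (ns * n3) := by field_simp
    have a2 : n3 / N / (nu * nv / ns / N) = n3 / N * (ns / N) / (nu / N * (nv / N)) := by field_simp
    have a3 : nu / N * (nv / N) / (ns / N) = nu * nv / ns / N := by field_simp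
    rw [a1] at g1
    rw [a2, gPersp_comm, ← g1] at g2
    rw [a3, mul_assoc, g2]
    ring
  rw [hashEstimator, Finset.sum_congr rfl key, sampleEstimator, ← Finset.sum_div]
  congr 1
  have := Finset.sum_comp (s := Finset.range N) (fun e : ℕ × ℕ × ℕ => w e.1 e.2.1 e.2.2 *
      gFun ((cnt N (fun r => u r = e.1 ∧ s r = e.2.2) : ℝ) *
        cnt N (fun r => v r = e.2.1 ∧ s r = e.2.2) /
      (cnt N (fun r => s r = e.2.2) *
        cnt N (fun r => u r = e.1 ∧ v r = e.2.1 ∧ s r = e.2.2)))) (fun t => (u t, v t, s t))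
  simp only [nsmul_eq_mul] at this
  simp only [depRatio]
  rw [this]
  rfl

open Classical in
/-- The sum of `depRatio` over a set of samples that is a union of classes of samples with equal
labels `u` and `s` is at most the size of the set. -/
lemma sum_depRatio_le {N : ℕ} {u : ℕ → A} {v : ℕ → B} {s : ℕ → D} {q : ℕ → Prop}
    (hq : ∀ t < N, ∀ r < N, u t = u r → s t = s r → q t → q r) :
    ∑ t ∈ Finset.range N with q t, depRatio N u v s t ≤ cnt N q := by
  set n3 : ℕ → ℝ := fun t => (cnt N (fun r => u r = u t ∧ v r = v t ∧ s r = s t) : ℝ) with hn3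
  set ns : ℕ → ℝ := fun t => (cnt N (fun r => s r = s t) : ℝ) with hns
  -- Both counts in the numerator are expanded over pairs of samples (r₁, r₂) sharing the required
  -- labels with t.
  set X : ℕ → ℕ → ℕ → ℝ := fun t r₁ r₂ => (if u r₁ = u t ∧ s r₁ = s t then 1 else 0) *
    (if v r₂ = v t ∧ s r₂ = s t then 1 else 0) / (ns t * n3 t) with hX
  have e : ∀ t, depRatio N u v s t = ∑ r₁ ∈ Finset.range N, ∑ r₂ ∈ Finset.range N, X t r₁ r₂ := by
    intro t
    simp only [hX]
    simp_rw [← Finset.sum_div, ← Finset.mul_sum, ← Finset.sum_mul]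
    rw [depRatio, cnt_cast N (fun r => u r = u t ∧ s r = s t),
      cnt_cast N (fun r => v r = v t ∧ s r = s t)]
    congr!
  -- For a fixed pair only t with labels (u r₁, v r₂, s r₁) contribute. There are c of them, each
  -- giving 1/(ns r₁ · c), so their sum is at most 1/ns r₁. The invariance of q passes it from t to
  -- r₁.
  have hb : ∀ r₁ ∈ Finset.range N, ∀ r₂ ∈ Finset.range N,
      ∑ t ∈ Finset.range N with q t, X t r₁ r₂ ≤
        (if q r₁ then 1 / ns r₁ else 0) * (if s r₂ = s r₁ then 1 else 0) := by
    intro r₁ h₁ r₂ h₂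
    rw [Finset.mem_range] at h₁ h₂
    by_cases hc : q r₁ ∧ s r₂ = s r₁
    · rw [if_pos hc.1, if_pos hc.2, mul_one]
      set c := cnt N (fun r => u r = u r₁ ∧ v r = v r₂ ∧ s r = s r₁) with hcdef
      have hXle : ∀ t ∈ Finset.range N, X t r₁ r₂ =
          (if u t = u r₁ ∧ v t = v r₂ ∧ s t = s r₁ then 1 else 0) * (1 / (ns r₁ * c)) := by
        intro t _
        simp only [hX]
        by_cases ht : u t = u r₁ ∧ v t = v r₂ ∧ s t = s r₁
        · rw [if_pos ht, if_pos ⟨ht.1.symm, ht.2.2.symm⟩,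
            if_pos ⟨ht.2.1.symm, hc.2.trans ht.2.2.symm⟩]
          simp only [hns, hn3, ht.1, ht.2.1, ht.2.2, ← hcdef]
          ring
        · rw [if_neg ht, zero_mul]
          by_cases h1 : u r₁ = u t ∧ s r₁ = s t
          · rw [if_neg (c := v r₂ = v t ∧ s r₂ = s t)]
            · simp
            · exact fun h => ht ⟨h1.1.symm, h.1.symm, h1.2.symm⟩
          · rw [if_neg h1]; simp
      calc ∑ t ∈ Finset.range N with q t, X t r₁ r₂ ≤ ∑ t ∈ Finset.range N, X t r₁ r₂ := by
            refine Finset.sum_le_sum_of_subset_of_nonneg (Finset.filter_subset _ _) fun t _ _ => ?_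
            simp only [hX, hns, hn3]
            positivity
        _ = c * (1 / (ns r₁ * c)) := by
            rw [Finset.sum_congr rfl hXle, ← Finset.sum_mul]
            congr 1
            rw [hcdef, cnt_cast]
            congr!
        _ ≤ 1 / ns r₁ := by
            have : (0:ℝ) < ns r₁ := by
              exact Nat.cast_pos.2 (cnt_pos h₁ rfl)
            rcases (Nat.cast_nonneg (α := ℝ) c).eq_or_lt with h0 | h0
            · rw [← h0]; simp; exact this.le
            · field_simp; exact le_rfl
    · rw [Finset.sum_eq_zero]
      · split_ifs <;> simp [hns]
      · intro t ht
        obtain ⟨ht, hqt⟩ := Finset.mem_filter.1 ht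
        rw [Finset.mem_range] at ht
        simp only [hX]
        by_cases h1 : u r₁ = u t ∧ s r₁ = s t
        · by_cases h2 : v r₂ = v t ∧ s r₂ = s t
          · exact absurd ⟨hq t ht r₁ h₁ h1.1.symm h1.2.symm hqt, h2.2.trans h1.2.symm⟩ hc
          · rw [if_neg h2]; simp
        · rw [if_neg h1]; simp
  calc ∑ t ∈ Finset.range N with q t, depRatio N u v s t
      = ∑ r₁ ∈ Finset.range N, ∑ r₂ ∈ Finset.range N, ∑ t ∈ Finset.range N with q t,
          X t r₁ r₂ := by
        simp_rw [e]
        rw [Finset.sum_comm]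
        exact Finset.sum_congr rfl fun _ _ => Finset.sum_comm
    _ ≤ ∑ r₁ ∈ Finset.range N, ∑ r₂ ∈ Finset.range N,
        (if q r₁ then 1 / ns r₁ else 0) * (if s r₂ = s r₁ then 1 else 0) :=
        Finset.sum_le_sum fun r₁ h₁ => Finset.sum_le_sum fun r₂ h₂ => hb r₁ h₁ r₂ h₂
    -- For each r₁ there are exactly ns r₁ choices of r₂.
    _ = ∑ r₁ ∈ Finset.range N, if q r₁ then 1 else 0 := by
        refine Finset.sum_congr rfl fun r₁ h₁ => ?_
        rw [← Finset.mul_sum, ← cnt_cast]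
        split_ifs
        · have : (0:ℝ) < ns r₁ := by
            exact Nat.cast_pos.2 (cnt_pos (Finset.mem_range.1 h₁) rfl)
          exact one_div_mul_cancel this.ne'
        · simp
    _ = cnt N q := (cnt_cast N q).symm

lemma depRatio_comm (N : ℕ) (u : ℕ → A) (v : ℕ → B) (s : ℕ → D) (t : ℕ) :
    depRatio N u v s t = depRatio N v u s t := by
  unfold depRatio
  rw [mul_comm (cnt N (fun r => u r = u t ∧ s r = s t) : ℝ), cnt_congr (N := N)
    (q := fun r => u r = u t ∧ v r = v t ∧ s r = s t)
    (q' := fun r => v r = v t ∧ u r = u t ∧ s r = s t) (fun _ _ => by tauto)]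

/-- The `t`-th sample is merged with a sample of a different cell. -/
def Merged {C : Type*} (N : ℕ) (x : ℕ → C) (u : ℕ → A) (t : ℕ) : Prop :=
  ∃ r < N, x r ≠ x t ∧ u r = u t

/-- Being merged depends only on the label: a label class with two different cells makes all of its
samples merged. Hence merged samples form unions of classes. -/
lemma Merged.of_label {C : Type*} {N : ℕ} {x : ℕ → C} {u : ℕ → A} {t r : ℕ} (ht : t < N)
    (h : Merged N x u t) (hu : u t = u r) : Merged N x u r := by
  obtain ⟨i, hi, hne, hui⟩ := h
  by_cases hx : x t = x r
  · exact ⟨i, hi, hx ▸ hne, hui.trans hu⟩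
  · exact ⟨t, ht, hx, hu⟩

lemma label_eq_iff_of_not_merged {C : Type*} {N : ℕ} {x : ℕ → C} {u : ℕ → A}
    (hu : ∀ t r, x t = x r → u t = u r) {t r : ℕ} (h : ¬ Merged N x u t) (hr : r < N) :
    u r = u t ↔ x r = x t :=
  ⟨fun hut => by_contra fun hne => h ⟨r, hr, hne, hut⟩, hu r t⟩

variable {A' B' D' : Type*}

-- Each condition is invariant under one label, so each is a union of classes for (u, s) or for (v,
-- s); symmetry of the ratio in u and v covers the latter.
open Classical in
lemma sum_depRatio_merged_le {N : ℕ} {u : ℕ → A} {v : ℕ → B} {s : ℕ → D} {qu qv qs : ℕ → Prop}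
    (hu : ∀ t < N, ∀ r < N, u t = u r → qu t → qu r)
    (hv : ∀ t < N, ∀ r < N, v t = v r → qv t → qv r)
    (hs : ∀ t < N, ∀ r < N, s t = s r → qs t → qs r) :
    ∑ t ∈ Finset.range N with (qu t ∨ qv t ∨ qs t), depRatio N u v s t ≤
      cnt N qu + cnt N qv + cnt N qs := by
  have h1 := sum_depRatio_le (v := v) (q := qu) fun t ht r hr h (_ : s t = s r) => hu t ht r hr h
  have h2 := sum_depRatio_le (v := u) (q := qv) fun t ht r hr h (_ : s t = s r) => hv t ht r hr h
  have h3 := sum_depRatio_le (v := v) (q := qs) fun t ht r hr (_ : u t = u r) h => hs t ht r hr h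
  simp_rw [depRatio_comm N v u s] at h2
  refine le_trans ?_ (add_le_add (add_le_add h1 h2) h3)
  rw [Finset.filter_or, Finset.filter_or, add_assoc]
  have hsub : ∀ S T : Finset ℕ, ∑ t ∈ S ∪ T, depRatio N u v s t ≤
      ∑ t ∈ S, depRatio N u v s t + ∑ t ∈ T, depRatio N u v s t := by
    intro S T
    rw [← Finset.sum_union_inter]
    exact le_add_of_nonneg_right (Finset.sum_nonneg fun t _ => depRatio_nonneg N u v s t)
  exact (hsub _ _).trans (add_le_add le_rfl (hsub _ _))

/-- Passing from cells to labels changes the estimator by at most a multiple of the fraction of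
merged samples. -/
theorem abs_sampleEstimator_sub_le {N : ℕ} {x : ℕ → A'} {y : ℕ → B'} {z : ℕ → D'} {u : ℕ → A}
    {v : ℕ → B} {s : ℕ → D} (hu : ∀ t r, x t = x r → u t = u r) (hv : ∀ t r, y t = y r → v t = v r)
    (hs : ∀ t r, z t = z r → s t = s r) {a a' : ℕ → ℝ} {M : ℝ} (ha0 : ∀ t < N, 0 ≤ a t)
    (haM : ∀ t < N, a t ≤ M) (ha0' : ∀ t < N, 0 ≤ a' t) (haM' : ∀ t < N, a' t ≤ M)
    (haa : ∀ t < N, ¬ Merged N x u t → ¬ Merged N y v t → ¬ Merged N z s t → a t = a' t) :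
    |sampleEstimator N u v s a - sampleEstimator N x y z a'| ≤
      2 * M * ((cnt N (Merged N x u) : ℝ) / N + (cnt N (Merged N y v) : ℝ) / N +
        (cnt N (Merged N z s) : ℝ) / N) := by
  classical
  rcases Nat.eq_zero_or_pos N with rfl | hN
  · simp [sampleEstimator]
  have hM : 0 ≤ M := (ha0 0 hN).trans (haM 0 hN)
  have hN' : (0:ℝ) < N := by exact_mod_cast hN
  set bad : ℕ → Prop := fun t => Merged N x u t ∨ Merged N y v t ∨ Merged N z s t with hbad
  set K : ℝ := cnt N (Merged N x u) + cnt N (Merged N y v) + cnt N (Merged N z s) with hK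
  have h1 : ∑ t ∈ Finset.range N with bad t, depRatio N u v s t ≤ K :=
    sum_depRatio_merged_le (fun t ht r _ h hm => hm.of_label ht h)
      (fun t ht r _ h hm => hm.of_label ht h) (fun t ht r _ h hm => hm.of_label ht h)
  have h2 : ∑ t ∈ Finset.range N with bad t, depRatio N x y z t ≤ K :=
    sum_depRatio_merged_le (fun t ht r _ h hm => hm.of_label ht (hu _ _ h))
      (fun t ht r _ h hm => hm.of_label ht (hv _ _ h))
      (fun t ht r _ h hm => hm.of_label ht (hs _ _ h))
  have h3 : (((Finset.range N).filter bad).card : ℝ) ≤ K := by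
    have e : ((Finset.range N).filter bad).card = cnt N bad := by unfold cnt; congr!
    rw [e, hK, add_assoc]
    exact_mod_cast (cnt_or_le N (Merged N x u) _).trans
      (add_le_add le_rfl (cnt_or_le N (Merged N y v) (Merged N z s)))
  -- An unmerged sample has the same counts under cells and labels, so its contribution cancels.
  have hgood : ∀ t ∈ Finset.range N, ¬ bad t → a t * gFun (depRatio N u v s t) -
      a' t * gFun (depRatio N x y z t) = 0 := by
    intro t ht hb
    rw [Finset.mem_range] at ht
    simp only [hbad, not_or] at hb
    have e : depRatio N u v s t = depRatio N x y z t := by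
      have iu := fun r (hr : r < N) => label_eq_iff_of_not_merged hu hb.1 hr
      have iv := fun r (hr : r < N) => label_eq_iff_of_not_merged hv hb.2.1 hr
      have is := fun r (hr : r < N) => label_eq_iff_of_not_merged hs hb.2.2 hr
      unfold depRatio
      rw [cnt_congr (fun r hr => and_congr (iu r hr) (is r hr)),
        cnt_congr (fun r hr => and_congr (iv r hr) (is r hr)), cnt_congr is,
        cnt_congr (fun r hr => and_congr (iu r hr) (and_congr (iv r hr) (is r hr)))]
    rw [e, haa t ht hb.1 hb.2.1 hb.2.2, sub_self]
  -- The ratios are not bounded individually; the linear growth of g reduces their effect to the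
  -- summed ratios over merged samples.
  have hterm : ∀ t ∈ Finset.range N, |a t * gFun (depRatio N u v s t) -
      a' t * gFun (depRatio N x y z t)| ≤
        M * ((1 + depRatio N u v s t) / 2 + (1 + depRatio N x y z t) / 2) := by
    intro t ht
    rw [Finset.mem_range] at ht
    have p1 := depRatio_nonneg N u v s t
    have p2 := depRatio_nonneg N x y z t
    have g1 := gFun_nonneg p1
    have g2 := gFun_nonneg p2
    have k1 : a t * gFun (depRatio N u v s t) ≤ M * ((1 + depRatio N u v s t) / 2) :=
      mul_le_mul (haM t ht) (gFun_le p1) g1 hM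
    have k2 : a' t * gFun (depRatio N x y z t) ≤ M * ((1 + depRatio N x y z t) / 2) :=
      mul_le_mul (haM' t ht) (gFun_le p2) g2 hM
    have k3 := mul_nonneg (ha0 t ht) g1
    have k4 := mul_nonneg (ha0' t ht) g2
    rw [mul_add, abs_le]
    constructor <;> linarith
  have hsum : ∑ t ∈ Finset.range N, |a t * gFun (depRatio N u v s t) -
      a' t * gFun (depRatio N x y z t)| ≤ 2 * M * K := by
    calc ∑ t ∈ Finset.range N, |a t * gFun (depRatio N u v s t) -
          a' t * gFun (depRatio N x y z t)|
        = ∑ t ∈ Finset.range N with bad t, |a t * gFun (depRatio N u v s t) -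
          a' t * gFun (depRatio N x y z t)| := by
          rw [Finset.sum_filter_of_ne]
          intro t ht hne
          by_contra hb
          exact hne (by rw [hgood t ht hb, abs_zero])
      _ ≤ ∑ t ∈ Finset.range N with bad t,
            M * ((1 + depRatio N u v s t) / 2 + (1 + depRatio N x y z t) / 2) :=
          Finset.sum_le_sum fun t ht => hterm t (Finset.mem_filter.1 ht).1
      _ = M * (((Finset.range N).filter bad).card +
            (∑ t ∈ Finset.range N with bad t, depRatio N u v s t) / 2 +
            (∑ t ∈ Finset.range N with bad t, depRatio N x y z t) / 2) := by
          rw [← Finset.mul_sum, Finset.sum_add_distrib, ← Finset.sum_div, ← Finset.sum_div,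
            Finset.sum_add_distrib, Finset.sum_add_distrib]
          simp only [Finset.sum_const, nsmul_eq_mul, mul_one]
          ring
      _ ≤ M * (K + K / 2 + K / 2) := by gcongr
      _ = 2 * M * K := by ring
  unfold sampleEstimator
  rw [← sub_div, ← Finset.sum_sub_distrib, abs_div, abs_of_pos hN', div_le_iff₀ hN']
  refine (Finset.abs_sum_le_sum_abs _ _).trans (hsum.trans (le_of_eq ?_))
  rw [hK]
  field_simp

end SampleEstimator

/-! ### Histogram mass and the estimator before hashing. -/

section HistMass

/-- The histogram mass of a union of cells is the fraction of samples in it. -/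
lemma setLIntegral_enorm_hist_one {N : ℕ} {E C : Type*} [MeasurableSpace E] [MeasurableSpace C]
    [MeasurableSingletonClass C] {κ : E → C} {m : Measure E} {v : ℝ} {s : ℕ → E}
    (hκ : Measurable κ) (hv : 0 < v) (hm : ∀ c, m {p | κ p = c} = ENNReal.ofReal v) {U : Set E}
    (mU : MeasurableSet U) (hU : ∀ p q, κ p = κ q → (p ∈ U ↔ q ∈ U)) :
    ∫⁻ p in U, ‖hist κ v N s 1 p‖ₑ ∂m = ENNReal.ofReal ((cnt N (fun t => s t ∈ U) : ℝ) / N) := by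
  classical
  set R : E → ℝ := U.indicator 1 with hRdef
  have hR : ∀ p q, κ p = κ q → R p = R q := by
    intro p q hpq
    have := hU p q hpq
    by_cases hp : p ∈ U
    · simp [hRdef, hp, this.1 hp]
    · have hq : q ∉ U := fun h => hp (this.2 h)
      simp [hRdef, hp, hq]
  have hR0 : ∀ p, 0 ≤ R p := fun p => Set.indicator_nonneg (fun _ _ => zero_le_one) p
  have e : ∀ p, U.indicator (fun p => ‖hist κ v N s 1 p‖ₑ) p =
      ENNReal.ofReal (hist κ v N s (fun t => R (s t)) p) := by
    intro p
    have := hist_mul (v := v) (N := N) (s := s) (a := 1) hR p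
    simp only [Pi.one_apply, one_mul] at this
    rw [← this]
    by_cases hp : p ∈ U
    · have := hist_nonneg (κ := κ) (N := N) (s := s) (a := 1) hv.le (fun _ => zero_le_one) p
      rw [Set.indicator_of_mem hp, Real.enorm_eq_ofReal this]
      simp [hRdef, hp]
    · simp [hp, hRdef]
  rw [← lintegral_indicator mU]
  simp_rw [e]
  rw [← ofReal_integral_eq_lintegral_ofReal (integrable_hist hκ hm)
    (Eventually.of_forall fun p => hist_nonneg hv.le (fun t => hR0 _) p), integral_hist hκ hv hm,
    cnt_cast]
  congr 2

end HistMass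

section CellEstimator

/-- The cells that share their hash value with a different cell among `x 0, …, x (N - 1)`. -/
def mergedCells {A : Type*} (N : ℕ) (x : ℕ → A) (g : A → ℕ) : Set A :=
  {c | ∃ r < N, x r ≠ c ∧ g (x r) = g c}

variable {α β γ A B D : Type*}

/-- The points one of whose coordinates lies in a cell that shares its hash value with the cell of
the corresponding coordinate of a sample. -/
def mergedPoints (N : ℕ) (κ₁ : α → A) (κ₂ : β → B) (κ₃ : γ → D) (g₁ : A → ℕ) (g₂ : B → ℕ)
    (g₃ : D → ℕ) (s : ℕ → α × β × γ) : Set (α × β × γ) :=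
  {p | κ₁ p.1 ∈ mergedCells N (fun t => κ₁ (s t).1) g₁ ∨
    κ₂ p.2.1 ∈ mergedCells N (fun t => κ₂ (s t).2.1) g₂ ∨
    κ₃ p.2.2 ∈ mergedCells N (fun t => κ₃ (s t).2.2) g₃}

/-- The weight of a point: the weight of the labels of its cells if these contain a sample,
and `0` otherwise. -/
def cellWeight (N : ℕ) (κ₁ : α → A) (κ₂ : β → B) (κ₃ : γ → D) (g₁ : A → ℕ) (g₂ : B → ℕ)
    (g₃ : D → ℕ) (s : ℕ → α × β × γ) (W : ℕ → ℕ → ℕ → ℝ) (p : α × β × γ) : ℝ :=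
  {c | ∃ t < N, prodCell κ₁ κ₂ κ₃ (s t) = c}.indicator
    (fun c => W (g₁ c.1) (g₂ c.2.1) (g₃ c.2.2)) (prodCell κ₁ κ₂ κ₃ p)

variable {N : ℕ} {κ₁ : α → A} {κ₂ : β → B} {κ₃ : γ → D} {g₁ : A → ℕ} {g₂ : B → ℕ} {g₃ : D → ℕ}
  {s : ℕ → α × β × γ}

lemma cellWeight_of_sample {W : ℕ → ℕ → ℕ → ℝ} {p : α × β × γ} {t : ℕ} (ht : t < N)
    (h : prodCell κ₁ κ₂ κ₃ (s t) = prodCell κ₁ κ₂ κ₃ p) :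
    cellWeight N κ₁ κ₂ κ₃ g₁ g₂ g₃ s W p =
      W (g₁ (κ₁ (s t).1)) (g₂ (κ₂ (s t).2.1)) (g₃ (κ₃ (s t).2.2)) := by
  have : prodCell κ₁ κ₂ κ₃ p ∈ {c | ∃ t < N, prodCell κ₁ κ₂ κ₃ (s t) = c} := ⟨t, ht, h⟩
  rw [cellWeight, Set.indicator_of_mem this, ← h]
  rfl

lemma cellWeight_mem {W : ℕ → ℕ → ℕ → ℝ} {M : ℝ} (hM : 0 ≤ M)
    (hW : ∀ t < N, W (g₁ (κ₁ (s t).1)) (g₂ (κ₂ (s t).2.1)) (g₃ (κ₃ (s t).2.2)) ∈ Set.Icc 0 M)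
    (p : α × β × γ) : cellWeight N κ₁ κ₂ κ₃ g₁ g₂ g₃ s W p ∈ Set.Icc 0 M := by
  by_cases h : ∃ t < N, prodCell κ₁ κ₂ κ₃ (s t) = prodCell κ₁ κ₂ κ₃ p
  · obtain ⟨t, ht, h⟩ := h
    rw [cellWeight_of_sample ht h]
    exact hW t ht
  · have : prodCell κ₁ κ₂ κ₃ p ∉ {c | ∃ t < N, prodCell κ₁ κ₂ κ₃ (s t) = c} := h
    rw [cellWeight, Set.indicator_of_notMem this]
    exact ⟨le_rfl, hM⟩

lemma cellWeight_congr {W : ℕ → ℕ → ℕ → ℝ} {p q : α × β × γ}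
    (h : prodCell κ₁ κ₂ κ₃ p = prodCell κ₁ κ₂ κ₃ q) :
    cellWeight N κ₁ κ₂ κ₃ g₁ g₂ g₃ s W p = cellWeight N κ₁ κ₂ κ₃ g₁ g₂ g₃ s W q := by
  rw [cellWeight, cellWeight, h]

variable [MeasurableSpace α] [MeasurableSpace β] [MeasurableSpace γ]

lemma measure_prodCell {μ : Measure α} {ν : Measure β} {ξ : Measure γ} [SigmaFinite μ]
    [SigmaFinite ν] [SigmaFinite ξ] {v₁ v₂ v₃ : ℝ} (hv1 : 0 < v₁) (hv2 : 0 < v₂)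
    (hm1 : ∀ c, μ {x | κ₁ x = c} = ENNReal.ofReal v₁)
    (hm2 : ∀ c, ν {x | κ₂ x = c} = ENNReal.ofReal v₂)
    (hm3 : ∀ c, ξ {x | κ₃ x = c} = ENNReal.ofReal v₃) (c : A × B × D) :
    (μ.prod (ν.prod ξ)) {p | prodCell κ₁ κ₂ κ₃ p = c} = ENNReal.ofReal (v₁ * (v₂ * v₃)) := by
  have e : {p | prodCell κ₁ κ₂ κ₃ p = c} =
      {x | κ₁ x = c.1} ×ˢ ({y | κ₂ y = c.2.1} ×ˢ {z | κ₃ z = c.2.2}) := by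
    ext p
    simp [prodCell, Prod.ext_iff]
  rw [e, Measure.prod_prod, Measure.prod_prod, hm1, hm2, hm3, ENNReal.ofReal_mul hv1.le,
    ENNReal.ofReal_mul hv2.le]

variable [MeasurableSpace A] [MeasurableSpace B] [MeasurableSpace D]

lemma measurable_prodCell (h1 : Measurable κ₁) (h2 : Measurable κ₂) (h3 : Measurable κ₃) :
    Measurable (prodCell κ₁ κ₂ κ₃) := by
  unfold prodCell; fun_prop

variable [Countable A] [MeasurableSingletonClass A] [Countable B] [MeasurableSingletonClass B]
  [Countable D] [MeasurableSingletonClass D]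

lemma measurableSet_mergedPoints (h1 : Measurable κ₁) (h2 : Measurable κ₂) (h3 : Measurable κ₃) :
    MeasurableSet (mergedPoints N κ₁ κ₂ κ₃ g₁ g₂ g₃ s) := by
  have e : mergedPoints N κ₁ κ₂ κ₃ g₁ g₂ g₃ s = prodCell κ₁ κ₂ κ₃ ⁻¹'
      {c | c.1 ∈ mergedCells N (fun t => κ₁ (s t).1) g₁ ∨
        c.2.1 ∈ mergedCells N (fun t => κ₂ (s t).2.1) g₂ ∨
        c.2.2 ∈ mergedCells N (fun t => κ₃ (s t).2.2) g₃} := rfl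
  rw [e]
  exact measurable_prodCell h1 h2 h3 MeasurableSet.of_discrete

lemma measurable_cellWeight (h1 : Measurable κ₁) (h2 : Measurable κ₂) (h3 : Measurable κ₃)
    (W : ℕ → ℕ → ℕ → ℝ) : Measurable (cellWeight N κ₁ κ₂ κ₃ g₁ g₂ g₃ s W) :=
  (Measurable.of_discrete (f := {c | ∃ t < N, prodCell κ₁ κ₂ κ₃ (s t) = c}.indicator
    (fun c => W (g₁ c.1) (g₂ c.2.1) (g₃ c.2.2)))).comp (measurable_prodCell h1 h2 h3)

variable {μ : Measure α} {ν : Measure β} {ξ : Measure γ} [SigmaFinite μ] [SigmaFinite ν]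
  [SigmaFinite ξ] {v₁ v₂ v₃ : ℝ}

omit [Countable A] [Countable B] [Countable D] in
/-- The estimator computed from the cells is a functional of the histogram. -/
lemma integral_hist_mul_gFun (h1 : Measurable κ₁) (h2 : Measurable κ₂) (h3 : Measurable κ₃)
    (hv1 : 0 < v₁) (hv2 : 0 < v₂) (hv3 : 0 < v₃)
    (hm1 : ∀ c, μ {x | κ₁ x = c} = ENNReal.ofReal v₁)
    (hm2 : ∀ c, ν {x | κ₂ x = c} = ENNReal.ofReal v₂)
    (hm3 : ∀ c, ξ {x | κ₃ x = c} = ENNReal.ofReal v₃) (hN : 0 < N) {w : α × β × γ → ℝ}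
    (hw : ∀ p q, prodCell κ₁ κ₂ κ₃ p = prodCell κ₁ κ₂ κ₃ q → w p = w q) :
    ∫ p, hist (prodCell κ₁ κ₂ κ₃) (v₁ * (v₂ * v₃)) N s 1 p *
      (w p * gFun (condIndepDensity μ ν (hist (prodCell κ₁ κ₂ κ₃) (v₁ * (v₂ * v₃)) N s 1) p /
        hist (prodCell κ₁ κ₂ κ₃) (v₁ * (v₂ * v₃)) N s 1 p)) ∂(μ.prod (ν.prod ξ)) =
    sampleEstimator N (fun t => κ₁ (s t).1) (fun t => κ₂ (s t).2.1) (fun t => κ₃ (s t).2.2)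
      (fun t => w (s t)) := by
  simp_rw [condIndepDensity_hist_div h1 h2 hv1 hv2 hv3 hm1 hm2 hN]
  rw [sampleEstimator]
  have hR : ∀ p q, prodCell κ₁ κ₂ κ₃ p = prodCell κ₁ κ₂ κ₃ q →
      w p * gFun ((cnt N (fun t => κ₁ (s t).1 = κ₁ p.1 ∧ κ₃ (s t).2.2 = κ₃ p.2.2) : ℝ) *
        cnt N (fun t => κ₂ (s t).2.1 = κ₂ p.2.1 ∧ κ₃ (s t).2.2 = κ₃ p.2.2) /
        (cnt N (fun t => κ₃ (s t).2.2 = κ₃ p.2.2) *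
          cnt N (fun t => κ₁ (s t).1 = κ₁ p.1 ∧ κ₂ (s t).2.1 = κ₂ p.2.1 ∧
            κ₃ (s t).2.2 = κ₃ p.2.2))) =
      w q * gFun ((cnt N (fun t => κ₁ (s t).1 = κ₁ q.1 ∧ κ₃ (s t).2.2 = κ₃ q.2.2) : ℝ) *
        cnt N (fun t => κ₂ (s t).2.1 = κ₂ q.2.1 ∧ κ₃ (s t).2.2 = κ₃ q.2.2) /
        (cnt N (fun t => κ₃ (s t).2.2 = κ₃ q.2.2) *
          cnt N (fun t => κ₁ (s t).1 = κ₁ q.1 ∧ κ₂ (s t).2.1 = κ₂ q.2.1 ∧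
            κ₃ (s t).2.2 = κ₃ q.2.2))) := by
    intro p q hpq
    rw [hw p q hpq]
    simp only [prodCell, Prod.mk.injEq] at hpq
    rw [hpq.1, hpq.2.1, hpq.2.2]
  -- The factor is constant on cells, so it becomes a weight on the samples, and integrating the
  -- histogram leaves their mean.
  simp_rw [hist_mul hR]
  rw [integral_hist (measurable_prodCell h1 h2 h3) (by positivity)
    (measure_prodCell hv1 hv2 hm1 hm2 hm3)]
  congr 1
  refine Finset.sum_congr rfl fun t _ => ?_
  rw [Pi.one_apply, one_mul]
  rfl

/-- The histogram mass of the merged points is at most the sum of the fractions of samples that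
are merged in one of the coordinates. -/
lemma setLIntegral_mergedPoints_le (h1 : Measurable κ₁) (h2 : Measurable κ₂) (h3 : Measurable κ₃)
    {m : Measure (α × β × γ)} {v : ℝ} (hv : 0 < v)
    (hm : ∀ c, m {p | prodCell κ₁ κ₂ κ₃ p = c} = ENNReal.ofReal v) :
    ∫⁻ p in mergedPoints N κ₁ κ₂ κ₃ g₁ g₂ g₃ s, ‖hist (prodCell κ₁ κ₂ κ₃) v N s 1 p‖ₑ ∂m ≤
      ENNReal.ofReal (
        (cnt N (Merged N (fun t => κ₁ (s t).1) (fun t => g₁ (κ₁ (s t).1))) : ℝ) / N +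
        (cnt N (Merged N (fun t => κ₂ (s t).2.1) (fun t => g₂ (κ₂ (s t).2.1))) : ℝ) / N +
        (cnt N (Merged N (fun t => κ₃ (s t).2.2) (fun t => g₃ (κ₃ (s t).2.2))) : ℝ) / N) := by
  rw [setLIntegral_enorm_hist_one (measurable_prodCell h1 h2 h3) hv hm
    (measurableSet_mergedPoints h1 h2 h3)]
  · refine ENNReal.ofReal_le_ofReal ?_
    rw [← add_div, ← add_div]
    gcongr
    rw [add_assoc]
    exact_mod_cast (cnt_or_le N _ _).trans (add_le_add le_rfl (cnt_or_le N _ _))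
  · intro p q hpq
    simp only [prodCell, Prod.mk.injEq] at hpq
    simp only [mergedPoints, Set.mem_ofPred_eq, hpq.1, hpq.2.1, hpq.2.2]

end CellEstimator

/-! ### The limit for a fixed realization. -/

section DeterministicLimit

variable {α β γ A B D : Type*} [MeasurableSpace α] [MeasurableSpace β] [MeasurableSpace γ]
  [MeasurableSpace A] [Countable A] [MeasurableSingletonClass A]
  [MeasurableSpace B] [Countable B] [MeasurableSingletonClass B]
  [MeasurableSpace D] [Countable D] [MeasurableSingletonClass D]
  {μ : Measure α} {ν : Measure β} {ξ : Measure γ} [SigmaFinite μ] [SigmaFinite ν]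
  [SigmaFinite ξ] {κ₁ : ℕ → α → A} {κ₂ : ℕ → β → B} {κ₃ : ℕ → γ → D} {v₁ v₂ v₃ : ℕ → ℝ}
  {g₁ : ℕ → A → ℕ} {g₂ : ℕ → B → ℕ} {g₃ : ℕ → D → ℕ} {s : ℕ → α × β × γ}

/-- Convergence of the hash-based estimator for a fixed sequence of samples, partitions and hash
functions, from the convergence of the histograms and the rarity of collisions. -/
theorem tendsto_hashEstimator (h1 : ∀ N, Measurable (κ₁ N)) (h2 : ∀ N, Measurable (κ₂ N))
    (h3 : ∀ N, Measurable (κ₃ N)) (hv1 : ∀ N, 0 < v₁ N) (hv2 : ∀ N, 0 < v₂ N) (hv3 : ∀ N, 0 < v₃ N)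
    (hm1 : ∀ N c, μ {x | κ₁ N x = c} = ENNReal.ofReal (v₁ N))
    (hm2 : ∀ N c, ν {x | κ₂ N x = c} = ENNReal.ofReal (v₂ N))
    (hm3 : ∀ N c, ξ {x | κ₃ N x = c} = ENNReal.ofReal (v₃ N))
    {f φ : α × β × γ → ℝ} {M : ℝ} (mf : Measurable f)
    (hf0 : ∀ p, 0 ≤ f p) (hfi : Integrable f (μ.prod (ν.prod ξ)))
    (mφ : Measurable φ) (hφ0 : ∀ p, 0 ≤ φ p) (hφM : ∀ p, φ p ≤ M) (hM : 0 ≤ M)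
    (hac : ∀ᵐ p ∂(μ.prod (ν.prod ξ)), f p = 0 → condIndepDensity μ ν f p = 0)
    (hlim : Tendsto (fun N => ∫⁻ p, ‖hist (prodCell (κ₁ N) (κ₂ N) (κ₃ N))
      (v₁ N * (v₂ N * v₃ N)) N s 1 p - f p‖ₑ ∂(μ.prod (ν.prod ξ))) atTop (𝓝 0))
    (hc1 : Tendsto (fun N => (cnt N (Merged N (fun t => κ₁ N (s t).1)
      (fun t => g₁ N (κ₁ N (s t).1))) : ℝ) / N) atTop (𝓝 0))
    (hc2 : Tendsto (fun N => (cnt N (Merged N (fun t => κ₂ N (s t).2.1)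
      (fun t => g₂ N (κ₂ N (s t).2.1))) : ℝ) / N) atTop (𝓝 0))
    (hc3 : Tendsto (fun N => (cnt N (Merged N (fun t => κ₃ N (s t).2.2)
      (fun t => g₃ N (κ₃ N (s t).2.2))) : ℝ) / N) atTop (𝓝 0))
    {W : ℕ → ℕ → ℕ → ℕ → ℝ}
    (hW : ∀ N, ∀ t < N, W N (g₁ N (κ₁ N (s t).1)) (g₂ N (κ₂ N (s t).2.1))
      (g₃ N (κ₃ N (s t).2.2)) ∈ Set.Icc 0 M)
    (hwlim : Tendsto (fun N => ∫⁻ p in (mergedPoints N (κ₁ N) (κ₂ N) (κ₃ N) (g₁ N) (g₂ N) (g₃ N) s)ᶜ,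
      ‖(cellWeight N (κ₁ N) (κ₂ N) (κ₃ N) (g₁ N) (g₂ N) (g₃ N) s (W N) p - φ p) *
        hist (prodCell (κ₁ N) (κ₂ N) (κ₃ N)) (v₁ N * (v₂ N * v₃ N)) N s 1 p‖ₑ
          ∂(μ.prod (ν.prod ξ))) atTop (𝓝 0)) :
    Tendsto (fun N => hashEstimator N (fun t => g₁ N (κ₁ N (s t).1))
      (fun t => g₂ N (κ₂ N (s t).2.1)) (fun t => g₃ N (κ₃ N (s t).2.2)) (W N)) atTop
      (𝓝 (∫ p, φ p * gPersp (f p) (condIndepDensity μ ν f p) ∂(μ.prod (ν.prod ξ)))) := by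
  set fh : ℕ → α × β × γ → ℝ := fun N =>
    hist (prodCell (κ₁ N) (κ₂ N) (κ₃ N)) (v₁ N * (v₂ N * v₃ N)) N s 1 with hfh
  set w : ℕ → α × β × γ → ℝ := fun N =>
    cellWeight N (κ₁ N) (κ₂ N) (κ₃ N) (g₁ N) (g₂ N) (g₃ N) s (W N) with hw
  have hv : ∀ N, 0 < v₁ N * (v₂ N * v₃ N) := fun N => mul_pos (hv1 N) (mul_pos (hv2 N) (hv3 N))
  have hκ := fun N => measurable_prodCell (h1 N) (h2 N) (h3 N)
  have hm := fun N => measure_prodCell (hv1 N) (hv2 N) (hm1 N) (hm2 N) (hm3 N)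
  have hwM := fun N => cellWeight_mem hM (hW N)
  have hc : Tendsto (fun N =>
      (cnt N (Merged N (fun t => κ₁ N (s t).1) (fun t => g₁ N (κ₁ N (s t).1))) : ℝ) / N +
      (cnt N (Merged N (fun t => κ₂ N (s t).2.1) (fun t => g₂ N (κ₂ N (s t).2.1))) : ℝ) / N +
      (cnt N (Merged N (fun t => κ₃ N (s t).2.2) (fun t => g₃ N (κ₃ N (s t).2.2))) : ℝ) / N)
      atTop (𝓝 0) := by simpa using (hc1.add hc2).add hc3
  -- On merged points nothing is known about the weights beyond the bound M, but the histogram mass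
  -- there is at most the sum of the merged fractions.
  have hwlim' : Tendsto (fun N => ∫⁻ p, ‖(w N p - φ p) * fh N p‖ₑ ∂(μ.prod (ν.prod ξ))) atTop
      (𝓝 0) := by
    have hc' : Tendsto (fun N => ENNReal.ofReal M * ENNReal.ofReal (
        (cnt N (Merged N (fun t => κ₁ N (s t).1) (fun t => g₁ N (κ₁ N (s t).1))) : ℝ) / N +
        (cnt N (Merged N (fun t => κ₂ N (s t).2.1) (fun t => g₂ N (κ₂ N (s t).2.1))) : ℝ) / N +
        (cnt N (Merged N (fun t => κ₃ N (s t).2.2) (fun t => g₃ N (κ₃ N (s t).2.2))) : ℝ) / N))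
        atTop (𝓝 0) := by
      have := ENNReal.Tendsto.const_mul (a := ENNReal.ofReal M) (ENNReal.tendsto_ofReal hc)
        (Or.inr ENNReal.ofReal_ne_top)
      simpa using this
    have hs := hc'.add hwlim
    rw [add_zero] at hs
    refine tendsto_of_tendsto_of_tendsto_of_le_of_le tendsto_const_nhds hs (fun _ => zero_le)
      fun N => ?_
    rw [← lintegral_add_compl _ (measurableSet_mergedPoints (N := N) (g₁ := g₁ N) (g₂ := g₂ N)
      (g₃ := g₃ N) (s := s) (h1 N) (h2 N) (h3 N))]
    refine add_le_add ?_ le_rfl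
    refine le_trans ?_ (mul_le_mul' le_rfl
      (setLIntegral_mergedPoints_le (h1 N) (h2 N) (h3 N) (hv N) (hm N)))
    rw [← lintegral_const_mul' _ _ ENNReal.ofReal_ne_top]
    refine lintegral_mono fun p => ?_
    simp only
    rw [enorm_mul]
    gcongr
    rw [← ofReal_norm]
    refine ENNReal.ofReal_le_ofReal ?_
    have a1 := hwM N p
    rw [Real.norm_eq_abs, abs_le]
    constructor <;> linarith [a1.1, a1.2, hφ0 p, hφM p]
  have key := tendsto_integral_functional (w := w) mf hf0 hfi mφ hφ0 hφM
    (fun N => measurable_hist (hκ N)) (fun N => hist_nonneg (hv N).le fun _ => zero_le_one)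
    (fun N => integrable_hist (hκ N) (hm N))
    (fun N => measurable_cellWeight (h1 N) (h2 N) (h3 N) (W N))
    (fun N p => (hwM N p).1) (fun N p => (hwM N p).2) hlim hwlim' hac
  -- The integral is the estimator computed from cells, with the same weights at sample points; only
  -- the merging of cells separates it from the hash estimator.
  have hdiff : Tendsto (fun N => hashEstimator N (fun t => g₁ N (κ₁ N (s t).1))
      (fun t => g₂ N (κ₂ N (s t).2.1)) (fun t => g₃ N (κ₃ N (s t).2.2)) (W N) -
      ∫ p, fh N p * (w N p * gFun (condIndepDensity μ ν (fh N) p / fh N p)) ∂(μ.prod (ν.prod ξ)))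
      atTop (𝓝 0) := by
    have hc' := hc.const_mul (2 * M)
    rw [mul_zero] at hc'
    refine squeeze_zero_norm' ?_ hc'
    filter_upwards [eventually_gt_atTop 0] with N hN
    rw [hfh, hw, integral_hist_mul_gFun (h1 N) (h2 N) (h3 N) (hv1 N) (hv2 N) (hv3 N) (hm1 N)
      (hm2 N) (hm3 N) hN (fun p q hpq => cellWeight_congr hpq), hashEstimator_eq_sampleEstimator,
      Real.norm_eq_abs]
    refine abs_sampleEstimator_sub_le (fun t r h => by rw [h]) (fun t r h => by rw [h])
      (fun t r h => by rw [h]) (fun t ht => (hW N t ht).1) (fun t ht => (hW N t ht).2)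
      (fun t _ => (hwM N _).1) (fun t _ => (hwM N _).2) fun t ht _ _ _ => ?_
    rw [cellWeight_of_sample ht rfl]
  have hsum := hdiff.add key
  rw [zero_add] at hsum
  exact hsum.congr fun N => sub_add_cancel _ _

end DeterministicLimit

/-! ### The two kinds of edge weights away from merged cells. -/

section Weights

variable {α β γ A B D : Type*} {N : ℕ} {κ₁ : α → A} {κ₂ : β → B} {κ₃ : γ → D} {g₁ : A → ℕ}
  {g₂ : B → ℕ} {g₃ : D → ℕ} {s : ℕ → α × β × γ}

lemma hash_eq_iff_of_notMem_mergedCells {x : ℕ → A} {c : A} (hc : c ∉ mergedCells N x g₁) {r : ℕ}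
    (hr : r < N) : g₁ (x r) = g₁ c ↔ x r = c :=
  ⟨fun h => by_contra fun hne => hc ⟨r, hr, hne, h⟩, fun h => by rw [h]⟩

lemma hist_eq_zero_of_forall_ne {E C : Type*} {κ : E → C} {v : ℝ} {s : ℕ → E} {a : ℕ → ℝ} {p : E}
    (h : ∀ t < N, κ (s t) ≠ κ p) : hist κ v N s a p = 0 := by
  have : ∀ t ∈ Finset.range N, {q | κ q = κ (s t)}.indicator (fun _ => a t) p = 0 := fun t ht =>
    Set.indicator_of_notMem (s := {q | κ q = κ (s t)})
      (fun hp => h t (Finset.mem_range.1 ht) (Eq.symm hp)) _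
  rw [hist, Finset.sum_eq_zero this, mul_zero]

lemma meanWeight_mem {u v s : ℕ → ℕ} {a : ℕ → ℝ} {M : ℝ} (ha : ∀ t, a t ∈ Set.Icc 0 M)
    (hM : 0 ≤ M) (i j k : ℕ) : meanWeight N u v s a i j k ∈ Set.Icc 0 M := by
  unfold meanWeight
  refine ⟨div_nonneg (Finset.sum_nonneg fun t _ => (ha t).1) (Nat.cast_nonneg _), ?_⟩
  refine div_le_of_le_mul₀ (Nat.cast_nonneg _) hM ?_
  calc ∑ t ∈ edgeSamples N u v s i j k, a t ≤ ∑ _t ∈ edgeSamples N u v s i j k, M :=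
        Finset.sum_le_sum fun t _ => (ha t).2
    _ = M * (edgeSamples N u v s i j k).card := by simp [mul_comm]

/-- Away from merged points, the mean weights are quotients of histograms. -/
lemma cellWeight_meanWeight_mul_hist {v : ℝ} {a : ℕ → ℝ} {p : α × β × γ} {t : ℕ} (ht : t < N)
    (htp : prodCell κ₁ κ₂ κ₃ (s t) = prodCell κ₁ κ₂ κ₃ p)
    (hp : p ∉ mergedPoints N κ₁ κ₂ κ₃ g₁ g₂ g₃ s) :
    cellWeight N κ₁ κ₂ κ₃ g₁ g₂ g₃ s (meanWeight N (fun t => g₁ (κ₁ (s t).1))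
      (fun t => g₂ (κ₂ (s t).2.1)) (fun t => g₃ (κ₃ (s t).2.2)) a) p *
      hist (prodCell κ₁ κ₂ κ₃) v N s 1 p = hist (prodCell κ₁ κ₂ κ₃) v N s a p := by
  classical
  have hp1 : κ₁ p.1 ∉ mergedCells N (fun t => κ₁ (s t).1) g₁ := fun h => hp (Or.inl h)
  have hp2 : κ₂ p.2.1 ∉ mergedCells N (fun t => κ₂ (s t).2.1) g₂ :=
    fun h => hp (Or.inr (Or.inl h))
  have hp3 : κ₃ p.2.2 ∉ mergedCells N (fun t => κ₃ (s t).2.2) g₃ :=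
    fun h => hp (Or.inr (Or.inr h))
  have hc := htp
  simp only [prodCell, Prod.mk.injEq] at hc
  -- At an unmerged point the edge collects exactly the samples in the cell of p.
  have hT : edgeSamples N (fun t => g₁ (κ₁ (s t).1)) (fun t => g₂ (κ₂ (s t).2.1))
      (fun t => g₃ (κ₃ (s t).2.2)) (g₁ (κ₁ (s t).1)) (g₂ (κ₂ (s t).2.1)) (g₃ (κ₃ (s t).2.2)) =
      {r ∈ Finset.range N | prodCell κ₁ κ₂ κ₃ (s r) = prodCell κ₁ κ₂ κ₃ p} := by
    unfold edgeSamples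
    refine Finset.filter_congr fun r hr => ?_
    rw [Finset.mem_range] at hr
    rw [hc.1, hc.2.1, hc.2.2, hash_eq_iff_of_notMem_mergedCells (x := fun t => κ₁ (s t).1) hp1 hr,
      hash_eq_iff_of_notMem_mergedCells (x := fun t => κ₂ (s t).2.1) hp2 hr,
      hash_eq_iff_of_notMem_mergedCells (x := fun t => κ₃ (s t).2.2) hp3 hr]
    simp [prodCell]
  rw [cellWeight_of_sample ht htp, meanWeight, hT]
  have hpos : (0:ℝ) < ({r ∈ Finset.range N |
      prodCell κ₁ κ₂ κ₃ (s r) = prodCell κ₁ κ₂ κ₃ p}).card :=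
    Nat.cast_pos.2 (Finset.card_pos.2 ⟨t, Finset.mem_filter.2 ⟨Finset.mem_range.2 ht, htp⟩⟩)
  have e : ∀ a : ℕ → ℝ, hist (prodCell κ₁ κ₂ κ₃) v N s a p = (N * v)⁻¹ *
      ∑ r ∈ Finset.range N with prodCell κ₁ κ₂ κ₃ (s r) = prodCell κ₁ κ₂ κ₃ p, a r := by
    intro a
    rw [hist, Finset.sum_filter]
    congr 1
    refine Finset.sum_congr rfl fun r _ => ?_
    by_cases h : prodCell κ₁ κ₂ κ₃ (s r) = prodCell κ₁ κ₂ κ₃ p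
    · rw [if_pos h, Set.indicator_of_mem]
      exact h.symm
    · rw [if_neg h, Set.indicator_of_notMem]
      exact fun h' => h (Eq.symm h')
  rw [e, e]
  simp only [Pi.one_apply, Finset.sum_const, nsmul_eq_mul, mul_one]
  field_simp

/-- The mean weight times the histogram is the φ-weighted histogram H, so the error is (H - φ f) - φ
(f̂ - f), where f̂ is the unweighted histogram. At points of cells without samples f̂ = 0, so the
error vanishes. -/
lemma enorm_meanWeight_sub_mul_hist_le {v M : ℝ} {φ f : α × β × γ → ℝ}
    (hφ0 : ∀ p, 0 ≤ φ p) (hφM : ∀ p, φ p ≤ M) {p : α × β × γ}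
    (hp : p ∉ mergedPoints N κ₁ κ₂ κ₃ g₁ g₂ g₃ s) :
    ‖(cellWeight N κ₁ κ₂ κ₃ g₁ g₂ g₃ s (meanWeight N (fun t => g₁ (κ₁ (s t).1))
      (fun t => g₂ (κ₂ (s t).2.1)) (fun t => g₃ (κ₃ (s t).2.2)) (fun t => φ (s t))) p - φ p) *
      hist (prodCell κ₁ κ₂ κ₃) v N s 1 p‖ₑ ≤
    ‖hist (prodCell κ₁ κ₂ κ₃) v N s (fun t => φ (s t)) p - φ p * f p‖ₑ +
      ENNReal.ofReal M * ‖hist (prodCell κ₁ κ₂ κ₃) v N s 1 p - f p‖ₑ := by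
  by_cases h : ∃ t < N, prodCell κ₁ κ₂ κ₃ (s t) = prodCell κ₁ κ₂ κ₃ p
  · obtain ⟨t, ht, htp⟩ := h
    rw [sub_mul, cellWeight_meanWeight_mul_hist ht htp hp]
    have e : hist (prodCell κ₁ κ₂ κ₃) v N s (fun t => φ (s t)) p -
        φ p * hist (prodCell κ₁ κ₂ κ₃) v N s 1 p =
        (hist (prodCell κ₁ κ₂ κ₃) v N s (fun t => φ (s t)) p - φ p * f p) -
          φ p * (hist (prodCell κ₁ κ₂ κ₃) v N s 1 p - f p) := by ring
    rw [e]
    refine (enorm_sub_le).trans ?_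
    rw [enorm_mul, Real.enorm_eq_ofReal (hφ0 p)]
    gcongr
    exact hφM p
  · push Not at h
    rw [hist_eq_zero_of_forall_ne h, mul_zero, enorm_zero]
    exact zero_le

/-- In each coordinate q lies in an occupied cell, possibly occupied by different samples, with the
label of p. Absence of collisions at p forces these cells to be the cells of p. -/
lemma exists_eq_of_cellWeight {W : ℕ → ℕ → ℕ → ℝ} {φ : α × β × γ → ℝ}
    (hW : ∀ t < N, ∃ q : α × β × γ,
      W (g₁ (κ₁ (s t).1)) (g₂ (κ₂ (s t).2.1)) (g₃ (κ₃ (s t).2.2)) = φ q ∧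
      ((∃ r < N, κ₁ q.1 = κ₁ (s r).1) ∧ g₁ (κ₁ q.1) = g₁ (κ₁ (s t).1)) ∧
      ((∃ r < N, κ₂ q.2.1 = κ₂ (s r).2.1) ∧ g₂ (κ₂ q.2.1) = g₂ (κ₂ (s t).2.1)) ∧
      ((∃ r < N, κ₃ q.2.2 = κ₃ (s r).2.2) ∧ g₃ (κ₃ q.2.2) = g₃ (κ₃ (s t).2.2)))
    {p : α × β × γ} {t : ℕ} (ht : t < N)
    (htp : prodCell κ₁ κ₂ κ₃ (s t) = prodCell κ₁ κ₂ κ₃ p)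
    (hp : p ∉ mergedPoints N κ₁ κ₂ κ₃ g₁ g₂ g₃ s) :
    ∃ q, prodCell κ₁ κ₂ κ₃ q = prodCell κ₁ κ₂ κ₃ p ∧
      cellWeight N κ₁ κ₂ κ₃ g₁ g₂ g₃ s W p = φ q := by
  obtain ⟨q, hq, ⟨⟨r₁, hr₁, e₁⟩, l₁⟩, ⟨⟨r₂, hr₂, e₂⟩, l₂⟩, ⟨⟨r₃, hr₃, e₃⟩, l₃⟩⟩ := hW t ht
  have hc := htp
  simp only [prodCell, Prod.mk.injEq] at hc
  refine ⟨q, ?_, (cellWeight_of_sample ht htp).trans hq⟩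
  simp only [prodCell, Prod.mk.injEq]
  rw [e₁, hc.1] at l₁
  rw [e₂, hc.2.1] at l₂
  rw [e₃, hc.2.2] at l₃
  exact ⟨e₁.trans ((hash_eq_iff_of_notMem_mergedCells (x := fun t => κ₁ (s t).1)
      (fun h => hp (Or.inl h)) hr₁).1 l₁),
    e₂.trans ((hash_eq_iff_of_notMem_mergedCells (x := fun t => κ₂ (s t).2.1)
      (fun h => hp (Or.inr (Or.inl h))) hr₂).1 l₂),
    e₃.trans ((hash_eq_iff_of_notMem_mergedCells (x := fun t => κ₃ (s t).2.2)
      (fun h => hp (Or.inr (Or.inr h))) hr₃).1 l₃)⟩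

end Weights

/-! ### Weights that are values of an a.e. continuous function. -/

section Oscillation

/-- An almost everywhere continuous function has small oscillation at a small scale outside a set
of small measure. -/
lemma exists_oscillation_le {E : Type*} [PseudoMetricSpace E] [MeasurableSpace E] [BorelSpace E]
    {P : Measure E} [IsFiniteMeasure P] {φ : E → ℝ} (hφ : ∀ᵐ p ∂P, ContinuousAt φ p) {η : ℝ}
    (hη : 0 < η) {θ : ℝ≥0∞} (hθ : θ ≠ 0) :
    ∃ r > 0, ∃ U, MeasurableSet U ∧ P U ≤ θ ∧ ∀ p ∉ U, ∀ q, dist q p < r → |φ q - φ p| ≤ η := by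
  -- Quantifying over two nearby points makes U n open, hence measurable for any φ. These sets
  -- decrease and no continuity point belongs to all of them.
  set U : ℕ → Set E := fun n =>
    {p | ∃ q q', dist q p < 1 / (n + 1 : ℝ) ∧ dist q' p < 1 / (n + 1 : ℝ) ∧ η < |φ q - φ q'|}
    with hU
  have oU : ∀ n, IsOpen (U n) := by
    intro n
    have : U n = ⋃ (q) (q') (_ : η < |φ q - φ q'|),
        Metric.ball q (1 / (n + 1 : ℝ)) ∩ Metric.ball q' (1 / (n + 1 : ℝ)) := by
      ext p
      simp only [hU, Set.mem_ofPred_eq, Set.mem_iUnion, Set.mem_inter_iff, Metric.mem_ball,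
        dist_comm p, exists_prop]
      exact exists_congr fun q => exists_congr fun q' => by tauto
    rw [this]
    exact isOpen_iUnion fun q => isOpen_iUnion fun q' => isOpen_iUnion fun _ =>
      Metric.isOpen_ball.inter Metric.isOpen_ball
  have anti : Antitone U := by
    intro m n hmn p hp
    obtain ⟨q, q', h1, h2, h3⟩ := hp
    have := Nat.one_div_le_one_div (α := ℝ) hmn
    exact ⟨q, q', h1.trans_le this, h2.trans_le this, h3⟩
  have hnull : P (⋂ n, U n) = 0 := by
    refine measure_mono_null (fun p hp => ?_) hφ
    intro (hc : ContinuousAt φ p)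
    rw [Metric.continuousAt_iff] at hc
    obtain ⟨δ, hδ, h⟩ := hc (η / 2) (half_pos hη)
    obtain ⟨n, hn⟩ := exists_nat_one_div_lt hδ
    obtain ⟨q, q', h1, h2, h3⟩ := Set.mem_iInter.1 hp n
    have a1 := h (h1.trans hn)
    have a2 := h (h2.trans hn)
    rw [Real.dist_eq, abs_lt] at a1 a2
    rw [lt_abs] at h3
    rcases h3 with h3 | h3 <;> linarith [a1.1, a1.2, a2.1, a2.2]
  have hlim := tendsto_measure_iInter_atTop (μ := P)
    (fun n => (oU n).measurableSet.nullMeasurableSet) anti ⟨0, measure_ne_top _ _⟩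
  rw [hnull] at hlim
  obtain ⟨n, hn⟩ := (ENNReal.tendsto_nhds_zero.1 hlim θ (pos_iff_ne_zero.2 hθ)).exists
  refine ⟨1 / (n + 1), Nat.one_div_pos_of_nat, U n, (oU n).measurableSet, hn, fun p hp q hq => ?_⟩
  by_contra hlt
  exact hp ⟨q, p, hq, by rw [dist_self]; exact Nat.one_div_pos_of_nat, not_le.1 hlt⟩

/-- Transfers smallness of probability to smallness of histogram mass, at the price of the L¹
distance. -/
lemma setLIntegral_enorm_le {E : Type*} [MeasurableSpace E] {m P : Measure E} {f : E → ℝ≥0}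
    (hP : P = m.withDensity (fun p => (f p : ℝ≥0∞))) {fh : E → ℝ} (mfh : Measurable fh)
    (hf : Measurable f) {U : Set E} (hU : MeasurableSet U) :
    ∫⁻ p in U, ‖fh p‖ₑ ∂m ≤ ∫⁻ p, ‖fh p - f p‖ₑ ∂m + P U := by
  rw [hP, withDensity_apply _ hU]
  have mm : Measurable fun p => ‖fh p - f p‖ₑ := by fun_prop
  calc ∫⁻ p in U, ‖fh p‖ₑ ∂m ≤ ∫⁻ p in U, (‖fh p - f p‖ₑ + f p) ∂m := by
        refine lintegral_mono fun p => ?_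
        calc ‖fh p‖ₑ = ‖(fh p - f p) + f p‖ₑ := by rw [sub_add_cancel]
          _ ≤ ‖fh p - f p‖ₑ + ‖(f p : ℝ)‖ₑ := enorm_add_le _ _
          _ = _ := by simp
    _ = ∫⁻ p in U, ‖fh p - f p‖ₑ ∂m + ∫⁻ p in U, f p ∂m := lintegral_add_left mm _
    _ ≤ _ := add_le_add (setLIntegral_le_lintegral _ _) le_rfl

/-- If densities `fh N` converge in `L¹` to the density `f` of `P`, then weights that lie, outside
sets `V N`, among the values of `φ` at distance tending to `0`, converge to `φ`. -/
lemma tendsto_lintegral_sub_mul_of_values {E : Type*} [PseudoMetricSpace E] [MeasurableSpace E]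
    [BorelSpace E] {m P : Measure E} [IsProbabilityMeasure P] {f : E → ℝ≥0} (hf : Measurable f)
    (hP : P = m.withDensity (fun p => (f p : ℝ≥0∞))) {φ : E → ℝ}
    (hφ : ∀ᵐ p ∂P, ContinuousAt φ p) (hφ0 : ∀ p, 0 ≤ φ p) {M : ℝ} (hφM : ∀ p, φ p ≤ M)
    {fh w : ℕ → E → ℝ} (mfh : ∀ N, Measurable (fh N)) (hw : ∀ N p, w N p ∈ Set.Icc 0 M)
    (hlim : Tendsto (fun N => ∫⁻ p, ‖fh N p - f p‖ₑ ∂m) atTop (𝓝 0))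
    {δ : ℕ → ℝ} (hδ : Tendsto δ atTop (𝓝 0)) {V : ℕ → Set E}
    (hval : ∀ N, ∀ p ∉ V N, fh N p ≠ 0 → ∃ q, dist q p ≤ δ N ∧ w N p = φ q)
    (hV : ∀ N, MeasurableSet (V N)) :
    Tendsto (fun N => ∫⁻ p in (V N)ᶜ, ‖(w N p - φ p) * fh N p‖ₑ ∂m) atTop (𝓝 0) := by
  have hM : 0 ≤ M := by
    have : Nonempty E := nonempty_of_isProbabilityMeasure P
    exact (hφ0 (Classical.arbitrary E)).trans (hφM _)
  rw [ENNReal.tendsto_nhds_zero]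
  intro e he
  obtain ⟨e', he'0, he'⟩ := ENNReal.lt_iff_exists_nnreal_btwn.1 he
  have he'0 : (0:ℝ) < e' := by exact_mod_cast he'0
  -- The final bound is 2η + 2Mθ, and θ(M + 1) ≤ η makes it at most 4η = e'. The condition θ ≤ 1
  -- keeps the mass of fh at most 2.
  set η : ℝ := e' / 4 with hη
  have hη0 : 0 < η := by positivity
  set θ : ℝ := min 1 (η / (M + 1)) with hθ
  have hθ0 : 0 < θ := lt_min one_pos (by positivity)
  obtain ⟨r, hr, U, mU, hPU, hosc⟩ := exists_oscillation_le (P := P) hφ hη0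
    (θ := ENNReal.ofReal θ) (by simpa using hθ0)
  filter_upwards [hδ.eventually_lt_const hr,
    ENNReal.tendsto_nhds_zero.1 hlim (ENNReal.ofReal θ) (by simpa using hθ0)] with N hN1 hN2
  calc ∫⁻ p in (V N)ᶜ, ‖(w N p - φ p) * fh N p‖ₑ ∂m
      ≤ ∫⁻ p in (V N)ᶜ, (ENNReal.ofReal η * ‖fh N p‖ₑ +
          ENNReal.ofReal M * U.indicator (fun p => ‖fh N p‖ₑ) p) ∂m := by
        refine setLIntegral_mono' (hV N).compl fun p hp => ?_
        rcases eq_or_ne (fh N p) 0 with h0 | h0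
        · simp [h0]
        obtain ⟨q, hq, hwq⟩ := hval N p hp h0
        rw [enorm_mul]
        by_cases hpU : p ∈ U
        · rw [Set.indicator_of_mem hpU]
          refine le_add_of_nonneg_of_le zero_le ?_
          gcongr
          rw [← ofReal_norm]
          refine ENNReal.ofReal_le_ofReal ?_
          have := hw N p
          rw [Real.norm_eq_abs, abs_le]
          constructor <;> linarith [this.1, this.2, hφ0 p, hφM p]
        · refine le_add_of_le_of_nonneg ?_ zero_le
          gcongr
          rw [← ofReal_norm, hwq]
          exact ENNReal.ofReal_le_ofReal (hosc p hpU q (hq.trans_lt hN1))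
    _ ≤ ∫⁻ p, (ENNReal.ofReal η * ‖fh N p‖ₑ +
          ENNReal.ofReal M * U.indicator (fun p => ‖fh N p‖ₑ) p) ∂m :=
        setLIntegral_le_lintegral _ _
    _ = ENNReal.ofReal η * ∫⁻ p, ‖fh N p‖ₑ ∂m +
          ENNReal.ofReal M * ∫⁻ p in U, ‖fh N p‖ₑ ∂m := by
        rw [lintegral_add_left ((mfh N).enorm.const_mul _), lintegral_const_mul' _ _ (by simp),
          lintegral_const_mul' _ _ (by simp), lintegral_indicator mU]
    _ ≤ ENNReal.ofReal η * 2 + ENNReal.ofReal M * (ENNReal.ofReal θ + ENNReal.ofReal θ) := by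
        gcongr
        · have := setLIntegral_enorm_le hP (mfh N) hf MeasurableSet.univ
          rw [Measure.restrict_univ, measure_univ] at this
          refine this.trans ?_
          rw [← one_add_one_eq_two]
          gcongr
          refine hN2.trans ?_
          rw [← ENNReal.ofReal_one]
          exact ENNReal.ofReal_le_ofReal (min_le_left _ _)
        · exact (setLIntegral_enorm_le hP (mfh N) hf mU).trans (add_le_add hN2 hPU)
    _ = ENNReal.ofReal (η * 2 + M * (θ + θ)) := by
        rw [ENNReal.ofReal_add (by positivity) (by positivity), ENNReal.ofReal_mul hη0.le,
          ENNReal.ofReal_mul hM, ENNReal.ofReal_add hθ0.le hθ0.le]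
        simp
    _ ≤ e := by
        refine le_trans ?_ he'.le
        rw [← ENNReal.ofReal_coe_nnreal]
        refine ENNReal.ofReal_le_ofReal ?_
        have h1 : θ * (M + 1) ≤ η := by
          rw [← le_div_iff₀ (by positivity)]; exact min_le_right _ _
        rw [hη] at h1 ⊢
        nlinarith

end Oscillation

/-! ### From few collisions to few merged samples. -/

section MergedFraction

/-- The fraction of merged samples tends to zero if the number of collisions among the cells of a
finite set that contains all samples is of smaller order than the inverse volume of a cell. -/
theorem tendsto_cnt_merged_div {E F A C : Type*} [MeasurableSpace E] [MeasurableSpace F]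
    [MeasurableSpace A] [Countable A] [MeasurableSingletonClass A] [MeasurableSpace C] [Countable C]
    [MeasurableSingletonClass C] {m P : Measure E} [IsProbabilityMeasure P] {ρ : Measure F}
    [SigmaFinite ρ] {f : E → ℝ≥0} (hf : Measurable f)
    (hP : P = m.withDensity (fun p => (f p : ℝ≥0∞))) {κ : ℕ → E → C} {v : ℕ → ℝ}
    (hκ : ∀ N, Measurable (κ N)) (hv : ∀ N, 0 < v N)
    (hm : ∀ N c, m {p | κ N p = c} = ENNReal.ofReal (v N)) {s : ℕ → E}
    (hlim : Tendsto (fun N => ∫⁻ p, ‖hist (κ N) (v N) N s 1 p - f p‖ₑ ∂m) atTop (𝓝 0))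
    {π : E → F} (hπ : Measurable π) (hac : P.map π ≪ ρ) {κ' : ℕ → F → A} {v' : ℕ → ℝ}
    (hκ' : ∀ N, Measurable (κ' N)) (hm' : ∀ N c, ρ {x | κ' N x = c} = ENNReal.ofReal (v' N))
    (hv' : ∀ N, 0 ≤ v' N) (hκκ' : ∀ N p q, κ N p = κ N q → κ' N (π p) = κ' N (π q))
    {S : ℕ → Finset A} {g : ℕ → A → ℕ} (hS : ∀ N, ∀ t < N, κ' N (π (s t)) ∈ S N)
    (hK : Tendsto (fun N => collisions (S N) (g N) * v' N) atTop (𝓝 0)) :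
    Tendsto (fun N => (cnt N (Merged N (fun t => κ' N (π (s t)))
      (fun t => g N (κ' N (π (s t))))) : ℝ) / N) atTop (𝓝 0) := by
  classical
  set T : ℕ → Finset A := fun N => {c ∈ S N | ∃ c' ∈ S N, c' ≠ c ∧ g N c' = g N c} with hT
  have hTm : ∀ N, MeasurableSet {x | κ' N x ∈ T N} := fun N =>
    hκ' N (MeasurableSet.of_discrete (s := (T N : Set A)))
  have : IsProbabilityMeasure (P.map π) := Measure.isProbabilityMeasure_map hπ.aemeasurable
  -- At most twice as many cells collide as are lost, each of measure v' N.
  have hρ : Tendsto (fun N => ρ {x | κ' N x ∈ T N}) atTop (𝓝 0) := by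
    have h2 := ENNReal.tendsto_ofReal (hK.const_mul 2)
    rw [mul_zero, ENNReal.ofReal_zero] at h2
    refine tendsto_of_tendsto_of_tendsto_of_le_of_le tendsto_const_nhds h2 (fun _ => zero_le)
      fun N => ?_
    have e : {x | κ' N x ∈ T N} = ⋃ c ∈ T N, {x | κ' N x = c} := by
      ext x; simp
    calc ρ {x | κ' N x ∈ T N} ≤ ∑ c ∈ T N, ρ {x | κ' N x = c} := by
          rw [e]; exact measure_biUnion_finset_le _ _
      _ = ENNReal.ofReal ((T N).card * v' N) := by
          simp_rw [hm']
          rw [Finset.sum_const, nsmul_eq_mul, ENNReal.ofReal_mul (Nat.cast_nonneg _),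
            ENNReal.ofReal_natCast]
      _ ≤ ENNReal.ofReal (2 * (collisions (S N) (g N) * v' N)) := by
          refine ENNReal.ofReal_le_ofReal ?_
          rw [← mul_assoc]
          refine mul_le_mul_of_nonneg_right ?_ (hv' N)
          have := card_filter_collide_le (S N) (g N)
          calc ((T N).card : ℝ) ≤ ((2 * collisions (S N) (g N) : ℕ) : ℝ) := by
                refine Nat.cast_le.2 (le_trans (le_of_eq ?_) this)
                simp only [hT]
            _ = _ := by push_cast; rfl
  -- Absolute continuity of the integral of the marginal density over sets of vanishing measure.
  have hPT : Tendsto (fun N => P {p | κ' N (π p) ∈ T N}) atTop (𝓝 0) := by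
    have h1 : ∫⁻ x, (P.map π).rnDeriv ρ x ∂ρ ≠ ∞ := by
      rw [Measure.lintegral_rnDeriv hac]; exact measure_ne_top _ _
    refine (tendsto_setLIntegral_zero h1 (s := fun N => {x | κ' N x ∈ T N}) hρ).congr fun N => ?_
    rw [Measure.setLIntegral_rnDeriv hac, Measure.map_apply hπ (hTm N)]
    rfl
  have hsum := hlim.add hPT
  rw [add_zero] at hsum
  have hreal := (ENNReal.tendsto_toReal ENNReal.zero_ne_top).comp hsum
  rw [ENNReal.toReal_zero] at hreal
  have hfin : ∀ᶠ N in atTop, ∫⁻ p, ‖hist (κ N) (v N) N s 1 p - f p‖ₑ ∂m +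
      P {p | κ' N (π p) ∈ T N} ≠ ∞ :=
    (hsum.eventually_lt_const ENNReal.zero_lt_top).mono fun N h => h.ne
  refine squeeze_zero' (Eventually.of_forall fun N => by positivity) ?_ hreal
  filter_upwards [hfin] with N hN
  have hU : MeasurableSet {p | κ' N (π p) ∈ T N} := hπ (hTm N)
  -- These sets depend on the samples and hashes, so a law of large numbers for fixed sets does not
  -- apply; L¹ convergence is uniform over all sets.
  have h1 := setLIntegral_enorm_le hP (fh := hist (κ N) (v N) N s 1) (measurable_hist (hκ N)) hf hU
  rw [setLIntegral_enorm_hist_one (hκ N) (hv N) (hm N) hU] at h1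
  swap
  · intro p q hpq
    simp only [Set.mem_ofPred_eq]
    rw [hκκ' N p q hpq]
  have h2 := (ENNReal.ofReal_le_iff_le_toReal hN).1 h1
  refine le_trans ?_ h2
  gcongr
  refine cnt_mono fun t ht hmt => ?_
  obtain ⟨r, hr, hne, hg⟩ := hmt
  exact Finset.mem_filter.2 ⟨hS N t ht, _, hS N r hr, hne, hg⟩

end MergedFraction

/-! ### Cells of triples in Euclidean space. -/

section EuclideanCells

variable {dX dY dZ : ℕ}

lemma exists_norm_le_ae {d : ℕ} {E : Type*} [MeasurableSpace E] {P : Measure E} {π : E → Euc d}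
    (hπ : Measurable π) (h : Bornology.IsBounded (P.map π).support) :
    ∃ R : ℝ, ∀ᵐ p ∂P, ‖π p‖ ≤ R := by
  obtain ⟨R, hR⟩ := h.exists_norm_le
  refine ⟨R, ?_⟩
  have h1 : ∀ᵐ x ∂(P.map π), x ∈ (P.map π).support := Measure.support_mem_ae
  filter_upwards [ae_of_ae_map hπ.aemeasurable h1] with p hp
  exact hR _ hp

/-- The cell map on triples. -/
def cell3 (ε b : ℝ) : Euc dX × Euc dY × Euc dZ → (Fin dX → ℤ) × (Fin dY → ℤ) × (Fin dZ → ℤ) :=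
  prodCell (cellv ε b) (cellv ε b) (cellv ε b)

/-- The volume of a cell of triples. -/
def vol3 (dX dY dZ : ℕ) (ε : ℝ) : ℝ := ε ^ dX * (ε ^ dY * ε ^ dZ)

/-- A finite set of cells of triples that contains the cells of all triples of points of norm at
most `R`. -/
def cellBox3 (dX dY dZ : ℕ) (R ε : ℝ) : Finset ((Fin dX → ℤ) × (Fin dY → ℤ) × (Fin dZ → ℤ)) :=
  cellBox dX R ε ×ˢ (cellBox dY R ε ×ˢ cellBox dZ R ε)

lemma vol3_eq (ε : ℝ) : vol3 dX dY dZ ε = ε ^ (dX + dY + dZ) := by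
  rw [vol3]; ring

lemma vol3_pos {ε : ℝ} (hε : 0 < ε) : 0 < vol3 dX dY dZ ε := by unfold vol3; positivity

lemma measurable_cell3 (ε b : ℝ) :
    Measurable (cell3 ε b : Euc dX × Euc dY × Euc dZ → _) :=
  measurable_prodCell (measurable_cellv ε b) (measurable_cellv ε b) (measurable_cellv ε b)

lemma measurable_uncurry_cell3 (ε : ℝ) :
    Measurable (Function.uncurry (cell3 ε : ℝ → Euc dX × Euc dY × Euc dZ → _)) := by
  have h : ∀ d, Measurable (fun q : ℝ × Euc d => cellv ε q.1 q.2) :=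
    fun d => measurable_cellv_prod ε
  have e1 : Measurable (fun q : ℝ × Euc dX × Euc dY × Euc dZ => cellv ε q.1 q.2.1) :=
    (h dX).comp (measurable_fst.prodMk (measurable_fst.comp measurable_snd))
  have e2 : Measurable (fun q : ℝ × Euc dX × Euc dY × Euc dZ => cellv ε q.1 q.2.2.1) :=
    (h dY).comp (measurable_fst.prodMk
      (measurable_fst.comp (measurable_snd.comp measurable_snd)))
  have e3 : Measurable (fun q : ℝ × Euc dX × Euc dY × Euc dZ => cellv ε q.1 q.2.2.2) :=
    (h dZ).comp (measurable_fst.prodMk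
      (measurable_snd.comp (measurable_snd.comp measurable_snd)))
  exact e1.prodMk (e2.prodMk e3)

lemma volume_cell3 {ε : ℝ} (hε : 0 < ε) (b : ℝ) (c : (Fin dX → ℤ) × (Fin dY → ℤ) × (Fin dZ → ℤ)) :
    volume {p | cell3 ε b p = c} = ENNReal.ofReal (vol3 dX dY dZ ε) :=
  measure_prodCell (pow_pos hε _) (pow_pos hε _) (volume_cellv hε b) (volume_cellv hε b)
    (volume_cellv hε b) c

lemma dist_le_of_cell3_eq {ε b : ℝ} (hε : 0 < ε) {p q : Euc dX × Euc dY × Euc dZ}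
    (h : cell3 ε b p = cell3 ε b q) : dist p q ≤ (√dX + √dY + √dZ) * ε := by
  simp only [cell3, prodCell, Prod.mk.injEq] at h
  have h1 := dist_le_of_cellv_eq hε h.1
  have h2 := dist_le_of_cellv_eq hε h.2.1
  have h3 := dist_le_of_cellv_eq hε h.2.2
  have p1 : 0 ≤ √dX * ε := by positivity
  have p2 : 0 ≤ √dY * ε := by positivity
  have p3 : 0 ≤ √dZ * ε := by positivity
  rw [Prod.dist_eq, Prod.dist_eq, add_mul, add_mul]
  refine max_le (by linarith) (max_le (by linarith) (by linarith))

lemma cell3_mem_cellBox3 {R ε b : ℝ} (hε : 0 < ε) (hb : b ∈ Set.Icc 0 ε)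
    {p : Euc dX × Euc dY × Euc dZ} (h1 : ‖p.1‖ ≤ R) (h2 : ‖p.2.1‖ ≤ R) (h3 : ‖p.2.2‖ ≤ R) :
    cell3 ε b p ∈ cellBox3 dX dY dZ R ε := by
  rw [cellBox3, Finset.mem_product, Finset.mem_product]
  exact ⟨cellv_mem_cellBox hε hb h1, cellv_mem_cellBox hε hb h2, cellv_mem_cellBox hε hb h3⟩

lemma card_cellBox3_mul_le {R ε : ℝ} (hR : 0 ≤ R) (hε : 0 < ε) (hε1 : ε ≤ 1) :
    ((cellBox3 dX dY dZ R ε).card : ℝ) * vol3 dX dY dZ ε ≤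
      (2 * R + 5) ^ dX * ((2 * R + 5) ^ dY * (2 * R + 5) ^ dZ) := by
  rw [cellBox3, Finset.card_product, Finset.card_product, vol3]
  push_cast
  calc _ = ((cellBox dX R ε).card * ε ^ dX) * (((cellBox dY R ε).card * ε ^ dY) *
        ((cellBox dZ R ε).card * ε ^ dZ)) := by ring
    _ ≤ _ := by
      have h1 := card_cellBox_mul_le (d := dX) hR hε hε1
      have h2 := card_cellBox_mul_le (d := dY) hR hε hε1
      have h3 := card_cellBox_mul_le (d := dZ) hR hε hε1
      gcongr

/-- The number of cells is at most a constant over ε^(dX + dY + dZ), which is o(N) by the rate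
condition; this is the budget of the union bound. -/
lemma tendsto_card_cellBox3_div {R : ℝ} (hR : 0 ≤ R) {ε : ℕ → ℝ} (hε : ∀ N, 0 < ε N)
    (hε0 : Tendsto ε atTop (𝓝 0))
    (hrate : Tendsto (fun N : ℕ => (N : ℝ) * ε N ^ (dX + dY + dZ)) atTop atTop) :
    Tendsto (fun N => ((cellBox3 dX dY dZ R (ε N)).card : ℝ) / N) atTop (𝓝 0) := by
  set A := (2 * R + 5) ^ dX * ((2 * R + 5) ^ dY * (2 * R + 5) ^ dZ) with hA
  have h1 : Tendsto (fun N : ℕ => A * ((N : ℝ) * ε N ^ (dX + dY + dZ))⁻¹) atTop (𝓝 0) := by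
    simpa using (tendsto_inv_atTop_zero.comp hrate).const_mul A
  refine squeeze_zero' (Eventually.of_forall fun N => by positivity) ?_ h1
  filter_upwards [hε0.eventually_le_const one_pos] with N hN
  have h2 := card_cellBox3_mul_le (dX := dX) (dY := dY) (dZ := dZ) hR (hε N) hN
  have h3 := vol3_pos (dX := dX) (dY := dY) (dZ := dZ) (hε N)
  rw [← vol3_eq, mul_inv, ← hA] at *
  calc ((cellBox3 dX dY dZ R (ε N)).card : ℝ) / N
      = ((cellBox3 dX dY dZ R (ε N)).card * vol3 dX dY dZ (ε N)) *
        ((N : ℝ)⁻¹ * (vol3 dX dY dZ (ε N))⁻¹) := by field_simp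
    _ ≤ _ := by gcongr

end EuclideanCells

/-! ### Almost sure consistency and rarity of collisions. -/

section AlmostSure

variable {Ω : Type*} [MeasurableSpace Ω] {μ : Measure Ω} [IsProbabilityMeasure μ] {dX dY dZ : ℕ}
  {P : Measure (Euc dX × Euc dY × Euc dZ)} [IsProbabilityMeasure P]

/-- Strong consistency in `L¹` of weighted histograms with randomly shifted cells. -/
theorem ae_tendsto_lintegral_hist_sub {f : Euc dX × Euc dY × Euc dZ → ℝ≥0} (hf : Measurable f)
    (hP : P = volume.withDensity (fun p => (f p : ℝ≥0∞)))
    {φ : Euc dX × Euc dY × Euc dZ → ℝ} (hφ : Measurable φ) {M : ℝ} (hφM : ∀ p, |φ p| ≤ M)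
    {s : ℕ → Ω → Euc dX × Euc dY × Euc dZ} (hlaw : ∀ t, HasLaw (s t) P μ) (hindep : iIndepFun s μ)
    {ε : ℕ → ℝ} (hε : ∀ N, 0 < ε N) (hε0 : Tendsto ε atTop (𝓝 0))
    (hrate : Tendsto (fun N : ℕ => (N : ℝ) * ε N ^ (dX + dY + dZ)) atTop atTop)
    {b : ℕ → Ω → ℝ} (hb : ∀ N, AEMeasurable (b N) μ)
    (hbind : ∀ N, 1 ≤ N → IndepFun (fun ω t => s t ω) (b N) μ) {R : ℝ} (hR : 0 ≤ R)
    (hbox : ∀ᵐ p ∂P, ‖p.1‖ ≤ R ∧ ‖p.2.1‖ ≤ R ∧ ‖p.2.2‖ ≤ R)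
    (hbad : ∀ᵐ ω ∂μ, ∀ N, b N ω ∈ Set.Icc 0 (ε N))
    (hsbox : ∀ᵐ ω ∂μ, ∀ t, ‖(s t ω).1‖ ≤ R ∧ ‖(s t ω).2.1‖ ≤ R ∧ ‖(s t ω).2.2‖ ≤ R) :
    ∀ᵐ ω ∂μ, Tendsto (fun N => ∫⁻ p, ‖hist (cell3 (ε N) (b N ω)) (vol3 dX dY dZ (ε N)) N
      (fun t => s t ω) (fun t => φ (s t ω)) p - φ p * f p‖ₑ) atTop (𝓝 0) := by
  have hfi : Integrable (fun p => (f p : ℝ)) := by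
    refine ⟨by fun_prop, ?_⟩
    have : P Set.univ < ∞ := measure_lt_top _ _
    rw [hP, withDensity_apply _ MeasurableSet.univ, Measure.restrict_univ] at this
    simpa [HasFiniteIntegral] using this
  have hF : Integrable (fun p => φ p * f p) :=
    hfi.bdd_mul hφ.aestronglyMeasurable (Eventually.of_forall fun p => by simpa using hφM p)
  have mF : Measurable (fun p => φ p * (f p : ℝ)) := by fun_prop
  have hdev := ae_tendsto_sum_abs_cellDev hlaw hindep hφ hφM hb hbind
    (κ := fun N => cell3 (ε N)) (fun N => measurable_uncurry_cell3 (ε N))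
    (tendsto_card_cellBox3_div hR hε hε0 hrate)
  filter_upwards [hdev, hbad, hsbox] with ω h1 h2 h3
  -- The bias bound is uniform over partitions of small diameter, so the random shift plays no role.
  have hbias : Tendsto (fun N => ∫⁻ p, ‖(vol3 dX dY dZ (ε N))⁻¹ *
      (∫ q in {q | cell3 (ε N) (b N ω) q = cell3 (ε N) (b N ω) p}, φ q * f q) - φ p * f p‖ₑ)
      atTop (𝓝 0) := by
    rw [ENNReal.tendsto_nhds_zero]
    intro η hη
    have : IsLocallyFiniteMeasure (volume : Measure (Euc dX × Euc dY × Euc dZ)) := inferInstance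
    obtain ⟨δ, hδ, hcell⟩ := exists_cellAverage_sub_le
      (C := (Fin dX → ℤ) × (Fin dY → ℤ) × (Fin dZ → ℤ)) mF hF hη.ne'
    have hd : Tendsto (fun N => (√dX + √dY + √dZ) * ε N) atTop (𝓝 0) := by
      simpa using hε0.const_mul (√dX + √dY + √dZ)
    filter_upwards [hd.eventually_le_const hδ] with N hN
    exact hcell _ _ (measurable_cell3 _ _) (vol3_pos (hε N)) (volume_cell3 (hε N) _)
      fun p q hpq => (dist_le_of_cell3_eq (hε N) hpq).trans hN
  have hsum := (ENNReal.tendsto_ofReal h1).add hbias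
  rw [ENNReal.ofReal_zero, add_zero] at hsum
  refine tendsto_of_tendsto_of_tendsto_of_le_of_le tendsto_const_nhds hsum (fun _ => zero_le)
    fun N => ?_
  refine lintegral_hist_sub_le (measurable_cell3 _ _) (vol3_pos (hε N)) (volume_cell3 (hε N) _)
    hf hP (fun t _ => cell3_mem_cellBox3 (hε N) (h2 N) (h3 t).1 (h3 t).2.1 (h3 t).2.2) ?_
  refine measure_mono_null (fun p hp => ?_) hbox
  intro h
  exact hp (cell3_mem_cellBox3 (hε N) (h2 N) h.1 h.2.1 h.2.2)

/-- The number of collisions among the cells of a box is almost surely of smaller order than the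
inverse volume of a cell. -/
theorem ae_tendsto_collisions_cellBox {h : ℕ → (Σ d : ℕ, Fin d → ℤ) → Ω → ℕ} {L : ℕ → ℕ}
    (hL : ∀ N, N ≤ L N) (hlaw : ∀ N, 1 ≤ N → ∀ c, HasLaw (h N c) (uniformOn (Set.Icc 1 (L N))) μ)
    (hind : ∀ N, 1 ≤ N → iIndepFun (h N) μ) {ε : ℕ → ℝ} (hε : ∀ N, 0 < ε N)
    (hε0 : Tendsto ε atTop (𝓝 0)) {D : ℕ}
    (hrate : Tendsto (fun N : ℕ => (N : ℝ) * ε N ^ D) atTop atTop) {d : ℕ} (hd : d ≤ D) {R : ℝ}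
    (hR : 0 ≤ R) :
    ∀ᵐ ω ∂μ, Tendsto (fun N => collisions (cellBox d R (ε N)) (fun c => h N ⟨d, c⟩ ω) * ε N ^ d)
      atTop (𝓝 0) := by
  -- In dimension 0 the cell volume is 1 and does not shrink, but there is only one cell and hence
  -- no collision.
  rcases Nat.eq_zero_or_pos d with rfl | hd0
  · refine Eventually.of_forall fun ω => ?_
    have : ∀ N, collisions (cellBox 0 R (ε N)) (fun c => h N ⟨0, c⟩ ω) = 0 := by
      intro N
      unfold collisions
      rw [Finset.card_image_of_injective _ (fun c c' _ => Subsingleton.elim c c'), Nat.sub_self]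
    simp [this]
  · refine ae_tendsto_collisions_mul (h := fun N c => h N ⟨d, c⟩) hL
      (fun N hN c => hlaw N hN _)
      (fun N hN => (hind N hN).precomp (g := fun c : Fin d → ℤ => (⟨d, c⟩ : Σ d : ℕ, Fin d → ℤ))
        (sigma_mk_injective (β := fun d : ℕ => Fin d → ℤ)))
      (fun N => pow_pos (hε N) d) ?_ (A := (2 * R + 5) ^ d) ?_ ?_
    · simpa [hd0.ne'] using hε0.pow d
    · filter_upwards [hε0.eventually_le_const one_pos] with N hN
      exact card_cellBox_mul_le hR (hε N) hN
    -- For ε ≤ 1 and d ≤ D one has ε^d ≥ ε^D, so the rate for triples implies the rate for each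
    -- coordinate.
    · refine tendsto_atTop_mono' _ ?_ hrate
      filter_upwards [hε0.eventually_le_const one_pos] with N hN
      exact mul_le_mul_of_nonneg_left (pow_le_pow_of_le_one (hε N).le hN hd) (Nat.cast_nonneg _)

end AlmostSure

/-! ### Assembling the limit for fixed samples, shifts and hash functions. -/

section EuclideanLimit

variable {dX dY dZ : ℕ} {P : Measure (Euc dX × Euc dY × Euc dZ)} [IsProbabilityMeasure P]
  {f : Euc dX × Euc dY × Euc dZ → ℝ≥0} {ε : ℕ → ℝ} {s : ℕ → Euc dX × Euc dY × Euc dZ} {b : ℕ → ℝ}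
  {h : ℕ → (Σ d : ℕ, Fin d → ℤ) → ℕ} {R : ℝ}

lemma tendsto_cnt_merged_cellv_div (hf : Measurable f)
    (hP : P = volume.withDensity (fun p => (f p : ℝ≥0∞))) (hε : ∀ N, 0 < ε N)
    (hlim : Tendsto (fun N => ∫⁻ p, ‖hist (cell3 (ε N) (b N)) (vol3 dX dY dZ (ε N)) N s 1 p -
      f p‖ₑ) atTop (𝓝 0)) (hb : ∀ N, b N ∈ Set.Icc 0 (ε N)) {d : ℕ}
    {π : Euc dX × Euc dY × Euc dZ → Euc d} (hπ : Measurable π) (hac : P.map π ≪ volume)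
    (hcell : ∀ N p q, cell3 (ε N) (b N) p = cell3 (ε N) (b N) q →
      cellv (ε N) (b N) (π p) = cellv (ε N) (b N) (π q)) (hbox : ∀ t, ‖π (s t)‖ ≤ R)
    (hK : Tendsto (fun N => collisions (cellBox d R (ε N)) (fun c => h N ⟨d, c⟩) * ε N ^ d) atTop
      (𝓝 0)) :
    Tendsto (fun N => (cnt N (Merged N (fun t => cellv (ε N) (b N) (π (s t)))
      (fun t => h N ⟨d, cellv (ε N) (b N) (π (s t))⟩)) : ℝ) / N) atTop (𝓝 0) :=
  tendsto_cnt_merged_div hf hP (fun _ => measurable_cell3 _ _) (fun N => vol3_pos (hε N))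
    (fun N => volume_cell3 (hε N) _) hlim hπ hac (κ' := fun N => cellv (ε N) (b N))
    (v' := fun N => ε N ^ d) (fun _ => measurable_cellv _ _) (fun N => volume_cellv (hε N) _)
    (fun N => (pow_pos (hε N) _).le) hcell (g := fun N c => h N ⟨d, c⟩)
    (fun N t _ => cellv_mem_cellBox (hε N) (hb N) (hbox t)) hK

/-- Convergence of the hash-based estimator for fixed samples, shifts and hash functions. -/
theorem tendsto_hashEstimator_cells (hf : Measurable f)
    (hP : P = volume.withDensity (fun p => (f p : ℝ≥0∞)))
    (hpos : ∀ᵐ p ∂(refMeasure P), 0 < condRatio P p)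
    {φ : Euc dX × Euc dY × Euc dZ → ℝ} (hφ : Measurable φ) (hφ0 : ∀ p, 0 ≤ φ p)
    {M : ℝ} (hφM : ∀ p, φ p ≤ M) (hε : ∀ N, 0 < ε N)
    (hlim : Tendsto (fun N => ∫⁻ p, ‖hist (cell3 (ε N) (b N)) (vol3 dX dY dZ (ε N)) N s 1 p -
      f p‖ₑ) atTop (𝓝 0)) (hb : ∀ N, b N ∈ Set.Icc 0 (ε N))
    (hbox : ∀ t, ‖(s t).1‖ ≤ R ∧ ‖(s t).2.1‖ ≤ R ∧ ‖(s t).2.2‖ ≤ R)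
    (hKX : Tendsto (fun N => collisions (cellBox dX R (ε N)) (fun c => h N ⟨dX, c⟩) * ε N ^ dX)
      atTop (𝓝 0))
    (hKY : Tendsto (fun N => collisions (cellBox dY R (ε N)) (fun c => h N ⟨dY, c⟩) * ε N ^ dY)
      atTop (𝓝 0))
    (hKZ : Tendsto (fun N => collisions (cellBox dZ R (ε N)) (fun c => h N ⟨dZ, c⟩) * ε N ^ dZ)
      atTop (𝓝 0)) {W : ℕ → ℕ → ℕ → ℕ → ℝ}
    (hW : ∀ N, ∀ t < N, W N (h N (cell (ε N) (b N) (s t).1)) (h N (cell (ε N) (b N) (s t).2.1))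
      (h N (cell (ε N) (b N) (s t).2.2)) ∈ Set.Icc 0 M)
    (hwlim : Tendsto (fun N => ∫⁻ p in (mergedPoints N (cellv (ε N) (b N)) (cellv (ε N) (b N))
        (cellv (ε N) (b N)) (fun c => h N ⟨dX, c⟩) (fun c => h N ⟨dY, c⟩) (fun c => h N ⟨dZ, c⟩) s)ᶜ,
        ‖(cellWeight N (cellv (ε N) (b N)) (cellv (ε N) (b N)) (cellv (ε N) (b N))
          (fun c => h N ⟨dX, c⟩) (fun c => h N ⟨dY, c⟩) (fun c => h N ⟨dZ, c⟩) s (W N) p - φ p) *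
          hist (cell3 (ε N) (b N)) (vol3 dX dY dZ (ε N)) N s 1 p‖ₑ) atTop (𝓝 0)) :
    Tendsto (fun N => hashEstimator N (label (ε N) (b N) (h N) (fun t => (s t).1))
      (label (ε N) (b N) (h N) (fun t => (s t).2.1))
      (label (ε N) (b N) (h N) (fun t => (s t).2.2)) (W N)) atTop (𝓝 (acmi P φ)) := by
  have hM : 0 ≤ M := (hφ0 0).trans (hφM 0)
  have mY : Measurable (fun p : Euc dX × Euc dY × Euc dZ => p.2.1) :=
    measurable_fst.comp measurable_snd
  have mZ : Measurable (fun p : Euc dX × Euc dY × Euc dZ => p.2.2) :=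
    measurable_snd.comp measurable_snd
  have hPac : P ≪ volume := hP ▸ withDensity_absolutelyContinuous _ _
  have acX : P.map (fun p => p.1) ≪ volume :=
    (hPac.map measurable_fst).trans Measure.quasiMeasurePreserving_fst.absolutelyContinuous
  have acY : P.map (fun p => p.2.1) ≪ volume :=
    (hPac.map mY).trans (Measure.quasiMeasurePreserving_fst.comp
      Measure.quasiMeasurePreserving_snd).absolutelyContinuous
  have acZ : P.map (fun p => p.2.2) ≪ volume :=
    (hPac.map mZ).trans (Measure.quasiMeasurePreserving_snd.comp
      Measure.quasiMeasurePreserving_snd).absolutelyContinuous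
  obtain ⟨hI, hpos'⟩ := acmi_eq_integral P f hf hP
  -- This is where positivity of ρ enters: the limit has no mass of Qf on {f = 0} that the dropped
  -- empty cells could miss.
  have hac : ∀ᵐ p, (f p : ℝ) = 0 → condIndepDensity volume volume (fun p => (f p : ℝ)) p = 0 := by
    filter_upwards [hpos' hpos] with p hp h0
    exact hp (by exact_mod_cast h0)
  have hfi : Integrable (fun p => (f p : ℝ)) := by
    refine ⟨by fun_prop, ?_⟩
    have : P Set.univ < ∞ := measure_lt_top _ _
    rw [hP, withDensity_apply _ MeasurableSet.univ, Measure.restrict_univ] at this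
    simpa [HasFiniteIntegral] using this
  rw [hI φ]
  have cX := tendsto_cnt_merged_cellv_div hf hP hε hlim hb measurable_fst acX
    (fun N p q hpq => (Prod.mk.inj hpq).1) (fun t => (hbox t).1) hKX
  have cY := tendsto_cnt_merged_cellv_div hf hP hε hlim hb mY acY
    (fun N p q hpq => (Prod.mk.inj (Prod.mk.inj hpq).2).1) (fun t => (hbox t).2.1) hKY
  have cZ := tendsto_cnt_merged_cellv_div hf hP hε hlim hb mZ acZ
    (fun N p q hpq => (Prod.mk.inj (Prod.mk.inj hpq).2).2) (fun t => (hbox t).2.2) hKZ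
  exact tendsto_hashEstimator (μ := volume) (ν := volume) (ξ := volume)
    (κ₁ := fun N => cellv (ε N) (b N)) (κ₂ := fun N => cellv (ε N) (b N))
    (κ₃ := fun N => cellv (ε N) (b N)) (g₁ := fun N c => h N ⟨dX, c⟩)
    (g₂ := fun N c => h N ⟨dY, c⟩) (g₃ := fun N c => h N ⟨dZ, c⟩)
    (v₁ := fun N => ε N ^ dX) (v₂ := fun N => ε N ^ dY) (v₃ := fun N => ε N ^ dZ)
    (fun N => measurable_cellv _ _) (fun N => measurable_cellv _ _)
    (fun N => measurable_cellv _ _) (fun N => pow_pos (hε N) _) (fun N => pow_pos (hε N) _)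
    (fun N => pow_pos (hε N) _) (fun N => volume_cellv (hε N) _) (fun N => volume_cellv (hε N) _)
    (fun N => volume_cellv (hε N) _) (by fun_prop) (fun p => (f p).2) hfi hφ hφ0 hφM hM
    hac hlim cX cY cZ hW hwlim

end EuclideanLimit
end

/-! ### The main theorem. -/

theorem theorem1 {Ω : Type*} [MeasurableSpace Ω] (μ : Measure Ω) [IsProbabilityMeasure μ]
    (dX dY dZ : ℕ)
    -- the joint law, with bounded supports and a density that is Hölder on the support
    (P : Measure (Euc dX × Euc dY × Euc dZ)) [IsProbabilityMeasure P]
    (hsuppX : Bornology.IsBounded (P.map (fun p => p.1)).support)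
    (hsuppY : Bornology.IsBounded (P.map (fun p => p.2.1)).support)
    (hsuppZ : Bornology.IsBounded (P.map (fun p => p.2.2)).support)
    (f : Euc dX × Euc dY × Euc dZ → ℝ≥0) (hf : Measurable f)
    (hP : P = volume.withDensity (fun p => (f p : ℝ≥0∞)))
    (C γ : ℝ≥0) (hγ : 0 < γ) (hHolder : HolderOnWith C γ f P.support)
    -- the Radon-Nikodym derivative takes values in the domain `(0, ∞)` of `g`
    (hpos : ∀ᵐ p ∂(refMeasure P), 0 < condRatio P p)
    -- the weight function
    (φ : Euc dX × Euc dY × Euc dZ → ℝ) (hφ : Measurable φ) (hφ_nonneg : ∀ p, 0 ≤ φ p)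
    (M : ℝ) (hφ_bdd : ∀ p, φ p ≤ M)
    -- the samples
    (X : ℕ → Ω → Euc dX) (Y : ℕ → Ω → Euc dY) (Z : ℕ → Ω → Euc dZ)
    (hlaw : ∀ t, HasLaw (fun ω => (X t ω, Y t ω, Z t ω)) P μ)
    (hindep : iIndepFun (fun t ω => (X t ω, Y t ω, Z t ω)) μ)
    -- the bin widths
    (ε : ℕ → ℝ) (hε : ∀ N, 0 < ε N) (hε_lim : Tendsto ε atTop (𝓝 0))
    (hε_rate : Tendsto (fun N : ℕ => (N : ℝ) * ε N ^ (dX + dY + dZ)) atTop atTop)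
    -- the random shifts
    (b : ℕ → Ω → ℝ) (hb : ∀ N, AEMeasurable (b N) μ)
    (hb_mem : ∀ N, ∀ᵐ ω ∂μ, b N ω ∈ Set.Icc 0 (ε N))
    -- the random hash functions, with `cH * N` buckets at sample size `N`
    (cH : ℕ) (hcH : 1 ≤ cH)
    (h : ℕ → (Σ d : ℕ, Fin d → ℤ) → Ω → ℕ)
    (hh_law : ∀ N, 1 ≤ N → ∀ c, HasLaw (h N c) (uniformOn (Set.Icc 1 (cH * N))) μ)
    (hh_indep : ∀ N, 1 ≤ N → iIndepFun (h N) μ)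
    -- samples, shift and hash function are independent at each sample size
    (hbh_indep : ∀ N, 1 ≤ N → IndepFun (b N) (fun ω c => h N c ω) μ)
    (hsample_indep : ∀ N, 1 ≤ N → IndepFun (fun ω t => (X t ω, Y t ω, Z t ω))
      (fun ω => (b N ω, fun c => h N c ω)) μ) :
    -- edge weights that are means of `φ` over the samples on the edge
    (∀ᵐ ω ∂μ, Tendsto
      (fun N : ℕ =>
        let u := label (ε N) (b N ω) (fun c => h N c ω) (fun t => X t ω)
        let v := label (ε N) (b N ω) (fun c => h N c ω) (fun t => Y t ω)
        let s := label (ε N) (b N ω) (fun c => h N c ω) (fun t => Z t ω)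
        hashEstimator N u v s (meanWeight N u v s (fun t => φ (X t ω, Y t ω, Z t ω))))
      atTop (𝓝 (acmi P φ))) ∧
    -- edge weights that are values of `φ` at arbitrary points of the occupied cells
    ((∀ᵐ p ∂P, ContinuousAt φ p) →
      ∀ᵐ ω ∂μ, ∀ w : ℕ → ℕ → ℕ → ℕ → ℝ,
        (∀ N, ∀ e ∈ edges N
            (label (ε N) (b N ω) (fun c => h N c ω) (fun t => X t ω))
            (label (ε N) (b N ω) (fun c => h N c ω) (fun t => Y t ω))
            (label (ε N) (b N ω) (fun c => h N c ω) (fun t => Z t ω)),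
          w N e.1 e.2.1 e.2.2 ∈ φ ''
            (bucket (ε N) (b N ω) (fun c => h N c ω) N (fun t => X t ω) e.1 ×ˢ
              bucket (ε N) (b N ω) (fun c => h N c ω) N (fun t => Y t ω) e.2.1 ×ˢ
              bucket (ε N) (b N ω) (fun c => h N c ω) N (fun t => Z t ω) e.2.2)) →
        Tendsto
          (fun N : ℕ => hashEstimator N
            (label (ε N) (b N ω) (fun c => h N c ω) (fun t => X t ω))
            (label (ε N) (b N ω) (fun c => h N c ω) (fun t => Y t ω))
            (label (ε N) (b N ω) (fun c => h N c ω) (fun t => Z t ω))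
            (w N))
          atTop (𝓝 (acmi P φ))) := by
  have hM : 0 ≤ M := (hφ_nonneg 0).trans (hφ_bdd 0)
  set S : ℕ → Ω → Euc dX × Euc dY × Euc dZ := fun t ω => (X t ω, Y t ω, Z t ω) with hS
  obtain ⟨R, hR, hbox⟩ : ∃ R : ℝ, 0 ≤ R ∧ ∀ᵐ p ∂P, ‖p.1‖ ≤ R ∧ ‖p.2.1‖ ≤ R ∧ ‖p.2.2‖ ≤ R := by
    obtain ⟨R₁, h₁⟩ := exists_norm_le_ae measurable_fst hsuppX
    obtain ⟨R₂, h₂⟩ := exists_norm_le_ae (measurable_fst.comp measurable_snd) hsuppY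
    obtain ⟨R₃, h₃⟩ := exists_norm_le_ae (measurable_snd.comp measurable_snd) hsuppZ
    refine ⟨max 0 (max R₁ (max R₂ R₃)), le_max_left _ _, ?_⟩
    filter_upwards [h₁, h₂, h₃] with p k₁ k₂ k₃
    exact ⟨k₁.trans (by simp), k₂.trans (by simp), k₃.trans (by simp)⟩
  have hsbox : ∀ᵐ ω ∂μ, ∀ t, ‖(S t ω).1‖ ≤ R ∧ ‖(S t ω).2.1‖ ≤ R ∧ ‖(S t ω).2.2‖ ≤ R := by
    refine ae_all_iff.2 fun t => ?_
    refine ae_of_ae_map (p := fun p : Euc dX × Euc dY × Euc dZ =>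
      ‖p.1‖ ≤ R ∧ ‖p.2.1‖ ≤ R ∧ ‖p.2.2‖ ≤ R) (hlaw t).aemeasurable ?_
    rw [(hlaw t).map_eq]
    exact hbox
  have hball : ∀ᵐ ω ∂μ, ∀ N, b N ω ∈ Set.Icc 0 (ε N) := ae_all_iff.2 hb_mem
  have hbind : ∀ N, 1 ≤ N → IndepFun (fun ω t => S t ω) (b N) μ := fun N hN =>
    (hsample_indep N hN).comp measurable_id measurable_fst
  -- Used with ψ = 1 for the density and with ψ = φ for the numerator of the mean weights.
  have hhist : ∀ ψ : Euc dX × Euc dY × Euc dZ → ℝ, Measurable ψ → (∃ B, ∀ p, |ψ p| ≤ B) →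
      ∀ᵐ ω ∂μ, Tendsto (fun N => ∫⁻ p, ‖hist (cell3 (ε N) (b N ω)) (vol3 dX dY dZ (ε N)) N
        (fun t => S t ω) (fun t => ψ (S t ω)) p - ψ p * f p‖ₑ) atTop (𝓝 0) :=
    fun ψ hψ ⟨B, hB⟩ => ae_tendsto_lintegral_hist_sub hf hP hψ hB hlaw hindep hε hε_lim hε_rate hb
      hbind hR hbox hball hsbox
  have hone : ∀ᵐ ω ∂μ, Tendsto (fun N => ∫⁻ p, ‖hist (cell3 (ε N) (b N ω))
      (vol3 dX dY dZ (ε N)) N (fun t => S t ω) 1 p - f p‖ₑ) atTop (𝓝 0) := by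
    filter_upwards [hhist (fun _ => 1) measurable_const ⟨1, by simp⟩] with ω hω
    simp only [one_mul] at hω
    exact hω
  have hL : ∀ N, N ≤ cH * N := fun N => Nat.le_mul_of_pos_left N hcH
  have hKX := ae_tendsto_collisions_cellBox hL hh_law hh_indep hε hε_lim hε_rate
    (show dX ≤ dX + dY + dZ by omega) hR
  have hKY := ae_tendsto_collisions_cellBox hL hh_law hh_indep hε hε_lim hε_rate
    (show dY ≤ dX + dY + dZ by omega) hR
  have hKZ := ae_tendsto_collisions_cellBox hL hh_law hh_indep hε hε_lim hε_rate
    (show dZ ≤ dX + dY + dZ by omega) hR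
  constructor
  · filter_upwards [hone, hball, hsbox, hKX, hKY, hKZ, hhist φ hφ ⟨M, fun p => abs_le.2
      ⟨by linarith [hφ_nonneg p], hφ_bdd p⟩⟩] with ω k1 k2 k3 k4 k5 k6 k7
    refine tendsto_hashEstimator_cells (b := fun N => b N ω) (h := fun N c => h N c ω)
      (s := fun t => S t ω) hf hP hpos hφ hφ_nonneg hφ_bdd hε k1 k2 k3 k4 k5 k6
      (fun N t _ => meanWeight_mem (fun t => ⟨hφ_nonneg _, hφ_bdd _⟩) hM _ _ _) ?_
    have hsum := k7.add (ENNReal.Tendsto.const_mul (a := ENNReal.ofReal M) k1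
      (Or.inr ENNReal.ofReal_ne_top))
    rw [mul_zero, add_zero] at hsum
    refine tendsto_of_tendsto_of_tendsto_of_le_of_le tendsto_const_nhds hsum (fun _ => zero_le)
      fun N => ?_
    have mm : Measurable fun p => ‖hist (cell3 (ε N) (b N ω)) (vol3 dX dY dZ (ε N)) N
        (fun t => S t ω) (fun t => φ (S t ω)) p - φ p * f p‖ₑ := by
      have := measurable_hist (v := vol3 dX dY dZ (ε N)) (N := N) (s := fun t => S t ω)
        (a := fun t => φ (S t ω)) (measurable_cell3 (dX := dX) (dY := dY) (dZ := dZ) (ε N) (b N ω))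
      fun_prop
    simp only
    rw [← lintegral_const_mul' _ _ ENNReal.ofReal_ne_top, ← lintegral_add_left mm]
    refine le_trans ?_ (setLIntegral_le_lintegral (mergedPoints N (cellv (ε N) (b N ω))
      (cellv (ε N) (b N ω)) (cellv (ε N) (b N ω)) (fun c => h N ⟨dX, c⟩ ω)
      (fun c => h N ⟨dY, c⟩ ω) (fun c => h N ⟨dZ, c⟩ ω) (fun t => S t ω))ᶜ _)
    refine setLIntegral_mono' (measurableSet_mergedPoints (measurable_cellv _ _)
      (measurable_cellv _ _) (measurable_cellv _ _)).compl fun p hp => ?_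
    exact enorm_meanWeight_sub_mul_hist_le (v := vol3 dX dY dZ (ε N)) (f := fun p => (f p : ℝ))
      hφ_nonneg hφ_bdd hp
  · intro hcont
    -- The good event does not involve w, so one null set serves all choices of weights.
    filter_upwards [hone, hball, hsbox, hKX, hKY, hKZ] with ω k1 k2 k3 k4 k5 k6 w hw
    have hval : ∀ N, ∀ t < N, ∃ q : Euc dX × Euc dY × Euc dZ,
        w N (h N ⟨dX, cellv (ε N) (b N ω) (S t ω).1⟩ ω)
          (h N ⟨dY, cellv (ε N) (b N ω) (S t ω).2.1⟩ ω)
          (h N ⟨dZ, cellv (ε N) (b N ω) (S t ω).2.2⟩ ω) = φ q ∧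
        ((∃ r < N, cellv (ε N) (b N ω) q.1 = cellv (ε N) (b N ω) (S r ω).1) ∧
          h N ⟨dX, cellv (ε N) (b N ω) q.1⟩ ω =
            h N ⟨dX, cellv (ε N) (b N ω) (S t ω).1⟩ ω) ∧
        ((∃ r < N, cellv (ε N) (b N ω) q.2.1 = cellv (ε N) (b N ω) (S r ω).2.1) ∧
          h N ⟨dY, cellv (ε N) (b N ω) q.2.1⟩ ω =
            h N ⟨dY, cellv (ε N) (b N ω) (S t ω).2.1⟩ ω) ∧
        ((∃ r < N, cellv (ε N) (b N ω) q.2.2 = cellv (ε N) (b N ω) (S r ω).2.2) ∧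
          h N ⟨dZ, cellv (ε N) (b N ω) q.2.2⟩ ω =
            h N ⟨dZ, cellv (ε N) (b N ω) (S t ω).2.2⟩ ω) := by
      intro N t ht
      obtain ⟨q, ⟨⟨⟨r₁, hr₁, e₁⟩, l₁⟩, ⟨⟨r₂, hr₂, e₂⟩, l₂⟩, ⟨r₃, hr₃, e₃⟩, l₃⟩, hq⟩ :=
        hw N _ (Finset.mem_image_of_mem _ (Finset.mem_range.2 ht))
      exact ⟨q, hq.symm, ⟨⟨r₁, hr₁, cell_eq_cell_iff.1 e₁⟩, l₁⟩,
        ⟨⟨r₂, hr₂, cell_eq_cell_iff.1 e₂⟩, l₂⟩, ⟨r₃, hr₃, cell_eq_cell_iff.1 e₃⟩, l₃⟩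
    have hwM : ∀ N, ∀ t < N, w N (h N (cell (ε N) (b N ω) (X t ω)) ω)
        (h N (cell (ε N) (b N ω) (Y t ω)) ω) (h N (cell (ε N) (b N ω) (Z t ω)) ω) ∈
          Set.Icc 0 M := by
      intro N t ht
      obtain ⟨q, hq, -⟩ := hval N t ht
      have : w N (h N (cell (ε N) (b N ω) (X t ω)) ω) (h N (cell (ε N) (b N ω) (Y t ω)) ω)
        (h N (cell (ε N) (b N ω) (Z t ω)) ω) = φ q := hq
      rw [this]
      exact ⟨hφ_nonneg q, hφ_bdd q⟩
    refine tendsto_hashEstimator_cells (b := fun N => b N ω) (h := fun N c => h N c ω)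
      (s := fun t => S t ω) hf hP hpos hφ hφ_nonneg hφ_bdd hε k1 k2 k3 k4 k5 k6 hwM ?_
    have hd : Tendsto (fun N => (√dX + √dY + √dZ) * ε N) atTop (𝓝 0) := by
      simpa using hε_lim.const_mul (√dX + √dY + √dZ)
    refine tendsto_lintegral_sub_mul_of_values hf hP hcont hφ_nonneg hφ_bdd
      (fun N => measurable_hist (measurable_cell3 _ _)) (fun N => cellWeight_mem hM (hwM N)) k1 hd
      (fun N p hp h0 => ?_) (fun N => measurableSet_mergedPoints (measurable_cellv _ _)
      (measurable_cellv _ _) (measurable_cellv _ _))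
    -- A nonzero histogram at p means that its cell holds a sample; the value then comes from a
    -- point of that same cell, at distance O(ε N).
    by_cases hocc : ∃ t < N, cell3 (ε N) (b N ω) (S t ω) = cell3 (ε N) (b N ω) p
    · obtain ⟨t, ht, htp⟩ := hocc
      obtain ⟨q, hq, hwq⟩ := exists_eq_of_cellWeight (κ₁ := cellv (ε N) (b N ω))
        (κ₂ := cellv (ε N) (b N ω)) (κ₃ := cellv (ε N) (b N ω))
        (g₁ := fun c => h N ⟨dX, c⟩ ω) (g₂ := fun c => h N ⟨dY, c⟩ ω) (g₃ := fun c => h N ⟨dZ, c⟩ ω)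
        (s := fun t => S t ω) (hval N) ht htp hp
      exact ⟨q, dist_le_of_cell3_eq (hε N) hq, hwq⟩
    · push Not at hocc
      exact absurd (hist_eq_zero_of_forall_ne hocc) h0
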